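/- **Setting.** Let $G=(V,E)$ be a finite simple graph with $n=|V|$ that has a perfect matching, let $\hat w:E\to\{0,\dots,N\}$ be integer weights, and let $\tau\ge 0$ be an integer. Put $\bar w(e)=(\frac n2+1)\hat w(e)$, and let $K=\lceil\log_2((\frac n2+1)N+1)\rceil$ be the number of bits needed to write the integers $0,\dots,(\frac n2+1)N$. The state consists of a graph with even integer weights $w$, a matching $M$, a nested set $\Omega$ of blossoms $B$ with edge sets $E_B$, and integer duals $y$ (on vertices) and $z\ge 0$ (on vertex sets); $yz(u,v)=y(u)+y(v)+\sum_{B\supseteq\{u,v\}}z(B)$. Single vertices are trivial blossoms with no edges; if $A_0,\dots,A_{\ell-1}$ ($\ell\ge 3$ odd) are disjoint blossoms and $e_i$ is an edge between $A_i$ and $A_{i+1}$ (indices mod $\ell$) with $e_i\in M$ iff $i$ is odd, then $B=\bigcup A_i$ is a blossom with $E_B=\bigcup E_{A_i}\cup\{e_0,\dots,e_{\ell-1}\}$. A root blossom is a member of $\Omega$ maximal under inclusion. A blossom is large if it has at least $\tau$ vertices, and small otherwise. A vertex is free if no edge of $M$ covers it. *Relaxed complementary slackness* (RCS): $w$ is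 even; all $z(B)$ are nonnegative and even; $|M\cap E_B|=\lfloor|B|/2\rfloor$ for $B\in\Omega$; $z(B)>0$ for root blossoms and $z(B)=0$ for $B\notin\Omega$; $yz(e)\ge w(e)-2$ for every edge; and $yz(e)\le w(e)$ for every $e\in M\cup\bigcup_{B\in\Omega}E_B$. *Searches.* Eligibility criteria for an edge $e$: (C1) $yz(e)=w(e)$; (C2) $e$ is in some $E_B$ with $B\in\Omega$, or $e\notin M$ and $yz(e)=w(e)-2$, or $e\in M$ and $yz(e)=w(e)$; (C3) $yz(e)\in\{w(e),w(e)-2\}$. Paths are taken in the graph $\hat G$ of eligible edges with all root blossoms contracted; an augmenting path there is extended through its blossoms to an augmenting path $P$ of the graph, and augmenting sets $M\leftarrow M\oplus P$. For a set $F$ of free vertices, an *adjustment* from $F$ is the following. Let $V_{out}$ consist of the vertices whose contracted vertex is reachable in $\hat G$ from free vertices of $F$ by an even-length alternating path, and $V_{in}$ of the others so reachable by an odd-length one. Add to $\Omega$, with $z=0$, a set of nested blossoms on $V_{out}$ with eligible edges such that any two vertices of $V_{out}$ joined by an unmatched edge of $\hat G$ lie in a common new blossom. Then decrease $y$ by $1$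 on $V_{out}$ and increase it by $1$ on $V_{in}$; add $2$ to $z(B)$ for root blossoms $B\subseteq V_{out}$ and subtract $2$ for root blossoms $B\subseteq V_{in}$. Finally remove root blossoms with $z=0$ from $\Omega$ as long as there are any. $\mathrm{EdmondsSearch}(F)$ repeats: augment as long as $\hat G$ has an augmenting path starting in $F$; halt if at least one was found; otherwise adjust from $F$. It requires that all $y$-values on $F$ have the same parity. $\mathrm{SearchOne}(F)$ (with C2) augments along a maximal set of vertex-disjoint augmenting paths of $\hat G$ starting in $F$, and then adjusts from $F$ once. *The Liquidationist algorithm.* Start with $G$, $w=y=z=0$, $M=\Omega=\emptyset$. For $i=1,\dots,K$ do scale $i$: 1. Let $\Omega'$ be the current $\Omega$; set $M,\Omega\leftarrow\emptyset$. 2. Set $w(e)\leftarrow 2(w(e)+b_i(e))$, with $b_i(e)$ the $i$-th most significant of the $K$ bits of $\bar w(e)$ ($0$ for edges at dummy vertices), $y(u)\leftarrow 2y(u)+3$, and $z\leftarrow 2z$. 3. Liquidate each large $B\in\Omega'$: add $z(B)/2$ to $y(u)$ for all $u\in B$, and set $z(B)\leftarrow0$. 4. Set $w(u,v)\leftarrow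 w(u,v)-y(u)-y(v)$ for all edges, and then $y\leftarrow0$. 5. Liquidate each small $B\in\Omega'$. 6. For each maximal small $B\in\Omega'$, while the largest $y$-value $Y$ of a free vertex of $B$ is positive: let $F$ be the set of free vertices of $B$ with $y$-value $Y$, let $Y'$ be the maximum of $0$ and the $y$-values of the other free vertices of $B$, and run $\mathrm{EdmondsSearch}(F)$ with C1 until it halts or has performed $Y-Y'$ adjustments. 7. Run $\mathrm{SearchOne}(F)$ $\tau$ times, with $F$ the current set of all free vertices. 8. Delete all free dummy vertices; for each remaining free vertex $u$ create a dummy vertex $\hat u$ with $y(\hat u)=\tau$ and a matched edge $(u,\hat u)$ of weight $0$. After scale $K$ delete all dummy vertices. Then, as long as there are free vertices, run $\mathrm{EdmondsSearch}(F)$ with C3, where $F$ is the set of all free vertices whose $y$-value has the same parity as that of some chosen free vertex (so $F$ is the set of all free vertices if their $y$-values have the same parity). Return $M$. **Lemma.** Whatever choices are made where the description leaves them open: (a) the algorithm terminates and never gets stuck; (b) RCS holds initially, after step 5 of each scale, and after every augmentation, every adjustment, every $\mathrm{SearchOne}$, every step 8, and the final deletion of the dummy vertices; and at the end of each scale $M$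 is a perfect matching of the current graph ($G$ supplemented with dummy vertices); (c) the returned $M$ is a perfect matching of $G$ such that, for every perfect matching $M^*$ of $G$, $w(M)\ge w(M^*)-n$ for the final $w$ and $\bar w(M)\ge\bar w(M^*)-\frac n2$; (d) any perfect matching $M$ of $G$ with $\bar w(M)\ge\bar w(M^*)-\frac n2$ for all perfect matchings $M^*$ of $G$ is a maximum weight perfect matching of $G$ with respect to $\hat w$. In particular, the algorithm returns a maximum weight perfect matching of $G$. -/

import Mathlib

open Finset

noncomputable section

namespace MWPM

universe u

/-! ### Matchings -/

section Matching

variable {W : Type u}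

/-- A matching of the graph with edge set `E`: a set of pairwise vertex-disjoint edges. -/
def IsMatching (E M : Finset (Sym2 W)) : Prop :=
  M ⊆ E ∧ ∀ e ∈ M, ∀ f ∈ M, ∀ v, v ∈ e → v ∈ f → e = f

/-- A perfect matching of the graph with vertex set `U` and edge set `E`. -/
def IsPerfectMatching (U : Finset W) (E M : Finset (Sym2 W)) : Prop :=
  IsMatching E M ∧ ∀ v ∈ U, ∃ e ∈ M, v ∈ e

/-- A maximum weight perfect matching with respect to the edge weights `c`. -/
def IsMaxWeightPerfectMatching (U : Finset W) (E : Finset (Sym2 W)) (c : Sym2 W → ℕ)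
    (M : Finset (Sym2 W)) : Prop :=
  IsPerfectMatching U E M ∧
    ∀ M', IsPerfectMatching U E M' → ∑ e ∈ M', c e ≤ ∑ e ∈ M, c e

/-- `y(u) + y(v)` as a function of the edge `s(u, v)`. -/
def endSum (y : W → ℤ) : Sym2 W → ℤ :=
  Sym2.lift ⟨fun u v => y u + y v, fun u v => add_comm (y u) (y v)⟩

end Matching

/-! ### The state of the algorithm: graph, weights, matching, blossoms, duals -/

/-- The graph has vertex set `U` and edge set `E`.  `Ω` is the set of active blossoms (as vertex
sets) and `EB B` is the edge set `E_B` of the blossom `B ∈ Ω`; its value off `Ω` is irrelevant. -/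
structure State (W : Type u) where
  U : Finset W
  E : Finset (Sym2 W)
  w : Sym2 W → ℤ
  M : Finset (Sym2 W)
  Ω : Finset (Finset W)
  EB : Finset W → Finset (Sym2 W)
  y : W → ℤ
  z : Finset W → ℤ

/-- The eligibility criteria.
* `tight`: `yz(e) = w(e)`.
* `batch`: `e` is a blossom edge, or `e ∉ M` and `yz(e) = w(e) - 2`, or `e ∈ M` and
  `yz(e) = w(e)`.
* `near`: `yz(e) = w(e)` or `yz(e) = w(e) - 2`. -/
inductive Criterion : Type
  | tight
  | batch
  | near

section Search

variable {W : Type u} [Fintype W] [DecidableEq W]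

/-- A vertex is free if no matching edge is incident to it. -/
def State.Free (s : State W) (v : W) : Prop := v ∈ s.U ∧ ∀ e ∈ s.M, v ∉ e

open Classical in
/-- The set of all free vertices. -/
def State.freeSet (s : State W) : Finset W := univ.filter fun v => s.Free v

open Classical in
/-- `yz(u,v) = y(u) + y(v) + ∑_{B ⊇ {u,v}} z(B)`. -/
def State.yz (s : State W) (e : Sym2 W) : ℤ :=
  endSum s.y e + ∑ B ∈ univ.filter (fun B : Finset W => ∀ v ∈ e, v ∈ B), s.z B

/-- The edge set `E_A` of a constituent: empty for a trivial blossom (a single vertex). -/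
def State.blossomEdges (s : State W) (A : Finset W) : Finset (Sym2 W) :=
  if A ∈ s.Ω then s.EB A else ∅

/-- `B`, with edge set `EB B`, is a nontrivial blossom whose cycle edges belong to `C`: there are
an odd `ℓ ≥ 3`, disjoint constituents `A 0, …, A (ℓ-1)` with union `B` (blossoms of `Ω` or single
vertices), and cycle edges `e_i ∈ A i × A (i+1)`, indices modulo `ℓ`, with `e_i ∈ M` if and only
if `i` is odd.  The last clause says that the constituents are the children of `B` in the forest
of active blossoms. -/
def State.IsBlossom (s : State W) (C : Sym2 W → Prop) (B : Finset W) : Prop :=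
  ∃ (ℓ : ℕ) (A : ℕ → Finset W) (a b : ℕ → W),
    Odd ℓ ∧ 3 ≤ ℓ ∧ A ℓ = A 0 ∧
    (∀ i < ℓ, ∀ j < ℓ, i ≠ j → Disjoint (A i) (A j)) ∧
    (∀ i < ℓ, A i ∈ s.Ω ∨ ∃ v ∈ s.U, A i = {v}) ∧
    (∀ i < ℓ, a i ∈ A i ∧ b i ∈ A (i + 1) ∧ C s(a i, b i) ∧ (s(a i, b i) ∈ s.M ↔ Odd i)) ∧
    B = (range ℓ).biUnion A ∧
    s.EB B = ((range ℓ).biUnion fun i => s.blossomEdges (A i)) ∪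
      (range ℓ).image (fun i => s(a i, b i)) ∧
    ∀ D ∈ s.Ω, D ⊂ B → ∃ i < ℓ, D ⊆ A i

/-- A nested (laminar) family of sets. -/
def IsNested (Ω : Finset (Finset W)) : Prop :=
  ∀ A ∈ Ω, ∀ B ∈ Ω, A ⊆ B ∨ B ⊆ A ∨ Disjoint A B

/-- A root blossom is an active blossom not contained in any other one. -/
def State.IsRoot (s : State W) (B : Finset W) : Prop :=
  B ∈ s.Ω ∧ ∀ C ∈ s.Ω, B ⊆ C → C = B

/-- Relaxed complementary slackness, for a matching `M`, a nested set `Ω` of blossoms, and duals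
`y`, `z`, with respect to the even edge weights `w`. -/
structure State.RCS (s : State W) : Prop where
  even_weight : ∀ e ∈ s.E, Even (s.w e)
  matching : IsMatching s.E s.M
  nested : IsNested s.Ω
  blossoms : ∀ B ∈ s.Ω, s.IsBlossom (fun e => e ∈ s.E) B
  granularity : ∀ B, 0 ≤ s.z B ∧ Even (s.z B)
  active : ∀ B ∈ s.Ω, (s.M ∩ s.EB B).card = B.card / 2
  root_pos : ∀ B, s.IsRoot B → 0 < s.z B
  inactive : ∀ B, B ∉ s.Ω → s.z B = 0
  near_domination : ∀ e ∈ s.E, s.w e - 2 ≤ s.yz e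
  near_tightness : ∀ e, (e ∈ s.M ∨ ∃ B ∈ s.Ω, e ∈ s.EB B) → s.yz e ≤ s.w e

/-- The edge `e` is eligible under the given criterion. -/
def State.Eligible (s : State W) (c : Criterion) (e : Sym2 W) : Prop :=
  e ∈ s.E ∧
    match c with
    | .tight => s.yz e = s.w e
    | .batch => (∃ B ∈ s.Ω, e ∈ s.EB B) ∨ (e ∉ s.M ∧ s.yz e = s.w e - 2) ∨
        (e ∈ s.M ∧ s.yz e = s.w e)
    | .near => s.yz e = s.w e ∨ s.yz e = s.w e - 2

open Classical in
/-- The vertex of the shrunken graph `G/Ω` that represents `v`: the root blossom containing `v`,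
or `{v}` if there is none. -/
def rootOf (Ω : Finset (Finset W)) (v : W) : Finset W :=
  univ.filter fun u => u = v ∨ ∃ B ∈ Ω, v ∈ B ∧ u ∈ B

/-- `ρ` is a simple alternating path of the shrunken eligible graph that starts at (the root
blossom of) a free vertex of `F`.  The path is listed by its vertices; its `j`-th edge (counted
from `0`) is in `M` if and only if `j` is odd. -/
def State.IsAltPath (s : State W) (c : Criterion) (F : Finset W) (ρ : List (Finset W)) : Prop :=
  ρ.Nodup ∧ (∀ R ∈ ρ, ∃ v ∈ s.U, R = rootOf s.Ω v) ∧
  (∃ R, ρ.head? = some R ∧ ∃ f ∈ F, f ∈ R ∧ s.Free f) ∧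
  ∀ (j : ℕ) (R R' : Finset W), ρ[j]? = some R → ρ[j + 1]? = some R' →
    ∃ u ∈ R, ∃ v ∈ R', s.Eligible c s(u, v) ∧ (s(u, v) ∈ s.M ↔ Odd j)

/-- An augmenting path of the shrunken eligible graph from a free vertex of `F`. -/
def State.IsAugPath (s : State W) (c : Criterion) (F : Finset W) (ρ : List (Finset W)) : Prop :=
  s.IsAltPath c F ρ ∧ Even ρ.length ∧
    ∃ R, ρ.getLast? = some R ∧ ∃ g ∈ R, s.Free g

/-- `V_out`: the vertices whose root blossom is reachable from a free vertex of `F` by an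
even-length alternating path of the shrunken eligible graph. -/
def State.Outer (s : State W) (c : Criterion) (F : Finset W) (v : W) : Prop :=
  v ∈ s.U ∧ ∃ ρ, s.IsAltPath c F ρ ∧ Odd ρ.length ∧ ρ.getLast? = some (rootOf s.Ω v)

/-- `V_in`: the vertices not in `V_out` whose root blossom is reachable from a free vertex of `F`
by an odd-length alternating path of the shrunken eligible graph. -/
def State.Inner (s : State W) (c : Criterion) (F : Finset W) (v : W) : Prop :=
  v ∈ s.U ∧ ¬ s.Outer c F v ∧
    ∃ ρ, s.IsAltPath c F ρ ∧ Even ρ.length ∧ ρ.getLast? = some (rootOf s.Ω v)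

/-- The augmenting path `P` of `G` (listed by its vertices) extends the augmenting path `ρ` of the
shrunken eligible graph: contracting the root blossoms turns `P` into `ρ`, edges between different
root blossoms are eligible, and `P` runs through every active blossom `B` that it meets (nested
ones included) along one even-length stretch of edges of `E_B`, i.e. passes it as an alternating
path passes a single vertex. -/
structure State.Extends (s : State W) (c : Criterion) (ρ : List (Finset W)) (P : List W) :
    Prop where
  nodup : P.Nodup
  contracts : (P.map (rootOf s.Ω)).destutter (· ≠ ·) = ρ
  free_ends : ∀ v, P.head? = some v ∨ P.getLast? = some v → s.Free v
  alternating : ∀ (j : ℕ) (u v : W), P[j]? = some u → P[j + 1]? = some v →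
    s(u, v) ∈ s.E ∧ (s(u, v) ∈ s.M ↔ Odd j) ∧
      (rootOf s.Ω u ≠ rootOf s.Ω v → s.Eligible c s(u, v))
  stretch : ∀ B ∈ s.Ω, ∃ a b : ℕ, b ≤ P.length ∧ (a < b → Odd (b - a)) ∧
    ∀ (j : ℕ) (v : W), P[j]? = some v → (v ∈ B ↔ a ≤ j ∧ j < b)
  inside : ∀ B ∈ s.Ω, ∀ (j : ℕ) (u v : W), P[j]? = some u → P[j + 1]? = some v →
    u ∈ B → v ∈ B → s(u, v) ∈ s.EB B

/-- The edge set of the path listed by its vertices. -/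
def pathEdges (P : List W) : Finset (Sym2 W) :=
  ((P.zip P.tail).map fun p => s(p.1, p.2)).toFinset

/-- One augmentation `M ← M ⊕ P` along an augmenting path of the shrunken eligible graph. -/
def Augment (c : Criterion) (F : Finset W) (s s' : State W) : Prop :=
  ∃ ρ P, s.IsAugPath c F ρ ∧ s.Extends c ρ P ∧
    s' = { s with M := symmDiff s.M (pathEdges P) }

/-- Augmentation along a maximal set of vertex-disjoint augmenting paths. -/
def AugmentMaximal (c : Criterion) (F : Finset W) (s s' : State W) : Prop :=
  ∃ (Ψ : List (List (Finset W))) (Ps : List (List W)),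
    (∀ ρ ∈ Ψ, s.IsAugPath c F ρ) ∧ Ψ.Pairwise List.Disjoint ∧
    (∀ ρ, s.IsAugPath c F ρ → ∃ ρ' ∈ Ψ, ¬ List.Disjoint ρ ρ') ∧
    List.Forall₂ (s.Extends c) Ψ Ps ∧
    s' = { s with M := symmDiff s.M (Ps.toFinset.biUnion pathEdges) }

/-- Blossom Shrinking: a maximal set `Ωnew` of nested blossoms on `V_out`, formed by eligible
edges, is added with `z`-value `0`; maximality means that two vertices of `V_out` joined by an
unmatched edge of the shrunken eligible graph are in a common blossom of `Ωnew`. -/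
def Shrink (c : Criterion) (F : Finset W) (s s' : State W) : Prop :=
  ∃ (Ωnew : Finset (Finset W)) (EB' : Finset W → Finset (Sym2 W)),
    s' = { s with
            Ω := s.Ω ∪ Ωnew
            EB := EB'
            z := fun B => if B ∈ Ωnew then 0 else s.z B } ∧
    (∀ B ∈ s.Ω, EB' B = s.EB B) ∧
    IsNested s'.Ω ∧
    (∀ B ∈ Ωnew, (∀ v ∈ B, s.Outer c F v) ∧ (∀ C ∈ s.Ω, ¬ B ⊆ C) ∧
      s'.IsBlossom (s.Eligible c) B) ∧
    ∀ u v, s.Eligible c s(u, v) → s(u, v) ∉ s.M → s.Outer c F u → s.Outer c F v →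
      rootOf s.Ω u ≠ rootOf s.Ω v → ∃ B ∈ Ωnew, u ∈ B ∧ v ∈ B

open Classical in
/-- Dual Adjustment of the state `t` that results from shrinking; `V_out` and `V_in` are those
computed in the state `s` before shrinking. -/
def adjust (c : Criterion) (F : Finset W) (s t : State W) : State W :=
  { t with
    y := fun v => if s.Outer c F v then t.y v - 1 else if s.Inner c F v then t.y v + 1 else t.y v
    z := fun B =>
      if t.IsRoot B ∧ ∀ v ∈ B, s.Outer c F v then t.z B + 2
      else if t.IsRoot B ∧ ∀ v ∈ B, s.Inner c F v then t.z B - 2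
      else t.z B }

open Classical in
/-- Blossom Dissolution: root blossoms with zero `z`-value are dissolved as long as they exist.
A blossom thus survives if and only if it is contained in an active blossom (possibly itself)
with nonzero `z`-value. -/
def dissolve (s : State W) : State W :=
  { s with Ω := s.Ω.filter fun B => ∃ C ∈ s.Ω, B ⊆ C ∧ s.z C ≠ 0 }

/-- Blossom Shrinking, one Dual Adjustment, and Blossom Dissolution. -/
def ShrinkAdjustDissolve (c : Criterion) (F : Finset W) (s s' : State W) : Prop :=
  ∃ t, Shrink c F s t ∧ s' = dissolve (adjust c F s t)

/-- `SearchOne(F)`, with the `batch` criterion. -/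
def SearchOne (F : Finset W) (s s' : State W) : Prop :=
  ∃ t, AugmentMaximal .batch F s t ∧ ShrinkAdjustDissolve .batch F t s'

/-- `Liquidate(B)` for all `B` in `S`, apart from dissolving them. -/
def liquidate (S : Finset (Finset W)) (s : State W) : State W :=
  { s with
    y := fun v => s.y v + ∑ B ∈ S with v ∈ B, s.z B / 2
    z := fun B => if B ∈ S then 0 else s.z B }

/-- Reweighting: `w(u,v) ← w(u,v) - y(u) - y(v)` and `y ← 0`. -/
def reweight (s : State W) : State W :=
  { s with w := fun e => s.w e - endSum s.y e, y := fun _ => 0 }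

/-- The maximal small blossoms of `Ω`; small means fewer than `τ` vertices. -/
def maximalSmall (τ : ℕ) (Ω : Finset (Finset W)) : Finset (Finset W) :=
  Ω.filter fun B => B.card < τ ∧ ∀ C ∈ Ω, C.card < τ → B ⊆ C → C = B

/-- Initialization, Scaling, Large Blossom Liquidation, Reweighting, and the liquidation of the
small blossoms; `bit e` is the next bit of the weight of `e`. -/
def startScale (τ : ℕ) (bit : Sym2 W → ℤ) (s : State W) : State W :=
  let s₂ : State W :=
    { s with
      M := ∅
      w := fun e => 2 * (s.w e + bit e)
      y := fun v => 2 * s.y v + 3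
      z := fun B => 2 * s.z B }
  let s₄ := reweight (liquidate (s.Ω.filter fun B => τ ≤ B.card) s₂)
  let s₅ := liquidate (s.Ω.filter fun B => B.card < τ) s₄
  { s₅ with Ω := ∅, EB := fun _ => ∅ }

end Search

/-! ### Dummy vertices: in `V ⊕ V`, the vertex `inl u` is `u` and `inr u` is its dummy mate -/

section Dummies

variable {V : Type u} [Fintype V] [DecidableEq V]

/-- Edge weights on the supplemented graph: zero on the edges at dummies. -/
def liftWeight (c : Sym2 V → ℕ) : Sym2 (V ⊕ V) → ℕ :=
  Sym2.lift ⟨fun a b =>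
    match a, b with
    | .inl u, .inl v => c s(u, v)
    | _, _ => 0, by
      rintro (u | u) (v | v) <;> simp [Sym2.eq_swap]⟩

open Classical in
/-- Perfection: delete all free dummies; for each remaining free vertex `u` create a dummy with
`y`-value `τ` and a zero-weight matched edge to `u`. -/
def perfection (τ : ℕ) (s : State (V ⊕ V)) : State (V ⊕ V) :=
  let freeDummies : Finset (V ⊕ V) := s.freeSet.filter fun v => v.isRight
  let freeOriginals : Finset V := univ.filter fun u => s.Free (.inl u)
  let newEdges : Finset (Sym2 (V ⊕ V)) :=
    freeOriginals.image fun u => s(Sum.inl u, Sum.inr u)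
  { s with
    U := (s.U \ freeDummies) ∪ freeOriginals.image Sum.inr
    E := (s.E.filter fun e => ∀ v ∈ e, v ∉ freeDummies) ∪ newEdges
    M := s.M ∪ newEdges
    w := fun e => if e ∈ newEdges then 0 else s.w e
    y := fun v => if v ∈ freeOriginals.image Sum.inr then (τ : ℤ) else s.y v }

open Classical in
/-- Delete all dummy vertices. -/
def deleteDummies (s : State (V ⊕ V)) : State (V ⊕ V) :=
  { s with
    U := s.U.filter fun v => v.isLeft
    E := s.E.filter fun e => ∀ v ∈ e, v.isLeft
    M := s.M.filter fun e => ∀ v ∈ e, v.isLeft }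

open Classical in
/-- The edges of the original graph that are in the current matching. -/
def State.output (s : State (V ⊕ V)) : Finset (Sym2 V) :=
  univ.filter fun e => e.map Sum.inl ∈ s.M

end Dummies

/-! ### The algorithm as a transition system -/

/-- The control points.
* `scaleEnd i`: `i` scales have been completed.
* `small i R`: scale `i`, loop over the maximal old small blossoms; those in `R` are still to do.
* `smallLoop i R B`: the while loop for the old small blossom `B`.
* `search c F k found r`: inside `EdmondsSearch(F)` with criterion `c`, where at most `k` further
  dual adjustments are allowed, `found` says whether an augmenting path was found, and `r` is the
  control point to return to.
* `reduction i k`: scale `i`, Free Vertex Reduction, `k` calls of `SearchOne` still to do.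
* `finalization`, `done`: the loop of the Finalization step, and the end of the algorithm. -/
inductive Control (W : Type u) : Type u
  | scaleEnd (i : ℕ)
  | small (i : ℕ) (R : Finset (Finset W))
  | smallLoop (i : ℕ) (R : Finset (Finset W)) (B : Finset W)
  | search (c : Criterion) (F : Finset W) (k : ℕ∞) (found : Bool) (r : Control W)
  | reduction (i k : ℕ)
  | finalization
  | done

section Algorithm

variable {V : Type u} [Fintype V] [DecidableEq V]

/-- The extended weight function `w̄ = (n/2 + 1) ŵ`.  (`n` is even if there is a perfect
matching.) -/
def extWeight (c : Sym2 V → ℕ) (e : Sym2 V) : ℕ := (Fintype.card V / 2 + 1) * c e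

/-- The number of scales, i.e. of bits needed to write all numbers up to `(n/2 + 1) N`. -/
def numScales (V : Type u) [Fintype V] (N : ℕ) : ℕ :=
  Nat.clog 2 ((Fintype.card V / 2 + 1) * N + 1)

/-- The `i`-th bit (`i = 1` is the most significant one) of the extended weight of `e`, written
with `numScales V N` bits. -/
def weightBit (c : Sym2 V → ℕ) (N i : ℕ) (e : Sym2 (V ⊕ V)) : ℤ :=
  if (liftWeight (extWeight c) e).testBit (numScales V N - i) then 1 else 0

/-- The initial state: the input graph, with everything else zero or empty. -/
def initialState (G : SimpleGraph V) [DecidableRel G.Adj] : State (V ⊕ V) where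
  U := univ.image Sum.inl
  E := G.edgeFinset.image (Sym2.map Sum.inl)
  w := fun _ => 0
  M := ∅
  Ω := ∅
  EB := fun _ => ∅
  y := fun _ => 0
  z := fun _ => 0

open Classical in
/-- The possible steps of the algorithm `Liquidationist` with parameter `τ` on edge weights `c`
bounded by `N`. -/
inductive Step (c : Sym2 V → ℕ) (N τ : ℕ) :
    Control (V ⊕ V) × State (V ⊕ V) → Control (V ⊕ V) × State (V ⊕ V) → Prop
  -- scale `i + 1` begins, up to and including the liquidation of all old blossoms
  | start (i : ℕ) (s : State (V ⊕ V)) (hi : i < numScales V N) :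
      Step c N τ (.scaleEnd i, s)
        (.small (i + 1) (maximalSmall τ s.Ω), startScale τ (weightBit c N (i + 1)) s)
  -- Small Blossom Liquidation: for each maximal old small blossom `B`
  | smallPick (i : ℕ) (R : Finset (Finset (V ⊕ V))) (B : Finset (V ⊕ V)) (s : State (V ⊕ V))
      (hB : B ∈ R) :
      Step c N τ (.small i R, s) (.smallLoop i (R.erase B) B, s)
  | smallDone (i : ℕ) (s : State (V ⊕ V)) :
      Step c N τ (.small i ∅, s) (.reduction i τ, s)
  -- while the largest `y`-value `Y` of a free vertex of `B` is positive: search from the free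
  -- vertices `F` of `B` with this `y`-value, for at most `Y - Y'` dual adjustments
  | smallEnter (i : ℕ) (R : Finset (Finset (V ⊕ V))) (B F : Finset (V ⊕ V)) (s : State (V ⊕ V))
      (Y Y' : ℤ) (hY : IsGreatest {t | ∃ u ∈ B, s.Free u ∧ s.y u = t} Y) (hpos : 0 < Y)
      (hF : F = B.filter fun u => s.Free u ∧ s.y u = Y)
      (hY' : IsGreatest ({0} ∪ {t | ∃ u ∈ B, u ∉ F ∧ s.Free u ∧ s.y u = t}) Y') :
      Step c N τ (.smallLoop i R B, s)
        (.search .tight F ((Y - Y').toNat : ℕ∞) false (.smallLoop i R B), s)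
  | smallExit (i : ℕ) (R : Finset (Finset (V ⊕ V))) (B : Finset (V ⊕ V)) (s : State (V ⊕ V))
      (h : ∀ u ∈ B, s.Free u → s.y u ≤ 0) :
      Step c N τ (.smallLoop i R B, s) (.small i R, s)
  -- `EdmondsSearch(F)`: while there is an augmenting path, augment
  | searchAugment (a : Criterion) (F : Finset (V ⊕ V)) (k : ℕ∞) (found : Bool)
      (r : Control (V ⊕ V)) (s s' : State (V ⊕ V)) (hk : k ≠ 0) (h : Augment a F s s') :
      Step c N τ (.search a F k found r, s) (.search a F k true r, s')
  -- no augmenting path was found: shrink, adjust the duals, dissolve, and go on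
  | searchAdjust (a : Criterion) (F : Finset (V ⊕ V)) (k : ℕ∞) (r : Control (V ⊕ V))
      (s s' : State (V ⊕ V)) (hk : k ≠ 0) (hno : ¬ ∃ ρ, s.IsAugPath a F ρ)
      (h : ShrinkAdjustDissolve a F s s') :
      Step c N τ (.search a F k false r, s) (.search a F (k - 1) false r, s')
  -- an augmenting path was found and there are no more: halt
  | searchFound (a : Criterion) (F : Finset (V ⊕ V)) (k : ℕ∞) (r : Control (V ⊕ V))
      (s : State (V ⊕ V)) (hk : k ≠ 0) (hno : ¬ ∃ ρ, s.IsAugPath a F ρ) :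
      Step c N τ (.search a F k true r, s) (r, s)
  -- the allowed number of dual adjustments has been performed: halt
  | searchBudget (a : Criterion) (F : Finset (V ⊕ V)) (found : Bool) (r : Control (V ⊕ V))
      (s : State (V ⊕ V)) :
      Step c N τ (.search a F 0 found r, s) (r, s)
  -- Free Vertex Reduction: `τ` calls of `SearchOne` from the current set of free vertices
  | reduce (i k : ℕ) (s s' : State (V ⊕ V)) (h : SearchOne s.freeSet s s') :
      Step c N τ (.reduction i (k + 1), s) (.reduction i k, s')
  -- Perfection
  | perfect (i : ℕ) (s : State (V ⊕ V)) :
      Step c N τ (.reduction i 0, s) (.scaleEnd i, perfection τ s)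
  -- Finalization: `EdmondsSearch(F)` until there is no free vertex.  The search requires all
  -- `y`-values on `F` to have the same parity, so `F` consists of the free vertices whose
  -- `y`-value has the parity of `y(u)`, where `u` is free: of all free vertices, if their
  -- `y`-values have the same parity.
  | finalize (s : State (V ⊕ V)) :
      Step c N τ (.scaleEnd (numScales V N), s) (.finalization, deleteDummies s)
  | finalSearch (s : State (V ⊕ V)) (u : V ⊕ V) (hu : s.Free u) :
      Step c N τ (.finalization, s)
        (.search .near (s.freeSet.filter fun v => Even (s.y v - s.y u)) ⊤ false .finalization, s)
  | finalDone (s : State (V ⊕ V)) (h : ∀ v, ¬ s.Free v) :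
      Step c N τ (.finalization, s) (.done, s)

/-- The configurations that some execution on the weighted graph `(G, c)` reaches. -/
def Reachable (G : SimpleGraph V) [DecidableRel G.Adj] (c : Sym2 V → ℕ) (N τ : ℕ)
    (x : Control (V ⊕ V) × State (V ⊕ V)) : Prop :=
  Relation.ReflTransGen (Step c N τ) (.scaleEnd 0, initialState G) x

end Algorithm

end MWPM

end

/-! The proof is an invariant argument over all executions. The core invariant `State.Good` is RCS
together with two sanity conditions on the graph and the fact that `y` has constant parity on every
blossom. `Inv` adds, for each control point, what is known about the graph, the weights and the
duals of free vertices. `Inv.step` preserves it, `Inv.progress` shows that only the end of the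
algorithm has no successor, and `Inv.rank_lt` makes a lexicographic rank fall at every step.

Adjustments rest on a flower lemma, `AltGraph.exists_flower`: without augmenting paths, an unmatched
edge between two outer nodes yields an odd alternating cycle on an even stem. Contracting it creates
neither an augmenting path nor a new outer vertex, because paths lift back with their parity
(`AltGraph.Contracts`). Iterating, every unmatched edge between outer nodes is absorbed by a
blossom, so Blossom Shrinking is possible; then no matched edge between distinct outer roots is left
either (`ShrinkData.rootOf_eq_of_matched`). Hence `yz` falls only on ineligible unmatched edges, and
it rises on a matched edge only if that edge is ineligible. When `yz` moves by 2, both ends are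
reached, so their duals have equal parity and `yz` is even like `w`: the slack is then enough.

Augmentations pass through each blossom along an odd stretch of vertices, so the number of matched
edges in `E_B` is unchanged. The alternating pattern around every blossom cycle is recovered from
this count alone: nonadjacent matched cycle edges in maximal number must alternate after a rotation
(`exists_rotation`, `State.Struct.isBlossom_of_cycle`). Therefore the bookkeeping keeps the
matching-free structure `State.Cycle` and the count, not `IsBlossom`. Conversely, contracted paths
are expanded through nested blossoms by `State.Struct.exists_piece` and
`State.Struct.exists_extends`. After a maximal batch augmentation, every root that was met has an
ineligible matched edge and blocks all paths (`AugmentMaximal.noAug`).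

Summing `yz` over a perfect matching and over `M` gives `State.Good.weight_le`: a perfect matching
exceeds `M` by at most the sum of the free duals plus the number of vertices. This bounds the
adjustments in Finalization, and without free vertices it is the error `n`. After all scales `w` is
twice the extended weight up to vertex terms, which are constant on perfect matchings, so the error
is at most `n / 2` there; extended weights of matchings being multiples of `n / 2 + 1`, the result
is exactly optimal. -/

noncomputable section

set_option linter.unusedSectionVars false

namespace MWPM

universe u

/-! ### Alternating lists -/

section Chains
variable {α : Type*}

/-- Consecutive members of the list are related by `r b`, `r (!b)`, `r b`, … -/
def AltChain (r : Bool → α → α → Prop) : Bool → List α → Prop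
  | _, [] => True
  | _, [_] => True
  | b, x :: y :: l => r b x y ∧ AltChain r (!b) (y :: l)

variable {r : Bool → α → α → Prop}

@[simp] theorem altChain_nil (b : Bool) : AltChain r b [] := trivial

@[simp] theorem altChain_singleton (b : Bool) (x : α) : AltChain r b [x] := trivial

theorem altChain_cons (b : Bool) (x : α) (l : List α) :
    AltChain r b (x :: l) ↔ AltChain r (!b) l ∧ ∀ y, l.head? = some y → r b x y := by
  cases l with
  | nil => simp
  | cons y l => simp [AltChain, and_comm]

/-- Only the parity of the position counts. The second list starts at position `l.length`; the edge
joining the lists sits one earlier, which has the parity of `l.length + 1`. -/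
theorem altChain_append (b : Bool) (l m : List α) :
    AltChain r b (l ++ m) ↔ AltChain r b l ∧ AltChain r (b ^^ l.length.bodd) m ∧
      ∀ x y, l.getLast? = some x → m.head? = some y → r (b ^^ (l.length + 1).bodd) x y := by
  induction l generalizing b with
  | nil => simp
  | cons x l ih =>
    rw [List.cons_append, altChain_cons, ih, altChain_cons]
    cases l with
    | nil => cases b <;> simp <;> grind
    | cons y l =>
      simp only [List.length_cons, Nat.bodd_succ, List.cons_append, List.head?_cons,
        List.getLast?_cons_cons]
      cases b <;> simp <;> tauto

theorem altChain_iff_getElem (b : Bool) (l : List α) :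
    AltChain r b l ↔ ∀ (j : ℕ) (x y : α), l[j]? = some x → l[j + 1]? = some y →
      r (b ^^ j.bodd) x y := by
  induction l generalizing b with
  | nil => simp
  | cons x l ih =>
    rw [altChain_cons, ih]
    constructor
    · rintro ⟨h1, h2⟩ j u v hu hv
      cases j with
      | zero => simp at hu hv; subst hu; simpa using h2 v (by rw [List.head?_eq_getElem?]; exact hv)
      | succ j => simpa using h1 j u v (by simpa using hu) (by simpa using hv)
    · intro h
      refine ⟨fun j u v hu hv => ?_, fun y hy => ?_⟩
      · simpa using h (j + 1) u v (by simpa using hu) (by simpa using hv)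
      · simpa using h 0 x y (by simp) (by rw [List.head?_eq_getElem?] at hy; simpa using hy)

/-- With `n` vertices, reversal sends edge `j` to edge `n - 2 - j`, so the flag shifts by the parity
of `n`. -/
theorem altChain_reverse (hr : ∀ b x y, r b x y → r b y x) (b : Bool) (l : List α)
    (h : AltChain r b l) : AltChain r (b ^^ l.length.bodd) l.reverse := by
  induction l generalizing b with
  | nil => simp
  | cons x l ih =>
    rw [altChain_cons] at h
    rw [List.reverse_cons, altChain_append]
    refine ⟨by simpa using ih _ h.1, by simp, ?_⟩
    intro u v hu hv
    simp at hu hv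
    subst hv
    have := hr _ _ _ (h.2 u hu)
    simpa using this

theorem altChain_mono {r' : Bool → α → α → Prop} (b : Bool) (l : List α)
    (hr : ∀ b, ∀ x ∈ l, ∀ y ∈ l, r b x y → r' b x y) (h : AltChain r b l) :
    AltChain r' b l := by
  rw [altChain_iff_getElem] at h ⊢
  intro j x y hx hy
  exact hr _ x (List.mem_of_getElem? hx) y (List.mem_of_getElem? hy) (h j x y hx hy)

theorem exists_first {p : α → Prop} : ∀ {l : List α}, (∃ x ∈ l, p x) →
    ∃ l₁ x l₂, l = l₁ ++ x :: l₂ ∧ p x ∧ ∀ y ∈ l₁, ¬ p y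
  | [], h => by simp at h
  | a :: l, h => by
    by_cases ha : p a
    · exact ⟨[], a, l, rfl, ha, by simp⟩
    · obtain ⟨l₁, x, l₂, rfl, hx, hl⟩ := exists_first (p := p) (l := l) (by
        obtain ⟨x, hx, hp⟩ := h
        rcases List.mem_cons.1 hx with rfl | hx
        · exact absurd hp ha
        · exact ⟨x, hx, hp⟩)
      refine ⟨a :: l₁, x, l₂, rfl, hx, ?_⟩
      intro y hy
      rcases List.mem_cons.1 hy with rfl | hy
      · exact ha
      · exact hl y hy

theorem eq_nil_or_snoc (l : List α) : l = [] ∨ ∃ l' x, l = l' ++ [x] := by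
  rcases List.eq_nil_or_concat l with h | ⟨l', x, h⟩
  · exact Or.inl h
  · exact Or.inr ⟨l', x, by simpa using h⟩

theorem bodd_of_odd {n : ℕ} (h : Odd n) : n.bodd = true := by
  obtain ⟨k, rfl⟩ := h
  rw [Nat.bodd_add, Nat.bodd_mul]
  rfl

theorem bodd_of_even {n : ℕ} (h : Even n) : n.bodd = false := by
  obtain ⟨k, rfl⟩ := h
  rw [Nat.bodd_add, Bool.xor_self]

theorem odd_iff_bodd {n : ℕ} : Odd n ↔ n.bodd = true := by
  refine ⟨bodd_of_odd, fun h => ?_⟩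
  by_contra hn
  rw [Nat.not_odd_iff_even] at hn
  simp [bodd_of_even hn] at h

end Chains

/-! ### Alternating reachability in an abstract graph with a matching -/

/-- `r true` are the matching edges, `r false` the other edges, `T` the free vertices and `S` the
free vertices from which paths start. -/
structure AltGraph (α : Type*) where
  r : Bool → α → α → Prop
  S : α → Prop
  T : α → Prop
  symm : ∀ {b x y}, r b x y → r b y x
  ne : ∀ {b x y}, r b x y → x ≠ y
  func : ∀ {x y z}, r true x y → r true x z → y = z
  start_free : ∀ {x}, S x → T x
  free_unmatched : ∀ {x y}, T x → ¬ r true x y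

namespace AltGraph
variable {α : Type*} (g : AltGraph α)

def IsPath (l : List α) : Prop :=
  l.Nodup ∧ AltChain g.r false l ∧ ∃ x, l.head? = some x ∧ g.S x

/-- Reachability by an even number of edges. -/
def Out (x : α) : Prop := ∃ l, g.IsPath (l ++ [x]) ∧ Even l.length

/-- Reachability by an odd number of edges. -/
def In (x : α) : Prop := ∃ l, g.IsPath (l ++ [x]) ∧ Odd l.length

def NoAug : Prop := ∀ x, g.T x → ¬ g.In x

variable {g}

theorem IsPath.prefix {l m : List α} (h : g.IsPath (l ++ m)) (hl : l ≠ []) : g.IsPath l := by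
  obtain ⟨h1, h2, x, hx, hS⟩ := h
  refine ⟨(List.nodup_append.1 h1).1, ((altChain_append _ _ _).1 h2).1, x, ?_, hS⟩
  cases l with
  | nil => exact absurd rfl hl
  | cons a l => simpa using hx

theorem IsPath.prefix' {l m : List α} {x : α} (h : g.IsPath (l ++ x :: m)) :
    g.IsPath (l ++ [x]) := by
  apply IsPath.prefix (m := m) _ (by simp)
  simpa using h

theorem IsPath.edge {l m : List α} {x y : α} (h : g.IsPath (l ++ x :: y :: m)) :
    g.r l.length.bodd x y := by
  have := ((altChain_append _ _ _).1 h.2.1).2.1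
  simpa using this.1

theorem IsPath.start {m : List α} {x : α} (h : g.IsPath (x :: m)) : g.S x := by
  obtain ⟨_, _, y, hy, hS⟩ := h
  simp at hy
  exact hy ▸ hS

theorem isPath_snoc {l : List α} {x y : α} (h : g.IsPath (l ++ [x])) (hy : y ∉ l ++ [x])
    (hr : g.r l.length.bodd x y) : g.IsPath (l ++ [x] ++ [y]) := by
  obtain ⟨h1, h2, z, hz, hS⟩ := h
  refine ⟨?_, ?_, z, ?_, hS⟩
  · rw [List.nodup_append]
    refine ⟨h1, by simp, ?_⟩
    rintro a ha b hb rfl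
    simp at hb
    subst hb
    exact hy ha
  · rw [altChain_append]
    refine ⟨h2, by simp, ?_⟩
    intro u v hu hv
    simp at hu hv
    subst hu hv
    simpa using hr
  · cases l <;> simpa using hz

theorem out_or_in_of_mem {l : List α} {y : α} (h : g.IsPath l) (hy : y ∈ l) :
    g.Out y ∨ g.In y := by
  obtain ⟨l₁, l₂, rfl⟩ := List.append_of_mem hy
  rcases Nat.even_or_odd l₁.length with he | ho
  · exact Or.inl ⟨l₁, h.prefix', he⟩
  · exact Or.inr ⟨l₁, h.prefix', ho⟩

theorem out_of_start {x : α} (h : g.S x) : g.Out x :=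
  ⟨[], ⟨by simp, by simp, x, rfl, h⟩, by simp⟩

/-- The path to `x` can be prolonged to `y` unless it visits `y` already, in which case a prefix
reaches `y` with one parity or the other. -/
theorem Out.unmatched {x y : α} (h : g.Out x) (hr : g.r false x y) : g.Out y ∨ g.In y := by
  obtain ⟨l, hl, he⟩ := h
  by_cases hy : y ∈ l ++ [x]
  · exact out_or_in_of_mem hl hy
  · refine Or.inr ⟨l ++ [x], isPath_snoc hl hy ?_, ?_⟩
    · rwa [bodd_of_even he]
    · simpa using he.add_one

/-- If the path already visits the mate of its last vertex at an odd position, the next edge there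
is matched and leads to the last vertex, so that vertex has even position, against the assumption.
-/
theorem In.matched {x y : α} (h : g.In x) (hr : g.r true x y) : g.Out y := by
  obtain ⟨l, hl, ho⟩ := h
  by_cases hy : y ∈ l ++ [x]
  · obtain ⟨l₁, l₂, h12⟩ := List.append_of_mem hy
    rcases Nat.even_or_odd l₁.length with he | ho'
    · rw [h12] at hl
      exact ⟨l₁, hl.prefix', he⟩
    · exfalso
      rcases l₂ with _ | ⟨z, l₂⟩
      · have : y = x := by
          have := congrArg List.getLast? h12
          simpa using this.symm
        exact g.ne hr this.symm
      · have h1 := hl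
        rw [h12] at h1
        have h2 := h1.edge
        rw [bodd_of_odd ho'] at h2
        have h3 := g.func h2 (g.symm hr)
        subst h3
        -- `z` is the last element
        have hnd := hl.1
        rcases eq_nil_or_snoc l₂ with rfl | ⟨l₃, w, rfl⟩
        · have := congrArg List.length h12
          simp at this
          rw [this] at ho
          exact absurd ho (by simpa using ho'.add_one)
        · have hw : w = z := by
            have := congrArg List.getLast? h12
            simpa [List.getLast?_cons] using this.symm
          subst hw
          rw [h12] at hnd
          simp [List.nodup_append] at hnd
  · refine ⟨l ++ [x], isPath_snoc hl hy ?_, ?_⟩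
    · rwa [bodd_of_odd ho]
    · simpa using ho.add_one

theorem Out.start_or_mate {x : α} (h : g.Out x) : g.S x ∨ ∃ y, g.r true x y ∧ g.In y := by
  obtain ⟨l, hl, he⟩ := h
  rcases eq_nil_or_snoc l with rfl | ⟨l', y, rfl⟩
  · exact Or.inl hl.start
  · have ho : Odd l'.length := by
      simp at he
      by_contra hn
      rw [Nat.not_odd_iff_even] at hn
      exact absurd he (by simpa using hn.add_one)
    have h1 : g.IsPath (l' ++ y :: [x]) := by simpa using hl
    have h2 := h1.edge
    rw [bodd_of_odd ho] at h2
    exact Or.inr ⟨y, g.symm h2, l', h1.prefix', ho⟩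

/-- On a path with an odd number of vertices all mates of vertices are on the path. -/
theorem IsPath.mate_mem {l : List α} {x y : α} (h : g.IsPath l) (hl : Odd l.length) (hx : x ∈ l)
    (hr : g.r true x y) : y ∈ l := by
  obtain ⟨l₁, l₂, rfl⟩ := List.append_of_mem hx
  rcases Nat.even_or_odd l₁.length with he | ho
  · obtain rfl | ⟨l', z, rfl⟩ := eq_nil_or_snoc l₁
    · exact absurd hr (g.free_unmatched (g.start_free h.start))
    · have h1 : g.IsPath (l' ++ z :: x :: l₂) := by simpa using h
      have h2 := h1.edge
      rw [bodd_of_odd (by simpa [Nat.even_add_one] using he)] at h2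
      rw [g.func hr (g.symm h2)]
      simp
  · rcases l₂ with _ | ⟨z, l₂⟩
    · simp at hl
      exact absurd ho (by simpa [Nat.odd_add_one] using hl)
    · have h2 := h.edge
      rw [bodd_of_odd ho] at h2
      rw [g.func hr h2]
      simp

/-- Walk along the path to `x`, cross the edge to `y`, and return along the path to `y`. If the
return never meets the first path, this is an augmenting path. Otherwise the first meeting vertex
`q` closes the odd cycle, or yields a shorter instance of the same situation. -/
theorem exists_flower (hno : g.NoAug) : ∀ (n : ℕ) (l m : List α) (x y : α),
    l.length + m.length ≤ n → g.IsPath (l ++ [x]) → Even l.length → g.IsPath (m ++ [y]) →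
    Even m.length → g.r false x y →
    ∃ (p C : List α) (a z : α), g.IsPath (p ++ C) ∧ Even p.length ∧ Odd C.length ∧
      C.head? = some a ∧ C.getLast? = some z ∧ g.r false z a := by
  intro n
  induction n using Nat.strong_induction_on with
  | _ n ih =>
  intro l m x y hn hP hl hQ hm hxy
  have hPlen : (l ++ [x]).length.bodd = true := by simp [bodd_of_even hl]
  have hQr : AltChain g.r true (m ++ [y]).reverse := by
    have := altChain_reverse (r := g.r) (fun _ _ _ h => g.symm h) _ _ hQ.2.1
    simpa [bodd_of_even hm] using this
  have hwalk : AltChain g.r false ((l ++ [x]) ++ (m ++ [y]).reverse) := by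
    rw [altChain_append]
    refine ⟨hP.2.1, by rw [hPlen]; exact hQr, ?_⟩
    intro u v hu hv
    simp at hu hv
    subst hu hv
    simpa [bodd_of_even hl] using hxy
  have hPx : ∃ s, (l ++ [x]).head? = some s ∧ g.S s := hP.2.2
  by_cases hmeet : ∃ q ∈ (m ++ [y]).reverse, q ∈ l ++ [x]
  · obtain ⟨c, q, d, hcd, hq, hc⟩ := exists_first hmeet
    have hQ' : m ++ [y] = d.reverse ++ q :: c.reverse := by
      have := congrArg List.reverse hcd
      simpa using this
    have hQl : m.length + 1 = d.length + (c.length + 1) := by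
      simpa using congrArg List.length hQ'
    have hwalk' : AltChain g.r false ((l ++ [x] ++ c) ++ [q]) := by
      rw [hcd] at hwalk
      have : l ++ [x] ++ (c ++ q :: d) = (l ++ [x] ++ c ++ [q]) ++ d := by simp
      rw [this, altChain_append] at hwalk
      exact hwalk.1
    have hnd : (l ++ [x] ++ c).Nodup := by
      rw [List.nodup_append]
      refine ⟨hP.1, ?_, ?_⟩
      · have := List.nodup_reverse.2 hQ.1
        rw [hcd] at this
        exact (List.nodup_append.1 this).1
      · rintro a ha b hb rfl
        exact hc _ hb ha
    have hWpath : g.IsPath (l ++ [x] ++ c) := by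
      refine ⟨hnd, ((altChain_append _ _ _).1 hwalk').1, ?_⟩
      obtain ⟨s, hs, hS⟩ := hPx
      refine ⟨s, ?_, hS⟩
      cases l <;> simpa using hs
    have hlast : ∃ z, (l ++ [x] ++ c).getLast? = some z := by
      cases h : (l ++ [x] ++ c).getLast? with
      | none => simp at h
      | some z => exact ⟨z, rfl⟩
    obtain ⟨z, hz⟩ := hlast
    have hedge := ((altChain_append _ _ _).1 hwalk').2.2 z q hz rfl
    obtain ⟨l₁, l₂, h12⟩ := List.append_of_mem hq
    have hPl : l.length + 1 = l₁.length + (l₂.length + 1) := by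
      simpa using congrArg List.length h12
    -- `d.length` is the position of `q` on the path to `y`. If it is even, the edge `z q` closing
    -- the walk is unmatched; if moreover `q` has even position on the path to `x`, its predecessors
    -- there are the stem.
    rcases Nat.even_or_odd d.length with hd | hd
    · have hce : Even c.length := by
        have : m.length = d.length + c.length := by omega
        rw [this] at hm
        exact (Nat.even_add.1 hm).1 hd
      have hzq : g.r false z q := by
        simpa [bodd_of_even hce, bodd_of_even hl] using hedge
      rcases Nat.even_or_odd l₁.length with he | ho
      · refine ⟨l₁, q :: l₂ ++ c, q, z, ?_, he, ?_, by simp, ?_, hzq⟩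
        · rw [h12] at hWpath
          simpa using hWpath
        · have h1 : l.length = l₁.length + l₂.length := by omega
          rw [h1] at hl
          have := (Nat.even_add.1 hl).1 he
          simp only [List.cons_append, List.length_cons, List.length_append]
          exact (this.add hce).add_one
        · rw [h12] at hz
          rw [← hz, List.append_assoc,
            List.getLast?_append_of_ne_nil l₁ (l₂ := q :: l₂ ++ c) (by simp)]
      -- At an odd position of the first path, `q` is preceded by an outer vertex `x'` with an
      -- unmatched edge to `q`, and `q` itself is outer by a prefix of the second path: recurse on
      -- these two shorter paths.
      · obtain rfl | ⟨l', x', rfl⟩ := eq_nil_or_snoc l₁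
        · simp at ho
        · have hp1 : g.IsPath (l' ++ x' :: q :: l₂) := by
            rw [h12] at hP
            simpa using hP
          have hl'e : Even l'.length := by
            simpa [Nat.odd_add_one] using ho
          have h2 := hp1.edge
          rw [bodd_of_even hl'e] at h2
          refine ih (l'.length + d.reverse.length) ?_ l' d.reverse x' q le_rfl hp1.prefix' hl'e
            ?_ (by simpa using hd) h2
          · simp at hPl ⊢
            omega
          · rw [hQ'] at hQ
            exact hQ.prefix'
    -- For odd position on the second path, the return reaches `q` by its matched edge. The first
    -- path has an odd number of vertices and contains all their mates, so it was met earlier.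
    · exfalso
      have hco : Odd c.length := by
        have : m.length = d.length + c.length := by omega
        rw [this] at hm
        by_contra hcn
        rw [Nat.not_odd_iff_even] at hcn
        exact (Nat.not_even_iff_odd.2 hd) ((Nat.even_add.1 hm).2 hcn)
      have hzq : g.r true z q := by
        simpa [bodd_of_odd hco, bodd_of_even hl] using hedge
      have hzP : z ∈ l ++ [x] := by
        refine hP.mate_mem ?_ hq (g.symm hzq)
        simpa using hl.add_one
      obtain rfl | ⟨c', z', rfl⟩ := eq_nil_or_snoc c
      · simp at hco
      · have : z' = z := by
          simpa [← List.append_assoc] using hz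
        subst this
        exact hc z' (by simp) hzP
  · exfalso
    push Not at hmeet
    obtain ⟨s, hs, hS⟩ := hQ.2.2
    obtain ⟨m', hm'⟩ : ∃ m', (m ++ [y]).reverse = m' ++ [s] := by
      cases hmy : m ++ [y] with
      | nil => simp at hmy
      | cons a b =>
        rw [hmy] at hs
        simp at hs
        exact ⟨b.reverse, by simp [hs]⟩
    refine hno s (g.start_free hS) ⟨l ++ [x] ++ m', ⟨?_, ?_, ?_⟩, ?_⟩
    · rw [List.append_assoc, ← hm', List.nodup_append]
      refine ⟨hP.1, List.nodup_reverse.2 hQ.1, ?_⟩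
      rintro a ha b hb rfl
      exact hmeet _ hb ha
    · rw [List.append_assoc, ← hm']
      exact hwalk
    · obtain ⟨s, hs, hS⟩ := hPx
      refine ⟨s, ?_, hS⟩
      cases l <;> simpa using hs
    · have : m.length = m'.length := by simpa using congrArg List.length hm'
      simp only [List.length_append, List.length_cons, List.length_nil]
      rw [← this]
      exact (hl.add_one).add_even hm

end AltGraph

/-! ### Even alternating paths around an odd cycle -/

section Cycles
variable {α : Type*} {r : Bool → α → α → Prop}

/-- In an odd cycle `a :: C` that is alternating up to the base `a`, every vertex is joined with `a`
by an even alternating path. -/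
theorem exists_cycle_path (hr : ∀ b x y, r b x y → r b y x) {a : α} {C : List α}
    (hnd : (a :: C).Nodup) (hC : AltChain r false (a :: C)) (hodd : Odd (a :: C).length)
    (hclose : ∀ z, (a :: C).getLast? = some z → r false z a) {x : α} (hx : x ∈ a :: C) :
    ∃ p : List α, p.Nodup ∧ (∀ y ∈ p, y ∈ a :: C) ∧ AltChain r false p ∧ Odd p.length ∧
      p.head? = some a ∧ p.getLast? = some x := by
  obtain ⟨l, m, hlm⟩ := List.append_of_mem hx
  -- A vertex at an even position is reached forwards, one at an odd position backwards over the
  -- unmatched closing edge.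
  rcases Nat.even_or_odd l.length with he | ho
  · refine ⟨l ++ [x], ?_, ?_, ?_, ?_, ?_, by simp⟩
    · rw [hlm] at hnd
      exact hnd.sublist (by simp)
    · intro y hy
      rw [hlm]
      simp at hy ⊢
      tauto
    · rw [hlm] at hC
      have : l ++ x :: m = (l ++ [x]) ++ m := by simp
      rw [this, altChain_append] at hC
      exact hC.1
    · simpa using he.add_one
    · cases l <;> simp_all
  · obtain ⟨l', hl'⟩ : ∃ l', l = a :: l' := by
      cases l with
      | nil => simp at ho
      | cons b l => exact ⟨l, by simp_all⟩
    subst hl'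
    have hsub : (x :: m).Sublist C := by
      have : C = l' ++ x :: m := by simpa using hlm
      rw [this]
      exact List.sublist_append_right _ _
    have hm : Odd m.length := by
      rw [hlm] at hodd
      by_contra hn
      rw [Nat.not_odd_iff_even] at hn
      simp only [List.length_append, List.length_cons] at hodd ho
      exact (Nat.not_even_iff_odd.2 hodd) (Odd.add_odd ho hn.add_one)
    have hch : AltChain r true (x :: m) := by
      rw [hlm, altChain_append] at hC
      have h1 := hC.2.1
      rw [bodd_of_odd ho] at h1
      exact h1
    refine ⟨a :: (x :: m).reverse, ?_, ?_, ?_, ?_, by simp, ?_⟩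
    · rw [List.nodup_cons, List.mem_reverse, List.nodup_reverse]
      rw [List.nodup_cons] at hnd
      exact ⟨fun h => hnd.1 (hsub.subset h), hnd.2.sublist hsub⟩
    · intro y hy
      rw [List.mem_cons, List.mem_reverse] at hy
      rcases hy with rfl | hy
      · simp
      · exact List.mem_cons_of_mem _ (hsub.subset hy)
    · rw [altChain_cons]
      refine ⟨?_, ?_⟩
      · have := altChain_reverse hr _ _ hch
        simpa [bodd_of_odd hm] using this
      · intro z hz
        apply hr
        apply hclose
        rw [hlm, List.getLast?_append_of_ne_nil _ (by simp)]
        rwa [List.head?_reverse] at hz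
    · simp only [List.length_cons, List.length_reverse]
      exact hm.add_one.add_one
    · simp [List.getLast?_cons]

/-- The edges at odd positions pair up all vertices of the cycle except the base `a`. -/
theorem exists_cycle_mate (hr : ∀ b x y, r b x y → r b y x) {a : α} {C : List α}
    (hC : AltChain r false (a :: C)) (hodd : Odd (a :: C).length)
    {x : α} (hx : x ∈ a :: C) (hxa : x ≠ a) : ∃ y ∈ a :: C, r true x y := by
  obtain ⟨l, m, hlm⟩ := List.append_of_mem hx
  rw [hlm] at hC hodd ⊢
  rcases Nat.even_or_odd l.length with he | ho
  · obtain rfl | ⟨l', y, rfl⟩ := eq_nil_or_snoc l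
    · simp at hlm
      exact absurd hlm.1.symm hxa
    · have h2 := ((altChain_append _ _ _).1 hC).2.2 y x (by simp) (by simp)
      refine ⟨y, by simp, hr _ _ _ ?_⟩
      have : Odd l'.length := by simpa [Nat.even_add_one] using he
      simpa [bodd_of_odd this] using h2
  · rcases m with _ | ⟨y, m⟩
    · exfalso
      simp only [List.length_append, List.length_cons, List.length_nil] at hodd
      exact (Nat.not_even_iff_odd.2 hodd) (ho.add_one)
    · have h2 := ((altChain_append _ _ _).1 hC).2.1
      refine ⟨y, by simp, ?_⟩
      rw [bodd_of_odd ho] at h2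
      exact h2.1

end Cycles

/-! ### Contraction of odd cycles and of blocks: lifting and projecting paths -/

namespace AltGraph
variable {α : Type*}

theorem symm_all (g : AltGraph α) : ∀ b x y, g.r b x y → g.r b y x := fun _ _ _ h => g.symm h

/-- `g₁` arises from `g` by contracting the vertices in `C` to the vertex `B`. -/
structure Contracts (g g₁ : AltGraph α) (B : α) (C : List α) : Prop where
  r_of : ∀ {b x y}, x ≠ B → y ≠ B → g₁.r b x y → g.r b x y ∧ x ∉ C ∧ y ∉ C
  r_B : ∀ {b x}, g₁.r b x B → x ∉ C ∧ ∃ a ∈ C, g.r b x a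
  S_of : ∀ {x}, x ≠ B → g₁.S x → g.S x ∧ x ∉ C
  S_B : g₁.S B → ∃ a ∈ C, g.S a
  T_of : ∀ {x}, x ≠ B → g₁.T x → g.T x
  T_B : g₁.T B → ∃ a ∈ C, g.T a

variable {g g₁ : AltGraph α} {B : α} {C : List α}

theorem Contracts.not_mem (h : Contracts g g₁ B C) {l : List α} (hl : g₁.IsPath l) {x : α}
    (hx : x ∈ l) (hxB : x ≠ B) : x ∉ C := by
  obtain ⟨l₁, l₂, rfl⟩ := List.append_of_mem hx
  obtain rfl | ⟨l', w, rfl⟩ := eq_nil_or_snoc l₁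
  · exact (h.S_of hxB hl.start).2
  · have h1 : g₁.IsPath (l' ++ w :: x :: l₂) := by simpa using hl
    by_cases hw : w = B
    · subst hw
      exact (h.r_B (g₁.symm h1.edge)).1
    · exact (h.r_of hw hxB h1.edge).2.2

theorem Contracts.altChain (h : Contracts g g₁ B C) {l : List α} {b : Bool}
    (hl : AltChain g₁.r b l) (hB : B ∉ l) : AltChain g.r b l :=
  altChain_mono _ _ (fun _ _ hx _ hy hr =>
    (h.r_of (fun e => hB (e ▸ hx)) (fun e => hB (e ▸ hy)) hr).1) hl

theorem Contracts.isPath (h : Contracts g g₁ B C) {l : List α}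
    (hl : g₁.IsPath l) (hB : B ∉ l) : g.IsPath l := by
  obtain ⟨h1, h2, x, hx, hS⟩ := hl
  exact ⟨h1, h.altChain h2 hB, x, hx, (h.S_of (fun e => hB (e ▸ List.mem_of_head? hx)) hS).1⟩

/-- The rest of the path avoids `C` and keeps its edges, so only the two junctions with `mid`
matter. As `mid` has an odd number of vertices, like the single vertex it replaces, the flags after
it are unaffected. -/
theorem Contracts.splice (h : Contracts g g₁ B C) {k mid m : List α} {s t : α}
    (hp : g₁.IsPath (k ++ B :: m)) (hnd : mid.Nodup) (hC : ∀ x ∈ mid, x ∈ C)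
    (hch : AltChain g.r k.length.bodd mid) (hodd : Odd mid.length) (hs : mid.head? = some s)
    (ht : mid.getLast? = some t) (hk : ∀ w, k.getLast? = some w → g.r (k.length + 1).bodd w s)
    (hk0 : k = [] → g.S s) (hm : ∀ y, m.head? = some y → g.r k.length.bodd t y) :
    g.IsPath (k ++ (mid ++ m)) := by
  have hnd' := hp.1
  rw [List.nodup_append, List.nodup_cons] at hnd'
  obtain ⟨hk1, ⟨hBm, hm1⟩, hdis⟩ := hnd'
  have hBk : B ∉ k := fun hB => hdis B hB B (by simp) rfl
  have hkC : ∀ x ∈ k, x ∉ C := fun x hx =>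
    h.not_mem hp (by simp [hx]) (fun e => hBk (e ▸ hx))
  have hmC : ∀ x ∈ m, x ∉ C := fun x hx =>
    h.not_mem hp (by simp [hx]) (fun e => hBm (e ▸ hx))
  have hch1 := (altChain_append _ _ _).1 hp.2.1
  have hch2 := (altChain_cons _ _ _).1 hch1.2.1
  refine ⟨?_, ?_, ?_⟩
  · rw [List.nodup_append, List.nodup_append]
    refine ⟨hk1, ⟨hnd, hm1, ?_⟩, ?_⟩
    · rintro a ha b hb rfl
      exact hmC _ hb (hC _ ha)
    · rintro a ha b hb rfl
      rcases List.mem_append.1 hb with hb | hb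
      · exact hkC _ ha (hC _ hb)
      · exact hdis a ha a (by simp [hb]) rfl
  · rw [altChain_append, altChain_append]
    refine ⟨h.altChain hch1.1 hBk, ⟨by simpa using hch, ?_, ?_⟩, ?_⟩
    · have := h.altChain hch2.1 hBm
      simpa [bodd_of_odd hodd] using this
    · intro x y hx hy
      rw [ht] at hx
      obtain rfl := Option.some.inj hx
      simpa [bodd_of_odd hodd] using hm y hy
    · intro x y hx hy
      have : y = s := by
        cases mid with
        | nil => simp at hs
        | cons a mid => simp_all
      subst this
      simpa using hk x hx
  · rcases k with _ | ⟨a, k⟩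
    · refine ⟨s, ?_, hk0 rfl⟩
      cases mid with
      | nil => simp at hs
      | cons a mid => simpa using hs
    · exact ⟨a, by simp, (h.S_of (fun e => hBk (by simp [e])) hp.start).1⟩

section Lift
variable {a : α} (h : Contracts g g₁ B (a :: C)) (hnd : (a :: C).Nodup)
  (hC : AltChain g.r false (a :: C)) (hodd : Odd (a :: C).length)
  (hclose : ∀ z, (a :: C).getLast? = some z → g.r false z a)
include h hC hodd

/-- Every other cycle vertex has its mate on the cycle, so a matched edge from outside can only
arrive at the base. -/
theorem Contracts.eq_of_matched {x w : α} (hw : w ∉ a :: C) (hx : x ∈ a :: C)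
    (hr : g.r true w x) : x = a := by
  by_contra hxa
  obtain ⟨y, hy, hxy⟩ := exists_cycle_mate g.symm_all hC hodd hx hxa
  exact hw (g.func (g.symm hr) hxy ▸ hy)

theorem Contracts.eq_of_free {x : α} (hx : x ∈ a :: C) (hT : g.T x) : x = a := by
  by_contra hxa
  obtain ⟨y, hy, hxy⟩ := exists_cycle_mate g.symm_all hC hodd hx hxa
  exact g.free_unmatched hT hxy

include hnd hclose

/-- Entering the contracted vertex after an even number of edges, one can leave anywhere. -/
theorem Contracts.splice_even {k m : List α} (hp : g₁.IsPath (k ++ B :: m)) (hk : Even k.length)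
    {x : α} (hx : x ∈ a :: C) (hm : ∀ y, m.head? = some y → g.r false x y) :
    ∃ mid : List α, g.IsPath (k ++ (mid ++ [x] ++ m)) ∧ Even mid.length := by
  obtain ⟨p, p1, p2, p3, p4, p5, p6⟩ :=
    exists_cycle_path g.symm_all hnd hC hodd hclose hx
  obtain rfl | ⟨mid, x', rfl⟩ := eq_nil_or_snoc p
  · simp at p6
  obtain rfl : x' = x := by simpa using p6
  refine ⟨mid, ?_, ?_⟩
  · refine h.splice hp p1 p2 (by rwa [bodd_of_even hk]) p4 p5 p6 ?_ ?_ (by rwa [bodd_of_even hk])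
    -- The edge by which the path enters `B` has an odd position, so it is matched and ends at the
    -- base, where the inserted piece starts.
    · intro w hw
      rw [bodd_of_odd hk.add_one]
      obtain rfl | ⟨k', w', rfl⟩ := eq_nil_or_snoc k
      · simp at hw
      obtain rfl : w' = w := by simpa using hw
      have h1 : g₁.IsPath (k' ++ w' :: B :: m) := by simpa using hp
      have h2 := h1.edge
      rw [bodd_of_odd (by simpa [Nat.even_add_one] using hk)] at h2
      obtain ⟨h3, b, hb, hr⟩ := h.r_B h2
      rwa [h.eq_of_matched hC hodd h3 hb hr] at hr
    · rintro rfl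
      obtain ⟨b, hb, hS⟩ := h.S_B hp.start
      rwa [h.eq_of_free hC hodd hb (g.start_free hS)] at hS
  · simpa [Nat.odd_add_one] using p4

/-- Entering the contracted vertex after an odd number of edges, one leaves at the base. -/
theorem Contracts.splice_odd {k m : List α} (hp : g₁.IsPath (k ++ B :: m)) (hk : Odd k.length) :
    ∃ mid : List α, g.IsPath (k ++ (mid ++ [a] ++ m)) ∧ Even mid.length := by
  obtain rfl | ⟨k', w, rfl⟩ := eq_nil_or_snoc k
  · simp at hk
  have h1 : g₁.IsPath (k' ++ w :: B :: m) := by simpa using hp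
  have h2 := h1.edge
  have hk' : Even k'.length := by simpa [Nat.odd_add_one] using hk
  rw [bodd_of_even hk'] at h2
  obtain ⟨h3, x, hx, hr⟩ := h.r_B h2
  obtain ⟨p, p1, p2, p3, p4, p5, p6⟩ :=
    exists_cycle_path g.symm_all hnd hC hodd hclose hx
  cases p with
  | nil => simp at p6
  | cons a' mid =>
  obtain rfl : a' = a := by simpa using p5
  refine ⟨mid.reverse, ?_, by simpa [Nat.odd_add_one] using p4⟩
  rw [← List.reverse_cons]
  refine h.splice hp (List.nodup_reverse.2 p1)
    (fun y hy => p2 y (List.mem_reverse.1 hy)) ?_ (by simpa using p4)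
    (by rw [List.head?_reverse]; exact p6) (by simp; rfl) ?_ (by simp) ?_
  · have := altChain_reverse g.symm_all _ _ p3
    rw [bodd_of_odd hk]
    rw [bodd_of_odd p4] at this
    simpa using this
  · intro w' hw'
    obtain rfl : w = w' := by simpa using hw'
    rwa [bodd_of_even hk.add_one]
  · intro y hy
    rw [bodd_of_odd hk]
    cases m with
    | nil => simp at hy
    | cons y' m =>
    obtain rfl : y' = y := by simpa using hy
    have h4 := hp.edge
    rw [bodd_of_odd hk] at h4
    obtain ⟨h5, b, hb, hr'⟩ := h.r_B (g₁.symm h4)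
    rw [h.eq_of_matched hC hodd h5 hb hr'] at hr'
    exact g.symm hr'

/-- Expanding `B` adds an even number of vertices, whichever parity it is entered with. After an
even number of edges any exit is available; after an odd number only the base is, and only the base
is needed. -/
theorem Contracts.lift_ne {l : List α} {x : α} (hp : g₁.IsPath (l ++ [x])) (hx : x ≠ B) :
    ∃ l', g.IsPath (l' ++ [x]) ∧ (Even l'.length ↔ Even l.length) := by
  by_cases hB : B ∈ l
  · obtain ⟨k, m, rfl⟩ := List.append_of_mem hB
    have hp' : g₁.IsPath (k ++ B :: (m ++ [x])) := by simpa using hp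
    rcases Nat.even_or_odd k.length with he | ho
    · obtain ⟨y, hy⟩ : ∃ y, (m ++ [x]).head? = some y := by cases m <;> simp
      obtain ⟨m', hm'⟩ : ∃ m', m ++ [x] = y :: m' := by
        cases hh : m ++ [x] with
        | nil => simp at hh
        | cons c d => rw [hh] at hy; simp at hy; exact ⟨d, by simp [hy]⟩
      have h2 := hp'
      rw [hm'] at h2
      have h3 := h2.edge
      rw [bodd_of_even he] at h3
      obtain ⟨h5, b, hb, hr'⟩ := h.r_B (g₁.symm h3)
      obtain ⟨mid, h6, h7⟩ := h.splice_even hnd hC hodd hclose hp' he hb (by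
        intro y' hy'
        rw [hy] at hy'
        exact (Option.some.inj hy') ▸ g.symm hr')
      refine ⟨k ++ (mid ++ [b] ++ m), by simpa using h6, ?_⟩
      simp only [List.length_append, List.length_cons, List.length_nil, Nat.even_add, he, h7]
      simp [Nat.even_add_one]
    · obtain ⟨mid, h6, h7⟩ := h.splice_odd hnd hC hodd hclose hp' ho
      refine ⟨k ++ (mid ++ [a] ++ m), by simpa using h6, ?_⟩
      simp only [List.length_append, List.length_cons, List.length_nil, Nat.even_add,
        Nat.not_even_iff_odd.2 ho, h7]
      simp [Nat.even_add_one]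
  · exact ⟨l, h.isPath hp (by simp [hB, hx.symm]), Iff.rfl⟩

theorem Contracts.lift_out {x : α} (hx : g₁.Out x) (hxB : x ≠ B) : g.Out x := by
  obtain ⟨l, hl, he⟩ := hx
  obtain ⟨l', h1, h2⟩ := h.lift_ne hnd hC hodd hclose hl hxB
  exact ⟨l', h1, h2.2 he⟩

theorem Contracts.lift_out_contracted (hB : g₁.Out B) {x : α} (hx : x ∈ a :: C) : g.Out x := by
  obtain ⟨l, hl, he⟩ := hB
  obtain ⟨mid, h1, h2⟩ := h.splice_even hnd hC hodd hclose hl he hx (by simp)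
  exact ⟨l ++ mid, by simpa using h1, by simpa using he.add h2⟩

/-- If the contracted vertex contains a free vertex, that vertex is the base, and an odd path to `B`
lifts to an odd path to the base. -/
theorem Contracts.lift_noAug (hno : g.NoAug) : g₁.NoAug := by
  intro x hT hx
  obtain ⟨l, hl, ho⟩ := hx
  by_cases hxB : x = B
  · subst hxB
    obtain ⟨b, hb, hTb⟩ := h.T_B hT
    rw [h.eq_of_free hC hodd hb hTb] at hTb
    obtain ⟨mid, h1, h2⟩ := h.splice_odd hnd hC hodd hclose hl ho
    exact hno a hTb ⟨l ++ mid, by simpa using h1, by simpa using ho.add_even h2⟩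
  · obtain ⟨l', h1, h2⟩ := h.lift_ne hnd hC hodd hclose hl hxB
    refine hno x (h.T_of hxB hT) ⟨l', h1, ?_⟩
    rw [← Nat.not_even_iff_odd] at ho ⊢
    rwa [h2]

end Lift

/-- A path that reaches the block `q = t` and could leave it only along its unique outgoing matched
edge has entered the block by an unmatched edge. -/
theorem IsPath.exists_entry {β : Type*} {q : α → β} {t : β} {l : List α} {b d : α}
    (h : g.IsPath (l ++ [b])) (hbt : q b = t) (hdl : d ∉ l)
    (huniq : ∀ x y, g.r true x y → q x = t → q y ≠ t → y = d) (hS : ∀ x, g.S x → q x ≠ t) :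
    ∃ l₀ p z l₁, l ++ [b] = l₀ ++ p :: z :: l₁ ∧ Even l₀.length ∧ q p ≠ t ∧ q z = t ∧
      g.r false p z := by
  obtain ⟨l₀, z, l₁, h1, hz, hfirst⟩ := exists_first (p := fun x => q x = t) (l := l ++ [b])
    ⟨b, by simp, hbt⟩
  obtain rfl | ⟨l₀, p, rfl⟩ := eq_nil_or_snoc l₀
  · rw [h1] at h
    exact absurd hz (hS z h.start)
  · have h' := h
    rw [h1] at h'
    have h2 : g.IsPath (l₀ ++ p :: z :: l₁) := by simpa using h'
    have hpt : q p ≠ t := hfirst p (by simp)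
    rcases Nat.even_or_odd l₀.length with he | ho
    · refine ⟨l₀, p, z, l₁, by simpa using h1, he, hpt, hz, ?_⟩
      have := h2.edge
      rwa [bodd_of_even he] at this
    -- If the first entry were along a matched edge, uniqueness would make its outer end equal to
    -- `d`, which is not on `l`.
    · exfalso
      have h3 := h2.edge
      rw [bodd_of_odd ho] at h3
      have h4 := huniq z p (g.symm h3) hz hpt
      subst h4
      apply hdl
      have h5 : l ++ [b] = l₀ ++ p :: (z :: l₁) := by simpa using h1
      have h6 : p ∈ l ++ [b] := by rw [h5]; simp
      rcases List.mem_append.1 h6 with h7 | h7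
      · exact h7
      · simp at h7
        exact absurd hbt (h7 ▸ hpt)

/-- If no unmatched edge joins two outer blocks of the graph `gt` of blocks, then outer vertices
are in outer blocks. -/
theorem out_of_blocks {β : Type*} {gt : AltGraph β} {q : α → β} (hS : ∀ {x}, g.S x → gt.S (q x))
    (hr : ∀ {b x y}, g.r b x y → q x ≠ q y → gt.r b (q x) (q y))
    (hH : ∀ {x y}, gt.Out x → gt.Out y → ¬ gt.r false x y)
    (huniq : ∀ {x y x' y'}, g.r true x y → q x ≠ q y → g.r true x' y' → q x' = q x →
      q y' ≠ q x → y' = y)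
    (hsingle : ∀ {x y}, g.r true x y → ¬ gt.Out (q x) → q x ≠ q y) {x : α} (hx : g.Out x) :
    gt.Out (q x) := by
  suffices H : ∀ (n : ℕ) (l : List α) (x : α), l.length ≤ n → g.IsPath (l ++ [x]) →
      Even l.length → gt.Out (q x) by
    obtain ⟨l, hl, he⟩ := hx
    exact H _ l x le_rfl hl he
  intro n
  induction n using Nat.strong_induction_on with
  | _ n ih =>
  intro l d hn hp he
  by_contra hcon
  obtain rfl | ⟨l, b, rfl⟩ := eq_nil_or_snoc l
  · exact hcon (out_of_start (hS hp.start))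
  have ho : Odd l.length := by simpa [Nat.even_add_one] using he
  obtain rfl | ⟨l, a, rfl⟩ := eq_nil_or_snoc l
  · simp at ho
  have hle : Even l.length := by simpa [Nat.odd_add_one] using ho
  have hp1 : g.IsPath (l ++ a :: b :: [d]) := by simpa using hp
  have hab := hp1.edge
  rw [bodd_of_even hle] at hab
  have hp2 : g.IsPath ((l ++ [a]) ++ b :: d :: []) := by simpa using hp
  have hbd := hp2.edge
  rw [bodd_of_odd ho] at hbd
  simp only [List.length_append, List.length_cons, List.length_nil] at hn
  have ha : gt.Out (q a) := ih l.length (by omega) l a le_rfl hp1.prefix' hle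
  -- If the block of `b` is outer, the path first entered it by an unmatched edge from a vertex
  -- whose block is outer by induction, so two outer blocks are joined, against `hH`. Otherwise the
  -- block of `b` is reached oddly from that of `a`, and the matched edge leaving it makes the block
  -- of `d` outer.
  by_cases hb : gt.Out (q b)
  · have hne : q b ≠ q d := fun e => hcon (e ▸ hb)
    have hnd := hp.1
    obtain ⟨l₀, p, z, l₁, h1, h2, h3, h4, h5⟩ := (hp2.prefix').exists_entry (q := q) (d := d) rfl
      (by
        rw [List.nodup_append] at hnd
        intro hd
        exact hnd.2.2 d (by simp at hd ⊢; tauto) d (by simp) rfl)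
      (fun x y hxy hx hy => huniq hbd hne hxy hx hy)
      (fun x hx e => gt.free_unmatched (gt.start_free (hS hx)) (e ▸ hr hbd hne))
    have hp3 := hp2.prefix'
    rw [h1] at hp3
    have hlen := congrArg List.length h1
    simp only [List.length_append, List.length_cons, List.length_nil] at hlen
    have hpo : gt.Out (q p) := ih l₀.length (by omega) l₀ p le_rfl hp3.prefix' h2
    refine hH hpo hb ?_
    rw [← h4] at h3 ⊢
    exact hr h5 h3
  · have hne : q a ≠ q b := fun e => hb (e ▸ ha)
    have hIn := (ha.unmatched (hr hab hne)).resolve_left hb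
    have hne' : q b ≠ q d := hsingle hbd hb
    exact hcon (hIn.matched (hr hbd hne'))

/-- Outer vertices joined by a matched edge are in the same block, if outer vertices joined by an
unmatched edge are. -/
theorem block_eq_of_matched {β : Type*} {q : α → β}
    (hH : ∀ {x y}, g.Out x → g.Out y → g.r false x y → q x = q y)
    (huniq : ∀ {x y x' y'}, g.r true x y → q x ≠ q y → g.r true x' y' → q x' = q x →
      q y' ≠ q x → y' = y)
    (hfree : ∀ {x y z}, g.r true x y → q x ≠ q y → g.S z → q z ≠ q x)
    (hblock : ∀ {x y w}, g.Out x → g.r false w y → q y = q x → g.Out y) {x y : α} (hx : g.Out x) (hy : g.Out y)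
    (hxy : g.r true x y) : q x = q y := by
  -- An even path to `x` arrives over the matched edge from `y`. It first entered the block of `y`
  -- by an unmatched edge from an outer vertex; the other end of that edge is outer by `hblock`, so
  -- `hH` puts both ends in one block.
  by_contra hne
  obtain ⟨l, hl, he⟩ := hx
  obtain rfl | ⟨l, y', rfl⟩ := eq_nil_or_snoc l
  · exact g.free_unmatched (g.start_free hl.start) hxy
  have ho : Odd l.length := by simpa [Nat.even_add_one] using he
  have hp : g.IsPath (l ++ y' :: [x]) := by simpa using hl
  have h1 := hp.edge
  rw [bodd_of_odd ho] at h1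
  obtain rfl := g.func (g.symm h1) hxy
  have hnd := hp.1
  obtain ⟨l₀, p, z, l₁, h1, h2, h3, h4, h5⟩ := hp.prefix'.exists_entry (q := q) (d := x) rfl
    (by
      rw [List.nodup_append] at hnd
      intro hd
      exact hnd.2.2 x hd x (by simp) rfl)
    (fun u v huv hu hv => huniq (g.symm hxy) (Ne.symm hne) huv hu hv)
    (fun u hu => hfree (g.symm hxy) (Ne.symm hne) hu)
  have hp3 := hp.prefix'
  rw [h1] at hp3
  exact h3 ((hH ⟨l₀, hp3.prefix', h2⟩ (hblock hy h5 h4) h5).trans h4)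

end AltGraph

/-! ### Rotating an odd cycle with a maximum number of nonadjacent marked edges -/

/-- Some two consecutive edges are unmarked, since strict alternation is impossible around an odd
cycle. Starting after the first of them and dropping the other end, the rest splits into `ℓ / 2`
adjacent pairs, each with exactly one mark by counting. An unmarked first edge forces the mark to
the second place in every pair. -/
theorem exists_rotation {ℓ : ℕ} (hodd : Odd ℓ) (f : ℕ → Prop) [DecidablePred f]
    (hper : ∀ n, f (n + ℓ) ↔ f n) (hadj : ∀ n, ¬ (f n ∧ f (n + 1)))
    (hcard : ((range ℓ).filter f).card = ℓ / 2) :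
    ∃ k, ∀ j < ℓ, (f (k + j) ↔ Odd j) := by
  obtain ⟨k, hk0, hk1⟩ : ∃ k, ¬ f k ∧ ¬ f (k + 1) := by
    by_contra hcon
    push Not at hcon
    have halt : ∀ n, f (n + 1) ↔ ¬ f n := fun n =>
      ⟨fun h h' => hadj n ⟨h', h⟩, hcon n⟩
    have h2 : ∀ n, (f n ↔ (f 0 ↔ Even n)) := by
      intro n
      induction n with
      | zero => simp
      | succ n ih => rw [halt, ih, Nat.even_add_one]; tauto
    have h3 := h2 ℓ
    have h4 := hper 0
    rw [zero_add] at h4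
    rw [h4] at h3
    have := Nat.not_even_iff_odd.2 hodd
    tauto
  obtain ⟨m, hm⟩ := hodd
  have hp : Function.Periodic f ℓ := fun n => propext (hper n)
  have hcount : ((Ico (k + 1) (k + 1 + ℓ)).filter f).card = m := by
    rw [Nat.filter_Ico_card_eq_of_periodic _ _ _ hp, Nat.count_eq_card_filter_range, hcard]
    omega
  set g : ℕ → ℕ := fun j => if f (k + 1 + j) then 1 else 0 with hg
  have hsum : ∑ j ∈ range ℓ, g j = m := by
    rw [← hcount, card_filter, Finset.sum_Ico_eq_sum_range]
    simp [hg]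
  -- The position after the `m` pairs is `k + ℓ`, that is, `k` again.
  have hlast : g (2 * m) = 0 := by
    have h1 : k + 1 + 2 * m = k + ℓ := by omega
    simp only [hg, h1, hper, hk0, if_false]
  have hpairs : ∑ t ∈ range m, (g (2 * t) + g (2 * t + 1)) = m := by
    have h5 : ∀ m, ∑ t ∈ range m, (g (2 * t) + g (2 * t + 1)) = ∑ j ∈ range (2 * m), g j := by
      intro m
      induction m with
      | zero => simp
      | succ m ih =>
        rw [sum_range_succ, ih, Nat.mul_succ, sum_range_succ, sum_range_succ, add_assoc]
    rw [h5]
    rw [hm, sum_range_succ, hlast] at hsum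
    exact hsum
  have hle : ∀ t ∈ range m, g (2 * t) + g (2 * t + 1) ≤ 1 := by
    intro t _
    have := hadj (k + 1 + 2 * t)
    simp only [hg, ← add_assoc]
    split_ifs <;> simp_all
  have heq : ∀ t ∈ range m, g (2 * t) + g (2 * t + 1) = 1 := by
    rw [← Finset.sum_eq_sum_iff_of_le hle]
    simpa using hpairs
  have key : ∀ t ≤ m, ¬ f (k + 1 + 2 * t) ∧ (t < m → f (k + 1 + (2 * t + 1))) := by
    intro t
    induction t with
    | zero =>
      intro _
      refine ⟨by simpa using hk1, fun h => ?_⟩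
      have h6 := heq 0 (mem_range.2 h)
      by_contra h7
      simp only [hg] at h6
      rw [if_neg (by simpa using hk1), if_neg h7] at h6
      simp at h6
    | succ t ih =>
      intro ht
      have h8 := (ih (by omega)).2 (by omega)
      have h9 : ¬ f (k + 1 + 2 * (t + 1)) := fun h => hadj _ ⟨h8, by
        have : k + 1 + (2 * t + 1) + 1 = k + 1 + 2 * (t + 1) := by ring
        rwa [this]⟩
      refine ⟨h9, fun h => ?_⟩
      have h6 := heq (t + 1) (mem_range.2 h)
      by_contra h7
      simp only [hg] at h6
      rw [if_neg h9, if_neg h7] at h6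
      simp at h6
  refine ⟨k + 1, fun j hj => ?_⟩
  rcases Nat.even_or_odd' j with ⟨t, rfl | rfl⟩
  · have := (key t (by omega)).1
    simp [this]
  · have := (key t (by omega)).2 (by omega)
    simp [this]

/-! ### Cyclic structure of blossoms: counting and bases -/

section Structure
variable {W : Type u} [Fintype W] [DecidableEq W]

/-- The cyclic structure of a blossom, regardless of the matching. -/
structure State.Cycle (s : State W) (C : Sym2 W → Prop) (B : Finset W) (ℓ : ℕ)
    (A : ℕ → Finset W) (a b : ℕ → W) : Prop where
  odd : Odd ℓ
  three : 3 ≤ ℓ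
  wrap : A ℓ = A 0
  disj : ∀ i < ℓ, ∀ j < ℓ, i ≠ j → Disjoint (A i) (A j)
  child : ∀ i < ℓ, A i ∈ s.Ω ∨ ∃ v ∈ s.U, A i = {v}
  edge : ∀ i < ℓ, a i ∈ A i ∧ b i ∈ A (i + 1) ∧ C s(a i, b i)
  union : B = (range ℓ).biUnion A
  edges : s.EB B = ((range ℓ).biUnion fun i => s.blossomEdges (A i)) ∪
      (range ℓ).image (fun i => s(a i, b i))
  inside : ∀ D ∈ s.Ω, D ⊂ B → ∃ i < ℓ, D ⊆ A i

theorem State.isBlossom_iff {s : State W} {C : Sym2 W → Prop} {B : Finset W} :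
    s.IsBlossom C B ↔ ∃ ℓ A a b, s.Cycle C B ℓ A a b ∧
      ∀ i < ℓ, (s(a i, b i) ∈ s.M ↔ Odd i) := by
  constructor
  · rintro ⟨ℓ, A, a, b, h1, h2, h3, h4, h5, h6, h7, h8, h9⟩
    exact ⟨ℓ, A, a, b, ⟨h1, h2, h3, h4, h5, fun i hi => ⟨(h6 i hi).1, (h6 i hi).2.1,
      (h6 i hi).2.2.1⟩, h7, h8, h9⟩, fun i hi => (h6 i hi).2.2.2⟩
  · rintro ⟨ℓ, A, a, b, h, hM⟩
    exact ⟨ℓ, A, a, b, h.odd, h.three, h.wrap, h.disj, h.child, fun i hi => ⟨(h.edge i hi).1,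
      (h.edge i hi).2.1, (h.edge i hi).2.2, hM i hi⟩, h.union, h.edges, h.inside⟩

namespace State.Cycle
variable {s : State W} {C : Sym2 W → Prop} {B : Finset W} {ℓ : ℕ} {A : ℕ → Finset W} {a b : ℕ → W}
  (h : s.Cycle C B ℓ A a b)
include h

theorem pos : 0 < ℓ := by have := h.three; omega

theorem subset {i : ℕ} (hi : i < ℓ) : A i ⊆ B := by
  rw [h.union]
  exact subset_biUnion_of_mem A (mem_range.2 hi)

theorem index_eq {i j : ℕ} (hi : i < ℓ) (hj : j < ℓ) {v : W} (hvi : v ∈ A i) (hvj : v ∈ A j) :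
    i = j := by
  by_contra hne
  exact Finset.disjoint_left.1 (h.disj i hi j hj hne) hvi hvj

theorem b_mem {i : ℕ} (hi : i < ℓ) : b i ∈ A ((i + 1) % ℓ) := by
  have h1 := (h.edge i hi).2.1
  by_cases hil : i + 1 = ℓ
  · rw [hil, h.wrap] at h1
    rwa [hil, Nat.mod_self]
  · rwa [Nat.mod_eq_of_lt (by omega)]

theorem succ_mod_lt (i : ℕ) : (i + 1) % ℓ < ℓ := Nat.mod_lt _ h.pos

theorem succ_mod_ne {i : ℕ} (hi : i < ℓ) : (i + 1) % ℓ ≠ i := by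
  have := h.three
  by_cases hil : i + 1 = ℓ
  · rw [hil, Nat.mod_self]; omega
  · rw [Nat.mod_eq_of_lt (by omega)]; omega

theorem succ_succ_mod_ne {i j : ℕ} (hi : i < ℓ) (hj : (i + 1) % ℓ = j) : (j + 1) % ℓ ≠ i := by
  have := h.three
  subst hj
  by_cases hil : i + 1 = ℓ
  · rw [hil, Nat.mod_self, Nat.mod_eq_of_lt (by omega)]; omega
  · rw [Nat.mod_eq_of_lt (show i + 1 < ℓ by omega)]
    by_cases hil' : i + 1 + 1 = ℓ
    · rw [hil', Nat.mod_self]; omega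
    · rw [Nat.mod_eq_of_lt (by omega)]; omega

theorem mem_iff {v : W} : v ∈ B ↔ ∃ i < ℓ, v ∈ A i := by
  rw [h.union]; simp

theorem nonempty {i : ℕ} (hi : i < ℓ) : (A i).Nonempty := ⟨_, (h.edge i hi).1⟩

/-- Two cycle edges could coincide in opposite directions only if `i` and `j` were successors of
each other modulo `ℓ`, which `3 ≤ ℓ` excludes. -/
theorem edge_inj {i j : ℕ} (hi : i < ℓ) (hj : j < ℓ) (he : s(a i, b i) = s(a j, b j)) : i = j := by
  rw [Sym2.eq_iff] at he
  rcases he with ⟨h1, -⟩ | ⟨h1, h2⟩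
  · exact h.index_eq hi hj (h.edge i hi).1 (h1 ▸ (h.edge j hj).1)
  · exfalso
    have h3 := h.index_eq hi (h.succ_mod_lt j) (h.edge i hi).1 (h1 ▸ h.b_mem hj)
    have h4 := h.index_eq hj (h.succ_mod_lt i) (h.edge j hj).1 (h2 ▸ h.b_mem hi)
    exact h.succ_succ_mod_ne hi h4.symm h3.symm

/-- Cycle edges are not inside a constituent. -/
theorem edge_not_inside {i j : ℕ} (hi : i < ℓ) (hj : j < ℓ) :
    ¬ ∀ v ∈ s(a i, b i), v ∈ A j := by
  intro hin
  have h1 := h.index_eq hi hj (h.edge i hi).1 (hin _ (by simp))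
  have h2 := h.index_eq (h.succ_mod_lt i) hj (h.b_mem hi) (hin _ (by simp))
  exact h.succ_mod_ne hi (h2.trans h1.symm)

theorem ssubset {i : ℕ} (hi : i < ℓ) : A i ⊂ B := by
  refine Finset.ssubset_iff_subset_ne.2 ⟨h.subset hi, fun he => ?_⟩
  refine h.edge_not_inside hi hi (fun v hv => ?_)
  rw [he, h.mem_iff]
  rcases Sym2.mem_iff.1 hv with rfl | rfl
  · exact ⟨i, hi, (h.edge i hi).1⟩
  · exact ⟨_, h.succ_mod_lt i, h.b_mem hi⟩

theorem card_lt {i : ℕ} (hi : i < ℓ) : (A i).card < B.card := Finset.card_lt_card (h.ssubset hi)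

theorem card_eq : B.card = ∑ i ∈ range ℓ, (A i).card := by
  rw [h.union, card_biUnion]
  intro i hi j hj hij
  exact h.disj i (mem_range.1 hi) j (mem_range.1 hj) hij

theorem three_le_card : 3 ≤ B.card := by
  rw [h.card_eq]
  calc 3 ≤ ℓ := h.three
    _ = ∑ i ∈ range ℓ, 1 := by simp
    _ ≤ _ := Finset.sum_le_sum fun i hi =>
      Finset.card_pos.2 (h.nonempty (mem_range.1 hi))

theorem mem_edges {e : Sym2 W} : e ∈ s.EB B ↔ (∃ i < ℓ, e ∈ s.blossomEdges (A i)) ∨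
    ∃ i < ℓ, s(a i, b i) = e := by
  rw [h.edges]; simp

theorem blossomEdges_subset {i : ℕ} (hi : i < ℓ) : s.blossomEdges (A i) ⊆ s.EB B := by
  intro e he
  exact h.mem_edges.2 (Or.inl ⟨i, hi, he⟩)

theorem card_inter (M : Finset (Sym2 W))
    (hin : ∀ i < ℓ, ∀ e ∈ s.blossomEdges (A i), ∀ v ∈ e, v ∈ A i) :
    (M ∩ s.EB B).card = ∑ i ∈ range ℓ, (M ∩ s.blossomEdges (A i)).card +
      ((range ℓ).filter fun i => s(a i, b i) ∈ M).card := by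
  have h1 : M ∩ s.EB B = ((range ℓ).biUnion fun i => M ∩ s.blossomEdges (A i)) ∪
      ((range ℓ).filter fun i => s(a i, b i) ∈ M).image fun i => s(a i, b i) := by
    ext e
    simp only [mem_inter, h.mem_edges, mem_union, mem_biUnion, mem_range, mem_image, mem_filter]
    constructor
    · rintro ⟨hM, ⟨i, hi, he⟩ | ⟨i, hi, rfl⟩⟩
      · exact Or.inl ⟨i, hi, hM, he⟩
      · exact Or.inr ⟨i, ⟨hi, hM⟩, rfl⟩
    · rintro (⟨i, hi, hM, he⟩ | ⟨i, ⟨hi, hM⟩, rfl⟩)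
      · exact ⟨hM, Or.inl ⟨i, hi, he⟩⟩
      · exact ⟨hM, Or.inr ⟨i, hi, rfl⟩⟩
  rw [h1, card_union_of_disjoint, card_biUnion, card_image_of_injOn]
  · intro i hi j hj hij
    simp at hi hj
    exact h.edge_inj hi.1 hj.1 hij
  · intro i hi j hj hij
    rw [Function.onFun, Finset.disjoint_left]
    intro e he he'
    have hi' := hin i (mem_range.1 hi) e (mem_inter.1 he).2
    have hj' := hin j (mem_range.1 hj) e (mem_inter.1 he').2
    induction e with
    | _ x y =>
    exact hij (h.index_eq (mem_range.1 hi) (mem_range.1 hj) (hi' x (by simp)) (hj' x (by simp)))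
  · rw [Finset.disjoint_left]
    intro e he he'
    simp only [mem_biUnion, mem_inter, mem_range, mem_image, mem_filter] at he he'
    obtain ⟨i, hi, -, hie⟩ := he
    obtain ⟨j, ⟨hj, -⟩, rfl⟩ := he'
    exact h.edge_not_inside hj hi (hin i hi _ hie)

end State.Cycle

/-- The structural part of relaxed complementary slackness, without duals. -/
structure State.Struct (s : State W) : Prop where
  noloop : ∀ e ∈ s.E, ¬ e.IsDiag
  ends : ∀ e ∈ s.E, ∀ v ∈ e, v ∈ s.U
  matching : IsMatching s.E s.M
  nested : IsNested s.Ω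
  cycles : ∀ B ∈ s.Ω, ∃ ℓ A a b, s.Cycle (fun e => e ∈ s.E) B ℓ A a b
  active : ∀ B ∈ s.Ω, (s.M ∩ s.EB B).card = B.card / 2

/-- Possible constituents of a blossom: active blossoms and single vertices. -/
def State.Part (s : State W) (R : Finset W) : Prop := R ∈ s.Ω ∨ ∃ v ∈ s.U, R = {v}

/-- The vertex of `R` that is not covered by matching edges of the blossom `R`. -/
def State.IsBase (s : State W) (R : Finset W) (b : W) : Prop :=
  b ∈ R ∧ (∀ v ∈ R, v ≠ b → ∃ e ∈ s.M ∩ s.blossomEdges R, v ∈ e) ∧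
    ∀ e ∈ s.M ∩ s.blossomEdges R, b ∉ e

/-- Every active blossom has a cyclic structure. -/
def State.Cyclic (s : State W) : Prop :=
  ∀ B ∈ s.Ω, ∃ ℓ A a b, s.Cycle (fun e => e ∈ s.E) B ℓ A a b

namespace State.Cyclic
variable {s : State W} (hs : s.Cyclic)
include hs

theorem blossom_induction {P : Finset W → Prop}
    (h : ∀ B ℓ A a b, B ∈ s.Ω → s.Cycle (fun e => e ∈ s.E) B ℓ A a b →
      (∀ i < ℓ, A i ∈ s.Ω → P (A i)) → P B) : ∀ B ∈ s.Ω, P B := by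
  suffices H : ∀ n, ∀ B ∈ s.Ω, B.card = n → P B from fun B hB => H _ B hB rfl
  intro n
  induction n using Nat.strong_induction_on with
  | _ n ih =>
  intro B hB hn
  obtain ⟨ℓ, A, a, b, hc⟩ := hs B hB
  exact h B ℓ A a b hB hc fun i hi hA => ih _ (hn ▸ hc.card_lt hi) _ hA rfl

theorem three_le_card {B : Finset W} (hB : B ∈ s.Ω) : 3 ≤ B.card := by
  obtain ⟨ℓ, A, a, b, hc⟩ := hs B hB
  exact hc.three_le_card

theorem singleton_not_mem (v : W) : {v} ∉ s.Ω := fun h => by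
  have := hs.three_le_card h
  simp at this

theorem blossomEdges_singleton (v : W) : s.blossomEdges {v} = ∅ := by
  rw [State.blossomEdges, if_neg (hs.singleton_not_mem v)]

omit hs in
theorem _root_.MWPM.State.blossomEdges_of_mem {B : Finset W} (hB : B ∈ s.Ω) :
    s.blossomEdges B = s.EB B := if_pos hB

theorem subset_U : ∀ B ∈ s.Ω, B ⊆ s.U := by
  refine hs.blossom_induction ?_
  intro B ℓ A a b hB hc ih v hv
  obtain ⟨i, hi, hvi⟩ := hc.mem_iff.1 hv
  rcases hc.child i hi with h | ⟨u, hu, h⟩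
  · exact ih i hi h hvi
  · rw [h, mem_singleton] at hvi
    exact hvi ▸ hu

theorem inside : ∀ B ∈ s.Ω, ∀ e ∈ s.EB B, ∀ v ∈ e, v ∈ B := by
  refine hs.blossom_induction ?_
  intro B ℓ A a b hB hc ih e he v hv
  rcases hc.mem_edges.1 he with ⟨i, hi, he⟩ | ⟨i, hi, rfl⟩
  · rcases hc.child i hi with h | ⟨u, hu, h⟩
    · rw [blossomEdges_of_mem h] at he
      exact hc.subset hi (ih i hi h e he v hv)
    · rw [h, hs.blossomEdges_singleton] at he
      simp at he
  · rcases Sym2.mem_iff.1 hv with rfl | rfl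
    · exact hc.subset hi (hc.edge i hi).1
    · exact hc.subset (hc.succ_mod_lt i) (hc.b_mem hi)

theorem EB_subset : ∀ B ∈ s.Ω, s.EB B ⊆ s.E := by
  refine hs.blossom_induction ?_
  intro B ℓ A a b hB hc ih e he
  rcases hc.mem_edges.1 he with ⟨i, hi, he⟩ | ⟨i, hi, rfl⟩
  · rcases hc.child i hi with h | ⟨u, hu, h⟩
    · rw [blossomEdges_of_mem h] at he
      exact ih i hi h he
    · rw [h, hs.blossomEdges_singleton] at he
      simp at he
  · exact (hc.edge i hi).2.2

theorem odd_card : ∀ B ∈ s.Ω, Odd B.card := by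
  refine hs.blossom_induction ?_
  intro B ℓ A a b hB hc ih
  rw [hc.card_eq, Finset.odd_sum_iff_odd_card_odd]
  convert hc.odd
  rw [filter_true_of_mem, card_range]
  intro i hi
  rcases hc.child i (mem_range.1 hi) with h | ⟨u, hu, h⟩
  · exact ih i (mem_range.1 hi) h
  · rw [h, card_singleton]; exact odd_one

theorem blossomEdges_inside {R : Finset W} {e : Sym2 W} (he : e ∈ s.blossomEdges R) {v : W}
    (hv : v ∈ e) : v ∈ R := by
  unfold State.blossomEdges at he
  split_ifs at he with h
  · exact hs.inside R h e he v hv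
  · simp at he

end State.Cyclic

/-- Each constituent has odd size and is matched up to one vertex, so `B.card` is twice the number
of matched edges inside constituents plus `ℓ`. Thus `B` has `B.card / 2` matched edges exactly when
`ℓ / 2` cycle edges are matched. Addition on both sides avoids truncated subtraction. -/
theorem State.Cyclic.card_cycle_edges {s : State W} (hs : s.Cyclic) {C : Sym2 W → Prop}
    {B : Finset W} {ℓ : ℕ} {A : ℕ → Finset W} {a b : ℕ → W} (hc : s.Cycle C B ℓ A a b)
    (hA : ∀ i < ℓ, A i ∈ s.Ω → (s.M ∩ s.EB (A i)).card = (A i).card / 2) :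
    (s.M ∩ s.EB B).card + ℓ / 2 =
      B.card / 2 + ((range ℓ).filter fun i => s(a i, b i) ∈ s.M).card := by
  rw [hc.card_inter s.M (fun i _ e he v hv => hs.blossomEdges_inside he hv)]
  have h1 : B.card = 2 * ∑ i ∈ range ℓ, (s.M ∩ s.blossomEdges (A i)).card + ℓ := by
    rw [hc.card_eq, mul_sum]
    have hℓ : ∑ _i ∈ range ℓ, 1 = ℓ := by simp
    refine Eq.trans ?_ (congrArg _ hℓ)
    rw [← sum_add_distrib]
    refine sum_congr rfl fun i hi => ?_
    rcases hc.child i (mem_range.1 hi) with h | ⟨v, -, h⟩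
    · rw [State.blossomEdges_of_mem h, hA i (mem_range.1 hi) h]
      obtain ⟨k, hk⟩ := hs.odd_card _ h
      omega
    · rw [h, hs.blossomEdges_singleton]
      simp
  obtain ⟨m, hm⟩ := hc.odd
  omega

theorem card_filter_odd (n : ℕ) : ((range n).filter Odd).card = n / 2 := by
  induction n with
  | zero => simp
  | succ n ih =>
    rw [range_add_one, filter_insert]
    split_ifs with h
    · rw [card_insert_of_notMem (by simp), ih]
      obtain ⟨k, rfl⟩ := h
      omega
    · rw [ih]
      rw [Nat.not_odd_iff_even] at h
      obtain ⟨k, rfl⟩ := h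
      omega

theorem State.Cyclic.active_of_isBlossom {s : State W} (hs : s.Cyclic)
    (hb : ∀ B ∈ s.Ω, s.IsBlossom (fun e => e ∈ s.E) B) :
    ∀ B ∈ s.Ω, (s.M ∩ s.EB B).card = B.card / 2 := by
  suffices H : ∀ n, ∀ B ∈ s.Ω, B.card = n → (s.M ∩ s.EB B).card = B.card / 2 from
    fun B hB => H _ B hB rfl
  intro n
  induction n using Nat.strong_induction_on with
  | _ n ih =>
  intro B hB hn
  obtain ⟨ℓ, A, a, b, hc, hM⟩ := State.isBlossom_iff.1 (hb B hB)
  have h1 := hs.card_cycle_edges hc fun i hi hA => ih _ (hn ▸ hc.card_lt hi) _ hA rfl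
  have h2 : ((range ℓ).filter fun i => s(a i, b i) ∈ s.M) = (range ℓ).filter Odd :=
    filter_congr fun i hi => hM i (mem_range.1 hi)
  rw [h2, card_filter_odd] at h1
  omega

namespace State.Struct
variable {s : State W} (hs : s.Struct)
include hs

theorem cyclic : s.Cyclic := hs.cycles

theorem not_diag {e : Sym2 W} (he : e ∈ s.M) : ¬ e.IsDiag := hs.noloop e (hs.matching.1 he)

theorem part_odd {R : Finset W} (hR : s.Part R) : Odd R.card := by
  rcases hR with h | ⟨v, -, rfl⟩
  · exact hs.cyclic.odd_card R h
  · rw [card_singleton]; exact odd_one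

theorem part_card {R : Finset W} (hR : s.Part R) :
    (s.M ∩ s.blossomEdges R).card = R.card / 2 := by
  rcases hR with h | ⟨v, -, rfl⟩
  · rw [blossomEdges_of_mem h]; exact hs.active R h
  · rw [hs.cyclic.blossomEdges_singleton]; simp

/-- The `R.card / 2` matched edges of `R` are disjoint and lie inside `R`, and `R.card` is odd, so
exactly one vertex is left over. -/
theorem exists_base {R : Finset W} (hR : s.Part R) : ∃ b, s.IsBase R b := by
  set MR := s.M ∩ s.blossomEdges R with hMR
  have hcov : (MR.biUnion fun e => e.toFinset).card = 2 * MR.card := by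
    rw [card_biUnion]
    · rw [Finset.sum_congr rfl (g := fun _ => 2), sum_const, smul_eq_mul, mul_comm]
      intro e he
      exact Sym2.card_toFinset_of_not_isDiag e (hs.not_diag (mem_inter.1 he).1)
    · intro e he f hf hef
      rw [Function.onFun, Finset.disjoint_left]
      intro v hv hv'
      rw [Sym2.mem_toFinset] at hv hv'
      exact hef (hs.matching.2 e (mem_inter.1 he).1 f (mem_inter.1 hf).1 v hv hv')
  have hsub : (MR.biUnion fun e => e.toFinset) ⊆ R := by
    intro v hv
    simp only [mem_biUnion, Sym2.mem_toFinset] at hv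
    obtain ⟨e, he, hve⟩ := hv
    exact hs.cyclic.blossomEdges_inside (mem_inter.1 he).2 hve
  have hcard : (R \ (MR.biUnion fun e => e.toFinset)).card = 1 := by
    rw [card_sdiff_of_subset hsub, hcov, hs.part_card hR]
    obtain ⟨k, hk⟩ := hs.part_odd hR
    omega
  obtain ⟨b, hb⟩ := card_eq_one.1 hcard
  have hb' : ∀ v, (v ∈ R ∧ ¬ ∃ e ∈ MR, v ∈ e) ↔ v = b := by
    intro v
    have : v ∈ R \ (MR.biUnion fun e => e.toFinset) ↔ v ∈ ({b} : Finset W) := by rw [hb]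
    simpa [mem_sdiff, mem_biUnion, Sym2.mem_toFinset] using this
  have hbb := (hb' b).2 rfl
  refine ⟨b, hbb.1, ?_, fun e he h => hbb.2 ⟨e, he, h⟩⟩
  intro v hv hvb
  by_contra hcon
  exact hvb ((hb' v).1 ⟨hv, hcon⟩)

theorem eq_base {R : Finset W} {b v : W} {e : Sym2 W} (hb : s.IsBase R b) (he : e ∈ s.M)
    (heR : e ∉ s.blossomEdges R) (hv : v ∈ e) (hvR : v ∈ R) : v = b := by
  by_contra hne
  obtain ⟨f, hf, hvf⟩ := hb.2.1 v hvR hne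
  have := hs.matching.2 e he f (mem_inter.1 hf).1 v hv hvf
  exact heR (this ▸ (mem_inter.1 hf).2)

omit hs in
theorem _root_.MWPM.State.IsBase.eq_of_free {R : Finset W} {b v : W} (hb : s.IsBase R b)
    (hv : s.Free v) (hvR : v ∈ R) : v = b := by
  by_contra hne
  obtain ⟨f, hf, hvf⟩ := hb.2.1 v hvR hne
  exact hv.2 f (mem_inter.1 hf).1 hvf

/-- A matched edge that is not a blossom edge of `R` can touch `R` only at the base, and the base
has only one matched edge. This makes the matching functional on contracted graphs. -/
theorem matched_unique {R : Finset W} (hR : s.Part R) {e f : Sym2 W} (he : e ∈ s.M)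
    (hf : f ∈ s.M) (heR : e ∉ s.blossomEdges R) (hfR : f ∉ s.blossomEdges R) {v w : W}
    (hv : v ∈ e) (hvR : v ∈ R) (hw : w ∈ f) (hwR : w ∈ R) : e = f ∧ v = w := by
  obtain ⟨b, hb⟩ := hs.exists_base hR
  have h1 := hs.eq_base hb he heR hv hvR
  have h2 := hs.eq_base hb hf hfR hw hwR
  subst h1
  subst h2
  exact ⟨hs.matching.2 e he f hf _ hv hw, rfl⟩

theorem not_free_of_matched {R : Finset W} (hR : s.Part R) {e : Sym2 W} (he : e ∈ s.M)
    (heR : e ∉ s.blossomEdges R) {v w : W} (hv : v ∈ e) (hvR : v ∈ R) (hwR : w ∈ R) :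
    ¬ s.Free w := by
  intro hw
  obtain ⟨b, hb⟩ := hs.exists_base hR
  have h1 := hs.eq_base hb he heR hv hvR
  have h2 := hb.eq_of_free hw hwR
  exact hw.2 e he (h2 ▸ h1 ▸ hv)

theorem not_mem_blossomEdges {R : Finset W} {u v : W} (hv : v ∉ R) :
    s(u, v) ∉ s.blossomEdges R := fun h => hv (hs.cyclic.blossomEdges_inside h (by simp))

/-- The count forces `ℓ / 2` matched cycle edges, and consecutive ones would leave the constituent
between them twice. So the matched edges alternate after a rotation, which restores the blossom
pattern after the base has moved. -/
theorem isBlossom_of_cycle {C : Sym2 W → Prop} {B : Finset W} {ℓ : ℕ} {A : ℕ → Finset W}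
    {a b : ℕ → W} (hc : s.Cycle C B ℓ A a b) (hcard : (s.M ∩ s.EB B).card = B.card / 2) :
    s.IsBlossom C B := by
  have hpos := hc.pos
  have hcnt : ((range ℓ).filter fun i => s(a (i % ℓ), b (i % ℓ)) ∈ s.M).card = ℓ / 2 := by
    have h1 := hs.cyclic.card_cycle_edges hc fun i _ hA => hs.active _ hA
    rw [hcard] at h1
    have h2 : ((range ℓ).filter fun i => s(a (i % ℓ), b (i % ℓ)) ∈ s.M) =
        (range ℓ).filter fun i => s(a i, b i) ∈ s.M := by
      refine filter_congr fun i hi => ?_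
      rw [Nat.mod_eq_of_lt (mem_range.1 hi)]
    rw [h2]
    omega
  have hlt : ∀ n, n % ℓ < ℓ := fun n => Nat.mod_lt _ hpos
  have hsucc : ∀ n, (n % ℓ + 1) % ℓ = (n + 1) % ℓ := fun n => by rw [Nat.mod_add_mod]
  obtain ⟨k, hk⟩ := exists_rotation hc.odd (fun i => s(a (i % ℓ), b (i % ℓ)) ∈ s.M)
    (fun n => by simp) (by
      rintro n ⟨h1, h2⟩
      have hb1 := hc.b_mem (hlt n)
      rw [hsucc] at hb1
      have ha2 := (hc.edge _ (hlt (n + 1))).1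
      have hne : ∀ j i, j < ℓ → i < ℓ → s(a i, b i) ∉ s.blossomEdges (A j) := fun j i hj hi h =>
        hc.edge_not_inside hi hj fun v hv => hs.cyclic.blossomEdges_inside h hv
      have h3 := hs.matched_unique (hc.child _ (hlt (n + 1))) h1 h2 (hne _ _ (hlt _) (hlt _))
        (hne _ _ (hlt _) (hlt _)) (Sym2.mem_mk_right _ _) hb1 (Sym2.mem_mk_left _ _) ha2
      have h4 := hc.edge_inj (hlt _) (hlt _) h3.1
      have h5 := hc.succ_mod_ne (hlt n)
      rw [hsucc] at h5
      exact h5 h4.symm) hcnt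
  have hbij : (range ℓ).image (fun i => (k + i) % ℓ) = range ℓ := by
    refine Finset.eq_of_subset_of_card_le ?_ ?_
    · intro x hx
      simp only [mem_image, mem_range] at hx ⊢
      obtain ⟨i, -, rfl⟩ := hx
      exact hlt _
    · rw [card_image_of_injOn]
      intro i hi j hj hij
      simp only [coe_range, Set.mem_Iio] at hi hj
      have : i ≡ j [MOD ℓ] := Nat.ModEq.add_left_cancel' k hij
      rwa [Nat.ModEq, Nat.mod_eq_of_lt hi, Nat.mod_eq_of_lt hj] at this
  refine State.isBlossom_iff.2 ⟨ℓ, fun i => A ((k + i) % ℓ), fun i => a ((k + i) % ℓ),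
    fun i => b ((k + i) % ℓ), ⟨hc.odd, hc.three, by simp, ?_, ?_, ?_, ?_, ?_, ?_⟩, ?_⟩
  · intro i hi j hj hij
    refine hc.disj _ (hlt _) _ (hlt _) fun h => hij ?_
    have : i ≡ j [MOD ℓ] := Nat.ModEq.add_left_cancel' k h
    rwa [Nat.ModEq, Nat.mod_eq_of_lt hi, Nat.mod_eq_of_lt hj] at this
  · exact fun i _ => hc.child _ (hlt _)
  · intro i _
    refine ⟨(hc.edge _ (hlt _)).1, ?_, (hc.edge _ (hlt _)).2.2⟩
    have := hc.b_mem (hlt (k + i))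
    rwa [hsucc] at this
  · rw [hc.union]
    conv_lhs => rw [← hbij, image_biUnion]
  · rw [hc.edges]
    congr 1
    · conv_lhs => rw [← hbij, image_biUnion]
    · conv_lhs => rw [← hbij, image_image]
      rfl
  · intro D hD hDB
    obtain ⟨i, hi, hDi⟩ := hc.inside D hD hDB
    have : i ∈ (range ℓ).image (fun i => (k + i) % ℓ) := by rw [hbij]; exact mem_range.2 hi
    simp only [mem_image, mem_range] at this
    obtain ⟨j, hj, rfl⟩ := this
    exact ⟨j, hj, hDi⟩
  · exact hk

theorem isBlossom {B : Finset W} (hB : B ∈ s.Ω) : s.IsBlossom (fun e => e ∈ s.E) B := by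
  obtain ⟨ℓ, A, a, b, hc⟩ := hs.cycles B hB
  exact hs.isBlossom_of_cycle hc (hs.active B hB)

end State.Struct

theorem State.Struct.of_isBlossom {s : State W} (h1 : ∀ e ∈ s.E, ¬ e.IsDiag)
    (h2 : ∀ e ∈ s.E, ∀ v ∈ e, v ∈ s.U) (h3 : IsMatching s.E s.M) (h4 : IsNested s.Ω)
    (h5 : ∀ B ∈ s.Ω, s.IsBlossom (fun e => e ∈ s.E) B) : s.Struct where
  noloop := h1
  ends := h2
  matching := h3
  nested := h4
  cycles B hB := by
    obtain ⟨ℓ, A, a, b, h, -⟩ := State.isBlossom_iff.1 (h5 B hB)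
    exact ⟨ℓ, A, a, b, h⟩
  active := State.Cyclic.active_of_isBlossom (fun B hB => by
    obtain ⟨ℓ, A, a, b, h, -⟩ := State.isBlossom_iff.1 (h5 B hB)
    exact ⟨ℓ, A, a, b, h⟩) h5

/-! ### Roots -/

section Roots
variable {Ω : Finset (Finset W)}

theorem mem_rootOf {u v : W} : u ∈ rootOf Ω v ↔ u = v ∨ ∃ B ∈ Ω, v ∈ B ∧ u ∈ B := by
  simp [rootOf]

theorem self_mem_rootOf (v : W) : v ∈ rootOf Ω v := mem_rootOf.2 (Or.inl rfl)

theorem subset_rootOf {B : Finset W} (hB : B ∈ Ω) {v : W} (hv : v ∈ B) : B ⊆ rootOf Ω v :=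
  fun _ hu => mem_rootOf.2 (Or.inr ⟨B, hB, hv, hu⟩)

theorem rootOf_eq_singleton {v : W} (h : ∀ B ∈ Ω, v ∉ B) : rootOf Ω v = {v} := by
  ext u
  rw [mem_rootOf, mem_singleton]
  constructor
  · rintro (h1 | ⟨B, hB, hv, -⟩)
    · exact h1
    · exact absurd hv (h B hB)
  · exact Or.inl

variable (hΩ : IsNested Ω)
include hΩ

/-- `rootOf` is the union of all blossoms through `v`; nestedness identifies it with the maximal
one. -/
theorem rootOf_eq_of_maximal {B : Finset W} (hB : B ∈ Ω) (hmax : ∀ C ∈ Ω, B ⊆ C → C = B) {v : W}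
    (hv : v ∈ B) : rootOf Ω v = B := by
  refine Finset.Subset.antisymm ?_ (subset_rootOf hB hv)
  intro u hu
  rcases mem_rootOf.1 hu with rfl | ⟨C, hC, hvC, huC⟩
  · exact hv
  · rcases hΩ B hB C hC with h | h | h
    · exact hmax C hC h ▸ huC
    · exact h huC
    · exact absurd hvC (Finset.disjoint_left.1 h hv)

theorem exists_maximal {B : Finset W} (hB : B ∈ Ω) :
    ∃ D ∈ Ω, B ⊆ D ∧ ∀ C ∈ Ω, D ⊆ C → C = D := by
  obtain ⟨D, hD, hmax⟩ := Finset.exists_max_image (Ω.filter fun C => B ⊆ C) Finset.card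
    ⟨B, by simp [hB]⟩
  rw [mem_filter] at hD
  refine ⟨D, hD.1, hD.2, fun C hC hDC => ?_⟩
  have := hmax C (mem_filter.2 ⟨hC, hD.2.trans hDC⟩)
  exact (Finset.eq_of_subset_of_card_le hDC this).symm

theorem rootOf_mem {B : Finset W} (hB : B ∈ Ω) {v : W} (hv : v ∈ B) :
    rootOf Ω v ∈ Ω ∧ ∀ C ∈ Ω, rootOf Ω v ⊆ C → C = rootOf Ω v := by
  obtain ⟨D, hD, hBD, hmax⟩ := exists_maximal hΩ hB
  rw [rootOf_eq_of_maximal hΩ hD hmax (hBD hv)]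
  exact ⟨hD, hmax⟩

theorem rootOf_cases (v : W) : (rootOf Ω v = {v} ∧ ∀ B ∈ Ω, v ∉ B) ∨
    (rootOf Ω v ∈ Ω ∧ ∀ C ∈ Ω, rootOf Ω v ⊆ C → C = rootOf Ω v) := by
  by_cases h : ∃ B ∈ Ω, v ∈ B
  · obtain ⟨B, hB, hv⟩ := h
    exact Or.inr (rootOf_mem hΩ hB hv)
  · push Not at h
    exact Or.inl ⟨rootOf_eq_singleton h, h⟩

theorem rootOf_eq_of_mem {u v : W} (h : u ∈ rootOf Ω v) : rootOf Ω u = rootOf Ω v := by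
  rcases rootOf_cases hΩ v with ⟨h1, -⟩ | ⟨h1, h2⟩
  · rw [h1, mem_singleton] at h
    rw [h]
  · exact rootOf_eq_of_maximal hΩ h1 h2 h

theorem rootOf_eq_of_blossom {B : Finset W} (hB : B ∈ Ω) {u v : W} (hu : u ∈ B) (hv : v ∈ B) :
    rootOf Ω u = rootOf Ω v :=
  rootOf_eq_of_mem hΩ (subset_rootOf hB hv hu)

theorem exists_blossom_of_rootOf_eq {u v : W} (h : rootOf Ω u = rootOf Ω v) (hne : u ≠ v) :
    ∃ B ∈ Ω, u ∈ B ∧ v ∈ B := by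
  rcases rootOf_cases hΩ v with ⟨h1, -⟩ | ⟨h1, h2⟩
  · have h3 := self_mem_rootOf (Ω := Ω) u
    rw [h, h1, mem_singleton] at h3
    exact absurd h3 hne
  · exact ⟨_, h1, h ▸ self_mem_rootOf u, self_mem_rootOf v⟩

end Roots

theorem State.Struct.rootOf_part {s : State W} (hs : s.Struct) {v : W} (hv : v ∈ s.U) :
    s.Part (rootOf s.Ω v) := by
  rcases rootOf_cases hs.nested v with ⟨h1, -⟩ | ⟨h1, -⟩
  · exact Or.inr ⟨v, hv, h1⟩
  · exact Or.inl h1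

theorem State.Struct.rootOf_subset_U {s : State W} (hs : s.Struct) {u v : W} (hv : v ∈ s.U)
    (hu : u ∈ rootOf s.Ω v) : u ∈ s.U := by
  rcases hs.rootOf_part hv with h | ⟨w, hw, h⟩
  · exact hs.cyclic.subset_U _ h hu
  · rw [h, mem_singleton] at hu
    exact hu ▸ hw

end Structure

/-! ### The shrunken graph as an abstract alternating graph -/

section NodeGraph
variable {W : Type u} [Fintype W] [DecidableEq W]

/-- The vertices of the shrunken graph. -/
def State.IsNode (s : State W) (R : Finset W) : Prop := ∃ v ∈ s.U, R = rootOf s.Ω v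

namespace State.Struct
variable {s : State W} (hs : s.Struct)
include hs

theorem node_part {R : Finset W} (hR : s.IsNode R) : s.Part R := by
  obtain ⟨v, hv, rfl⟩ := hR
  exact hs.rootOf_part hv

theorem node_eq {R : Finset W} (hR : s.IsNode R) {u : W} (hu : u ∈ R) : R = rootOf s.Ω u := by
  obtain ⟨v, hv, rfl⟩ := hR
  exact (rootOf_eq_of_mem hs.nested hu).symm

theorem node_subset_U {R : Finset W} (hR : s.IsNode R) {u : W} (hu : u ∈ R) : u ∈ s.U := by
  obtain ⟨v, hv, rfl⟩ := hR
  exact hs.rootOf_subset_U hv hu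

theorem node_eq_of_mem {R R' : Finset W} (hR : s.IsNode R) (hR' : s.IsNode R') {u : W}
    (hu : u ∈ R) (hu' : u ∈ R') : R = R' := (hs.node_eq hR hu).trans (hs.node_eq hR' hu').symm

theorem isNode_rootOf {v : W} (hv : v ∈ s.U) : s.IsNode (rootOf s.Ω v) := ⟨v, hv, rfl⟩

end State.Struct

theorem State.Free.congr {s t : State W} (hU : t.U = s.U) (hM : t.M = s.M) {v : W} :
    t.Free v ↔ s.Free v := by
  unfold State.Free
  rw [hU, hM]

/-- The shrunken graph of eligible edges. -/
def nodeGraph (s : State W) (hs : s.Struct) (c : Criterion) (F : Finset W) :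
    AltGraph (Finset W) where
  r b R R' := R ≠ R' ∧ s.IsNode R ∧ s.IsNode R' ∧
    ∃ u ∈ R, ∃ v ∈ R', s.Eligible c s(u, v) ∧ (s(u, v) ∈ s.M ↔ b = true)
  S R := s.IsNode R ∧ ∃ f ∈ F, f ∈ R ∧ s.Free f
  T R := s.IsNode R ∧ ∃ f ∈ R, s.Free f
  symm := by
    rintro b R R' ⟨h1, h2, h3, u, hu, v, hv, h4⟩
    exact ⟨h1.symm, h3, h2, v, hv, u, hu, by rwa [Sym2.eq_swap]⟩
  ne h := h.1
  func := by
    rintro R R' R'' ⟨h1, h2, h3, u, hu, v, hv, h4, h5⟩ ⟨k1, k2, k3, u', hu', v', hv', k4, k5⟩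
    have h6 : v ∉ R := fun h => h1 (hs.node_eq_of_mem h2 h3 h hv)
    have k6 : v' ∉ R := fun h => k1 (hs.node_eq_of_mem h2 k3 h hv')
    obtain ⟨h7, rfl⟩ := hs.matched_unique (hs.node_part h2) (h5.2 rfl) (k5.2 rfl)
      (hs.not_mem_blossomEdges h6) (hs.not_mem_blossomEdges k6)
      (Sym2.mem_mk_left _ _) hu (Sym2.mem_mk_left _ _) hu'
    rw [Sym2.congr_right] at h7
    subst h7
    exact hs.node_eq_of_mem h3 k3 hv hv'
  start_free := by
    rintro R ⟨h1, f, -, hf, hfree⟩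
    exact ⟨h1, f, hf, hfree⟩
  free_unmatched := by
    rintro R R' ⟨h1, f, hf, hfree⟩ ⟨k1, k2, k3, u, hu, v, hv, k4, k5⟩
    have h6 : v ∉ R := fun h => k1 (hs.node_eq_of_mem h1 k3 h hv)
    exact hs.not_free_of_matched (hs.node_part h1) (k5.2 rfl)
      (hs.not_mem_blossomEdges h6) (Sym2.mem_mk_left _ _) hu hf hfree

variable {s : State W} (hs : s.Struct) {c : Criterion} {F : Finset W}

theorem nodup_getElem_ne {α : Type*} {l : List α} (h : l.Nodup) {j : ℕ} {x y : α}
    (hx : l[j]? = some x) (hy : l[j + 1]? = some y) : x ≠ y := by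
  rintro rfl
  obtain ⟨h1, h2⟩ := List.getElem?_eq_some_iff.1 hx
  obtain ⟨h3, h4⟩ := List.getElem?_eq_some_iff.1 hy
  have := (List.Nodup.getElem_inj_iff h).1 (h2.trans h4.symm)
  omega

theorem AltGraph.IsPath.isNode {ρ : List (Finset W)} (h : (nodeGraph s hs c F).IsPath ρ)
    {R : Finset W} (hR : R ∈ ρ) : s.IsNode R := by
  obtain ⟨l₁, l₂, rfl⟩ := List.append_of_mem hR
  obtain rfl | ⟨l', w, rfl⟩ := eq_nil_or_snoc l₁
  · exact h.start.1
  · have h1 : (nodeGraph s hs c F).IsPath (l' ++ w :: R :: l₂) := by simpa using h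
    exact h1.edge.2.2.1

theorem isAltPath_iff {ρ : List (Finset W)} :
    s.IsAltPath c F ρ ↔ (nodeGraph s hs c F).IsPath ρ := by
  constructor
  · rintro ⟨h1, h2, ⟨R, hR, hf⟩, h4⟩
    refine ⟨h1, ?_, R, hR, h2 R (List.mem_of_head? hR), hf⟩
    rw [altChain_iff_getElem]
    intro j x y hx hy
    obtain ⟨u, hu, v, hv, he, hM⟩ := h4 j x y hx hy
    exact ⟨nodup_getElem_ne h1 hx hy, h2 x (List.mem_of_getElem? hx),
      h2 y (List.mem_of_getElem? hy), u, hu, v, hv, he, by rw [hM, odd_iff_bodd]; simp⟩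
  · intro h
    obtain ⟨h1, h2, R, hR, -, hf⟩ := id h
    refine ⟨h1, fun R hR => h.isNode hs hR, ⟨R, hR, hf⟩, ?_⟩
    rw [altChain_iff_getElem] at h2
    intro j x y hx hy
    obtain ⟨-, -, -, u, hu, v, hv, he, hM⟩ := h2 j x y hx hy
    exact ⟨u, hu, v, hv, he, by rw [hM, odd_iff_bodd]; simp⟩

theorem getLast?_eq_some_iff' {α : Type*} {l : List α} {x : α} :
    l.getLast? = some x ↔ ∃ l', l = l' ++ [x] := by
  rw [List.getLast?_eq_some_iff]

/-- `ρ.length` counts vertices, so a list of odd length is a path with an even number of edges. -/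
theorem exists_odd_path_iff {R : Finset W} :
    (∃ ρ, s.IsAltPath c F ρ ∧ Odd ρ.length ∧ ρ.getLast? = some R) ↔
      (nodeGraph s hs c F).Out R := by
  constructor
  · rintro ⟨ρ, h1, h2, h3⟩
    obtain ⟨l, rfl⟩ := getLast?_eq_some_iff'.1 h3
    exact ⟨l, (isAltPath_iff hs).1 h1, by simpa [Nat.odd_add_one] using h2⟩
  · rintro ⟨l, h1, h2⟩
    exact ⟨l ++ [R], (isAltPath_iff hs).2 h1, by simpa using h2.add_one, by simp⟩

theorem exists_even_path_iff {R : Finset W} :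
    (∃ ρ, s.IsAltPath c F ρ ∧ Even ρ.length ∧ ρ.getLast? = some R) ↔
      (nodeGraph s hs c F).In R := by
  constructor
  · rintro ⟨ρ, h1, h2, h3⟩
    obtain ⟨l, rfl⟩ := getLast?_eq_some_iff'.1 h3
    exact ⟨l, (isAltPath_iff hs).1 h1, by simpa [Nat.even_add_one] using h2⟩
  · rintro ⟨l, h1, h2⟩
    exact ⟨l ++ [R], (isAltPath_iff hs).2 h1, by simpa using h2.add_one, by simp⟩

theorem outer_iff {v : W} : s.Outer c F v ↔
    v ∈ s.U ∧ (nodeGraph s hs c F).Out (rootOf s.Ω v) := by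
  rw [State.Outer, exists_odd_path_iff hs]

theorem inner_iff {v : W} : s.Inner c F v ↔
    v ∈ s.U ∧ ¬ s.Outer c F v ∧ (nodeGraph s hs c F).In (rootOf s.Ω v) := by
  rw [State.Inner, exists_even_path_iff hs]

theorem noAug_iff : (¬ ∃ ρ, s.IsAugPath c F ρ) ↔ (nodeGraph s hs c F).NoAug := by
  constructor
  · rintro h R ⟨-, g, hg, hfree⟩ hI
    obtain ⟨ρ, h1, h2, h3⟩ := (exists_even_path_iff hs).2 hI
    exact h ⟨ρ, h1, h2, R, h3, g, hg, hfree⟩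
  · rintro h ⟨ρ, h1, h2, R, h3, g, hg, hfree⟩
    refine h R ⟨?_, g, hg, hfree⟩ ((exists_even_path_iff hs).1 ⟨ρ, h1, h2, h3⟩)
    exact ((isAltPath_iff hs).1 h1).isNode hs (List.mem_of_getLast? h3)

/-! ### Adding blossoms -/

/-- By `hnew` no new blossom lies inside `D`, so its constituents, their edge sets and the clause on
the children mean the same in both states. -/
theorem State.Cycle.transfer {s t : State W} {C C' : Sym2 W → Prop} {D : Finset W} {ℓ : ℕ}
    {A : ℕ → Finset W} {a b : ℕ → W} (hc : s.Cycle C D ℓ A a b)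
    (hU : ∀ v ∈ D, v ∈ s.U → v ∈ t.U) (hΩ : s.Ω ⊆ t.Ω)
    (hEB : ∀ B ∈ s.Ω, t.EB B = s.EB B) (hEBD : t.EB D = s.EB D)
    (hnew : ∀ B ∈ t.Ω, B ∉ s.Ω → ¬ B ⊆ D) (hC : ∀ i < ℓ, C s(a i, b i) → C' s(a i, b i)) :
    t.Cycle C' D ℓ A a b := by
  have hb : ∀ i < ℓ, t.blossomEdges (A i) = s.blossomEdges (A i) := by
    intro i hi
    unfold State.blossomEdges
    by_cases h : A i ∈ s.Ω
    · rw [if_pos h, if_pos (hΩ h), hEB _ h]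
    · rw [if_neg h, if_neg]
      intro h'
      exact hnew _ h' h (hc.subset hi)
  refine ⟨hc.odd, hc.three, hc.wrap, hc.disj, ?_, ?_, hc.union, ?_, ?_⟩
  · intro i hi
    rcases hc.child i hi with h | ⟨v, hv, h⟩
    · exact Or.inl (hΩ h)
    · exact Or.inr ⟨v, hU v (hc.subset hi (by rw [h]; simp)) hv, h⟩
  · exact fun i hi => ⟨(hc.edge i hi).1, (hc.edge i hi).2.1, hC i hi (hc.edge i hi).2.2⟩
  · rw [hEBD, hc.edges]
    congr 1
    exact biUnion_congr rfl fun i hi => (hb i (mem_range.1 hi)).symm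
  · intro B hB hBD
    by_cases h : B ∈ s.Ω
    · exact hc.inside B h hBD
    · exact absurd hBD.1 (hnew B hB h)

theorem State.IsBlossom.mono {s : State W} {C C' : Sym2 W → Prop} {D : Finset W}
    (h : s.IsBlossom C D) (hC : ∀ e, C e → C' e) : s.IsBlossom C' D := by
  obtain ⟨ℓ, A, a, b, hc, hM⟩ := State.isBlossom_iff.1 h
  exact State.isBlossom_iff.2 ⟨ℓ, A, a, b, ⟨hc.odd, hc.three, hc.wrap, hc.disj, hc.child,
    fun i hi => ⟨(hc.edge i hi).1, (hc.edge i hi).2.1, hC _ (hc.edge i hi).2.2⟩, hc.union,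
    hc.edges, hc.inside⟩, hM⟩

theorem State.IsBlossom.transfer {s t : State W} {C : Sym2 W → Prop} {D : Finset W}
    (h : s.IsBlossom C D) (hU : t.U = s.U) (hM : t.M = s.M) (hΩ : s.Ω ⊆ t.Ω)
    (hEB : ∀ B ∈ s.Ω, t.EB B = s.EB B) (hD : D ∈ s.Ω)
    (hnew : ∀ B ∈ t.Ω, B ∉ s.Ω → ¬ B ⊆ D) : t.IsBlossom C D := by
  obtain ⟨ℓ, A, a, b, hc, hM'⟩ := State.isBlossom_iff.1 h
  exact State.isBlossom_iff.2 ⟨ℓ, A, a, b, hc.transfer (fun v _ hv => hU ▸ hv) hΩ hEB (hEB D hD)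
    hnew (fun _ _ h => h), by rwa [hM]⟩

/-- `t` arises from `s` by adding blossoms formed by eligible edges. -/
structure Extension (c : Criterion) (s t : State W) : Prop where
  U : t.U = s.U
  E : t.E = s.E
  M : t.M = s.M
  w : t.w = s.w
  y : t.y = s.y
  z : t.z = s.z
  Ω : s.Ω ⊆ t.Ω
  EB : ∀ B ∈ s.Ω, t.EB B = s.EB B
  nested : IsNested t.Ω
  not_subset : ∀ B ∈ t.Ω, B ∉ s.Ω → ∀ C ∈ s.Ω, ¬ B ⊆ C
  blossom : ∀ B ∈ t.Ω, B ∉ s.Ω → t.IsBlossom (s.Eligible c) B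

namespace Extension
variable {t : State W} (h : Extension c s t)
include h

theorem struct (hs : s.Struct) : t.Struct := by
  refine State.Struct.of_isBlossom ?_ ?_ ?_ h.nested ?_
  · rw [h.E]; exact hs.noloop
  · rw [h.E, h.U]; exact hs.ends
  · rw [h.E, h.M]; exact hs.matching
  · intro B hB
    by_cases hBs : B ∈ s.Ω
    · rw [h.E]
      exact (hs.isBlossom hBs).transfer h.U h.M h.Ω h.EB hBs fun D hD hDs =>
        h.not_subset D hD hDs B hBs
    · rw [h.E]
      exact (h.blossom B hB hBs).mono fun e he => he.1

theorem yz_eq : t.yz = s.yz := by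
  funext e
  unfold State.yz
  rw [h.y, h.z]

theorem free_iff {v : W} : t.Free v ↔ s.Free v := State.Free.congr h.U h.M

theorem rootOf_subset {v : W} : rootOf s.Ω v ⊆ rootOf t.Ω v := by
  intro u hu
  rw [mem_rootOf] at hu ⊢
  rcases hu with hu | ⟨B, hB, h1⟩
  · exact Or.inl hu
  · exact Or.inr ⟨B, h.Ω hB, h1⟩

theorem rootOf_eq {u v : W} (huv : rootOf s.Ω u = rootOf s.Ω v) :
    rootOf t.Ω u = rootOf t.Ω v :=
  rootOf_eq_of_mem h.nested (h.rootOf_subset (huv ▸ self_mem_rootOf u))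

/-- Two vertices in different roots of `s` but in the same root of `t` are in a common new root. -/
theorem exists_new {u v : W} (hne : rootOf s.Ω u ≠ rootOf s.Ω v)
    (heq : rootOf t.Ω u = rootOf t.Ω v) (hs : s.Struct) :
    rootOf t.Ω u ∈ t.Ω ∧ rootOf t.Ω u ∉ s.Ω := by
  obtain ⟨B, hB, huB, hvB⟩ := exists_blossom_of_rootOf_eq h.nested heq (fun e => hne (e ▸ rfl))
  refine ⟨(rootOf_mem h.nested hB huB).1, fun hmem => hne ?_⟩
  exact rootOf_eq_of_blossom hs.nested hmem (self_mem_rootOf u) (heq ▸ self_mem_rootOf v)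

/-- Blossom edges of the new blossoms are eligible or old. -/
theorem mem_EB (hs : s.Struct) : ∀ B ∈ t.Ω, ∀ e ∈ t.EB B,
    s.Eligible c e ∨ ∃ D ∈ s.Ω, e ∈ s.EB D := by
  suffices H : ∀ n, ∀ B ∈ t.Ω, B.card = n → ∀ e ∈ t.EB B,
      s.Eligible c e ∨ ∃ D ∈ s.Ω, e ∈ s.EB D from fun B hB => H _ B hB rfl
  intro n
  induction n using Nat.strong_induction_on with
  | _ n ih =>
  intro B hB hn e he
  by_cases hBs : B ∈ s.Ω
  · exact Or.inr ⟨B, hBs, h.EB B hBs ▸ he⟩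
  · obtain ⟨ℓ, A, a, b, hc, -⟩ := State.isBlossom_iff.1 (h.blossom B hB hBs)
    rcases hc.mem_edges.1 he with ⟨i, hi, hie⟩ | ⟨i, hi, rfl⟩
    · rcases hc.child i hi with hm | ⟨v, hv, hA⟩
      · rw [State.blossomEdges_of_mem hm] at hie
        exact ih _ (hn ▸ hc.card_lt hi) _ hm rfl e hie
      · rw [hA, (h.struct hs).cyclic.blossomEdges_singleton] at hie
        simp at hie
    · exact Or.inl (hc.edge i hi).2.2

/-- Under `batch`, blossom edges become eligible by fiat, but the edges of new blossoms were
eligible already; the new blossoms carry no dual, so `yz` is unchanged. -/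
theorem eligible_iff (hs : s.Struct) {e : Sym2 W} : t.Eligible c e ↔ s.Eligible c e := by
  have hyz := h.yz_eq
  have hold : ∀ {e}, (∃ B ∈ s.Ω, e ∈ s.EB B) → ∃ B ∈ t.Ω, e ∈ t.EB B := by
    rintro e ⟨B, hB, he⟩
    exact ⟨B, h.Ω hB, (h.EB B hB).symm ▸ he⟩
  have hm := h.mem_EB hs
  unfold State.Eligible at hm ⊢
  rw [h.E, hyz, h.w, h.M]
  cases c with
  | tight => rfl
  | near => rfl
  | batch =>
    simp only at hm ⊢
    refine and_congr_right fun heE => ?_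
    constructor
    · rintro (⟨B, hB, he⟩ | h1)
      · rcases hm B hB e he with h2 | h2
        · exact h2.2
        · exact Or.inl h2
      · exact Or.inr h1
    · rintro (h1 | h1)
      · exact Or.inl (hold h1)
      · exact Or.inr h1

/-- The node of `t` that contains a node of `s`. -/
theorem biUnion_rootOf (hs : s.Struct) {R : Finset W} (hR : s.IsNode R) {u : W} (hu : u ∈ R) :
    R.biUnion (rootOf t.Ω) = rootOf t.Ω u := by
  ext x
  rw [mem_biUnion]
  constructor
  · rintro ⟨v, hv, hx⟩
    rwa [h.rootOf_eq ((hs.node_eq hR hu).symm.trans (hs.node_eq hR hv))]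
  · exact fun hx => ⟨u, hu, hx⟩

/-- A root of `t` is again a blossom or a single vertex, so at most one matched edge leaves it, and
that edge determines the node at its far end. -/
theorem matched_unique (hs : s.Struct) {x y x' y' : Finset W}
    (hxy : (nodeGraph s hs c F).r true x y)
    (hne : x.biUnion (rootOf t.Ω) ≠ y.biUnion (rootOf t.Ω))
    (hxy' : (nodeGraph s hs c F).r true x' y')
    (heq : x'.biUnion (rootOf t.Ω) = x.biUnion (rootOf t.Ω))
    (hne' : y'.biUnion (rootOf t.Ω) ≠ x.biUnion (rootOf t.Ω)) : y' = y := by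
  obtain ⟨-, h2, h3, u, hu, v, hv, -, h5⟩ := hxy
  obtain ⟨-, k2, k3, u', hu', v', hv', -, k5⟩ := hxy'
  rw [h.biUnion_rootOf hs h2 hu] at hne heq hne'
  rw [h.biUnion_rootOf hs h3 hv] at hne
  rw [h.biUnion_rootOf hs k2 hu'] at heq
  rw [h.biUnion_rootOf hs k3 hv'] at hne'
  have ht := h.struct hs
  have hvn : v ∉ rootOf t.Ω u := fun hm => hne (rootOf_eq_of_mem h.nested hm).symm
  have hvn' : v' ∉ rootOf t.Ω u := fun hm => hne' (rootOf_eq_of_mem h.nested hm)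
  have hM1 : s(u, v) ∈ t.M := h.M ▸ h5.2 rfl
  have hM2 : s(u', v') ∈ t.M := h.M ▸ k5.2 rfl
  have huU : u ∈ t.U := h.U ▸ hs.node_subset_U h2 hu
  obtain ⟨h7, rfl⟩ := ht.matched_unique (ht.rootOf_part huU) hM1 hM2
    (ht.not_mem_blossomEdges hvn) (ht.not_mem_blossomEdges hvn')
    (Sym2.mem_mk_left _ _) (self_mem_rootOf u) (Sym2.mem_mk_left _ _)
    (heq ▸ self_mem_rootOf u')
  rw [Sym2.congr_right] at h7
  subst h7
  exact hs.node_eq_of_mem k3 h3 hv' hv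

theorem isNode (hs : s.Struct) {R : Finset W} (hR : s.IsNode R) :
    t.IsNode (R.biUnion (rootOf t.Ω)) := by
  obtain ⟨v, hv, rfl⟩ := id hR
  rw [h.biUnion_rootOf hs hR (self_mem_rootOf v)]
  exact ⟨v, h.U.symm ▸ hv, rfl⟩

/-- Project paths of `s` to the roots of `t` by the block map. New roots are outer, so a root that
is not outer is a node of `s`, and its matched edge leaves it; this is what the projection argument
needs. -/
theorem outer_of_outer (hs : s.Struct) (ht : t.Struct)
    (hH : ∀ u v, s.Eligible c s(u, v) → s(u, v) ∉ s.M → t.Outer c F u → t.Outer c F v →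
      rootOf t.Ω u = rootOf t.Ω v)
    (hout : ∀ B ∈ t.Ω, B ∉ s.Ω → ∀ v ∈ B, t.Outer c F v) {v : W} (hv : s.Outer c F v) :
    t.Outer c F v := by
  rw [outer_iff hs] at hv
  rw [outer_iff ht, h.U]
  refine ⟨hv.1, ?_⟩
  rw [← h.biUnion_rootOf hs (hs.isNode_rootOf hv.1) (self_mem_rootOf v)]
  refine AltGraph.out_of_blocks (q := fun R => R.biUnion (rootOf t.Ω)) (g := nodeGraph s hs c F)
    ?_ ?_ ?_ ?_ ?_ hv.2
  · rintro x ⟨h1, f, hfF, hfx, hf⟩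
    refine ⟨h.isNode hs h1, f, hfF, ?_, h.free_iff.2 hf⟩
    exact mem_biUnion.2 ⟨f, hfx, self_mem_rootOf f⟩
  · rintro b x y ⟨h1, h2, h3, u, hu, v, hv, h4, h5⟩ hne
    exact ⟨hne, h.isNode hs h2, h.isNode hs h3, u, mem_biUnion.2 ⟨u, hu, self_mem_rootOf u⟩, v,
      mem_biUnion.2 ⟨v, hv, self_mem_rootOf v⟩, (h.eligible_iff hs).2 h4, by rwa [h.M]⟩
  · rintro x y hx hy ⟨h1, h2, h3, u, hu, v, hv, h4, h5⟩
    rw [ht.node_eq h2 hu] at hx h1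
    rw [ht.node_eq h3 hv] at hy h1
    refine h1 (hH u v ((h.eligible_iff hs).1 h4) (fun hM => ?_) ?_ ?_)
    · rw [← h.M] at hM
      simpa using h5.1 hM
    · exact (outer_iff ht).2 ⟨ht.node_subset_U h2 hu, hx⟩
    · exact (outer_iff ht).2 ⟨ht.node_subset_U h3 hv, hy⟩
  · exact fun hxy hne hxy' heq hne' => h.matched_unique hs hxy hne hxy' heq hne'
  · rintro x y ⟨h1, h2, h3, u, hu, v, hv, h4, h5⟩ hx heq
    rw [h.biUnion_rootOf hs h2 hu] at hx heq
    rw [h.biUnion_rootOf hs h3 hv] at heq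
    rw [hs.node_eq h2 hu, hs.node_eq h3 hv] at h1
    obtain ⟨k1, k2⟩ := h.exists_new h1 heq hs
    exact hx ((outer_iff ht).1 (hout _ k1 k2 u (self_mem_rootOf u))).2

end Extension
end NodeGraph

/-! ### Existence of Blossom Shrinking -/

section Shrinking
variable {W : Type u} [Fintype W] [DecidableEq W]
variable {s : State W} (hs : s.Struct) {c : Criterion} {F : Finset W}

theorem Extension.refl (hs : s.Struct) : Extension c s s :=
  ⟨rfl, rfl, rfl, rfl, rfl, rfl, Finset.Subset.refl _, fun _ _ => rfl, hs.nested,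
    fun _ h h' => absurd h h', fun _ h h' => absurd h h'⟩

theorem Extension.trans {s₁ t : State W} (hs : s.Struct) (h₁ : Extension c s s₁)
    (h₂ : Extension c s₁ t) : Extension c s t where
  U := h₂.U.trans h₁.U
  E := h₂.E.trans h₁.E
  M := h₂.M.trans h₁.M
  w := h₂.w.trans h₁.w
  y := h₂.y.trans h₁.y
  z := h₂.z.trans h₁.z
  Ω := h₁.Ω.trans h₂.Ω
  EB B hB := (h₂.EB B (h₁.Ω hB)).trans (h₁.EB B hB)
  nested := h₂.nested
  not_subset B hB hBs C hC := by
    by_cases h : B ∈ s₁.Ω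
    · exact h₁.not_subset B h hBs C hC
    · exact h₂.not_subset B hB h C (h₁.Ω hC)
  blossom B hB hBs := by
    by_cases h : B ∈ s₁.Ω
    · exact (h₁.blossom B h hBs).transfer h₂.U h₂.M h₂.Ω h₂.EB h fun D hD hD1 =>
        h₂.not_subset D hD hD1 B h
    · exact (h₂.blossom B hB h).mono fun e he => (h₁.eligible_iff hs).1 he

/-- An odd cycle of nodes can be made a blossom. -/
theorem exists_extension_of_cycle {a z : Finset W} {C : List (Finset W)} (hnd : (a :: C).Nodup)
    (hch : AltChain (nodeGraph s hs c F).r false (a :: C)) (hnode : ∀ R ∈ a :: C, s.IsNode R)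
    (hodd : Odd (a :: C).length) (hz : (a :: C).getLast? = some z)
    (hza : (nodeGraph s hs c F).r false z a) :
    ∃ (B : Finset W) (t : State W), Extension c s t ∧ t.Ω = insert B s.Ω ∧ B ∉ s.Ω ∧
      ∀ v, v ∈ B ↔ ∃ R ∈ a :: C, v ∈ R := by
  set L := a :: C with hL
  set ℓ := L.length with hℓ
  have hpos : 0 < ℓ := by simp [hℓ, hL]
  have hz' : L[ℓ - 1]? = some z := by
    rw [← hz, List.getLast?_eq_getElem?]
  have h0 : L[0]? = some a := by simp [hL]
  have hthree : 3 ≤ ℓ := by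
    have h1 : ℓ ≠ 1 := by
      intro h
      rw [h] at hz'
      rw [hz'] at h0
      exact hza.1 (Option.some.inj h0)
    obtain ⟨k, hk⟩ := hodd
    omega
  obtain ⟨A, hA⟩ : ∃ A : ℕ → Finset W, ∀ i, L[i % ℓ]? = some (A i) := by
    refine ⟨fun i => L[i % ℓ]'(Nat.mod_lt _ hpos), fun i => ?_⟩
    exact List.getElem?_eq_getElem _
  have hA' : ∀ i < ℓ, L[i]? = some (A i) := fun i hi => by
    rw [← hA i, Nat.mod_eq_of_lt hi]
  have hmem : ∀ i, A i ∈ L := fun i => List.mem_of_getElem? (hA i)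
  have hinj : ∀ i < ℓ, ∀ j < ℓ, A i = A j → i = j := by
    intro i hi j hj hij
    have h1 := hA' i hi
    rw [hij, ← hA' j hj] at h1
    exact (List.getElem?_inj hi hnd).1 h1
  have hwrap : A ℓ = A 0 := by
    have h1 := hA ℓ
    rw [Nat.mod_self, ← Nat.zero_mod ℓ, hA 0] at h1
    exact (Option.some.inj h1).symm
  have hedge : ∀ i, ∃ u v, i < ℓ → u ∈ A i ∧ v ∈ A (i + 1) ∧ s.Eligible c s(u, v) ∧
      (s(u, v) ∈ s.M ↔ Odd i) := by
    intro i
    by_cases hi : i < ℓ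
    · by_cases hi' : i + 1 = ℓ
      · have e1 : A i = z := by
          have h1 := hA' i hi
          have : i = ℓ - 1 := by omega
          rw [this, hz'] at h1
          rw [this]
          exact (Option.some.inj h1).symm
        have e2 : A (i + 1) = a := by
          rw [hi', hwrap]
          have h1 := hA' 0 hpos
          rw [h0] at h1
          exact (Option.some.inj h1).symm
        obtain ⟨-, -, -, u, hu, v, hv, h1, h2⟩ := hza
        refine ⟨u, v, fun _ => ⟨e1 ▸ hu, e2 ▸ hv, h1, ?_⟩⟩
        rw [h2]
        rw [← hi', Nat.odd_add_one] at hodd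
        simp [hodd]
      · obtain ⟨-, -, -, u, hu, v, hv, h1, h2⟩ :=
          (altChain_iff_getElem _ _).1 hch i _ _ (hA' i hi) (hA' (i + 1) (by omega))
        refine ⟨u, v, fun _ => ⟨hu, hv, h1, ?_⟩⟩
        rw [h2, odd_iff_bodd]
        simp
    -- Beyond the cycle the choice of the end vertices is irrelevant.
    · exact ⟨(hnode a (by simp [hL])).choose, (hnode a (by simp [hL])).choose,
        fun h => absurd h hi⟩
  choose u v huv using hedge
  have hdisj : ∀ i < ℓ, ∀ j < ℓ, i ≠ j → Disjoint (A i) (A j) := by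
    intro i hi j hj hij
    rw [Finset.disjoint_left]
    intro x hx hx'
    exact hij (hinj i hi j hj (hs.node_eq_of_mem (hnode _ (hmem i)) (hnode _ (hmem j)) hx hx'))
  set B := (range ℓ).biUnion A with hB
  have hBmem : ∀ x, x ∈ B ↔ ∃ R ∈ L, x ∈ R := by
    intro x
    rw [hB, mem_biUnion]
    constructor
    · rintro ⟨i, -, hx⟩
      exact ⟨A i, hmem i, hx⟩
    · rintro ⟨R, hR, hx⟩
      obtain ⟨i, hi, rfl⟩ := List.mem_iff_getElem.1 hR
      refine ⟨i, mem_range.2 hi, ?_⟩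
      have := hA' i hi
      rw [List.getElem?_eq_getElem hi] at this
      rwa [← Option.some.inj this]
  have hsub : ∀ i < ℓ, A i ⊆ B := fun i hi => subset_biUnion_of_mem A (mem_range.2 hi)
  have hBnot : ∀ D ∈ s.Ω, ¬ B ⊆ D := by
    intro D hD hBD
    have h1 := (huv 0 hpos).1
    have h2 := (huv 1 (by omega)).1
    have h3 := rootOf_eq_of_blossom hs.nested hD (hBD (hsub 0 hpos h1)) (hBD (hsub 1 (by omega) h2))
    rw [← hs.node_eq (hnode _ (hmem 0)) h1, ← hs.node_eq (hnode _ (hmem 1)) h2] at h3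
    exact absurd (hinj 0 hpos 1 (by omega) h3) (by norm_num)
  have hBΩ : B ∉ s.Ω := fun h => hBnot B h (Finset.Subset.refl _)
  have hABne : ∀ i < ℓ, A i ≠ B := by
    intro i hi he
    have h1 : ∀ j < ℓ, j = i := by
      intro j hj
      by_contra hne
      exact Finset.disjoint_left.1 (hdisj j hj i hi hne) (huv j hj).1
        (he ▸ hsub j hj (huv j hj).1)
    have := (h1 0 hpos).trans (h1 1 (by omega)).symm
    omega
  have hDB : ∀ D ∈ s.Ω, ∀ x ∈ D, x ∈ B → ∃ i < ℓ, D ⊆ A i := by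
    intro D hD x hx hxB
    rw [hB, mem_biUnion] at hxB
    obtain ⟨i, hi, hxi⟩ := hxB
    refine ⟨i, mem_range.1 hi, ?_⟩
    rw [hs.node_eq (hnode _ (hmem i)) hxi]
    exact subset_rootOf hD hx
  set EB' : Finset W → Finset (Sym2 W) := Function.update s.EB B
    (((range ℓ).biUnion fun i => s.blossomEdges (A i)) ∪ (range ℓ).image fun i => s(u i, v i))
    with hEB'
  set t : State W := { s with Ω := insert B s.Ω, EB := EB' } with ht
  refine ⟨B, t, ?_, rfl, hBΩ, hBmem⟩
  have hEBold : ∀ D ∈ s.Ω, EB' D = s.EB D := fun D hD =>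
    Function.update_of_ne (fun (h : D = B) => hBΩ (by rw [← h]; exact hD)) _ _
  refine ⟨rfl, rfl, rfl, rfl, rfl, rfl, Finset.subset_insert _ _, hEBold, ?_, ?_, ?_⟩
  · have key : ∀ D ∈ s.Ω, D ⊆ B ∨ Disjoint D B := by
      intro D hD
      by_cases hd : Disjoint D B
      · exact Or.inr hd
      · rw [Finset.not_disjoint_iff] at hd
        obtain ⟨x, hx, hxB⟩ := hd
        obtain ⟨i, hi, hDi⟩ := hDB D hD x hx hxB
        exact Or.inl (hDi.trans (hsub i hi))
    intro D hD D' hD'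
    rcases mem_insert.1 hD with rfl | hD <;> rcases mem_insert.1 hD' with rfl | hD'
    · exact Or.inl (Finset.Subset.refl _)
    · rcases key D' hD' with h | h
      · exact Or.inr (Or.inl h)
      · exact Or.inr (Or.inr h.symm)
    · rcases key D hD with h | h
      · exact Or.inl h
      · exact Or.inr (Or.inr h)
    · exact hs.nested D hD D' hD'
  · intro D hD hDs
    rcases mem_insert.1 hD with rfl | hD
    · exact hBnot
    · exact absurd hD hDs
  · intro D hD hDs
    rcases mem_insert.1 hD with rfl | hD
    swap
    · exact absurd hD hDs
    refine State.isBlossom_iff.2 ⟨ℓ, A, u, v, ⟨hodd, hthree, hwrap, hdisj, ?_, ?_, rfl, ?_, ?_⟩, ?_⟩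
    · intro i hi
      rcases hs.node_part (hnode _ (hmem i)) with h | h
      · exact Or.inl (mem_insert_of_mem h)
      · exact Or.inr h
    · exact fun i hi => ⟨(huv i hi).1, (huv i hi).2.1, (huv i hi).2.2.1⟩
    · rw [show t.EB B = _ from Function.update_self _ _ _]
      congr 1
      refine biUnion_congr rfl fun i hi => ?_
      have hi' := mem_range.1 hi
      unfold State.blossomEdges
      by_cases h : A i ∈ s.Ω
      · rw [if_pos h, if_pos (mem_insert_of_mem h)]
        exact (hEBold _ h).symm
      · rw [if_neg h, if_neg]
        intro h'
        rcases mem_insert.1 h' with h' | h'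
        · exact hABne i hi' h'
        · exact h h'
    · intro D hD hDB'
      rcases mem_insert.1 hD with rfl | hD
      · exact absurd rfl hDB'.ne
      · have h3 := hs.cyclic.three_le_card hD
        obtain ⟨x, hx⟩ : D.Nonempty := Finset.card_pos.1 (by omega)
        exact hDB D hD x hx (hDB'.1 hx)
    · exact fun i hi => (huv i hi).2.2.2

variable {t : State W} {a : Finset W} {C : List (Finset W)} {B : Finset W}

theorem Extension.rootOf_insert (h : Extension c s t) (hΩ : t.Ω = insert B s.Ω) (hB : B ∉ s.Ω)
    (v : W) : (v ∈ B → rootOf t.Ω v = B) ∧ (v ∉ B → rootOf t.Ω v = rootOf s.Ω v) := by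
  constructor
  · intro hv
    refine rootOf_eq_of_maximal h.nested (by rw [hΩ]; simp) ?_ hv
    intro D hD hBD
    rw [hΩ] at hD
    rcases mem_insert.1 hD with rfl | hD
    · rfl
    · exact absurd hBD (h.not_subset B (by rw [hΩ]; simp) hB D hD)
  · intro hv
    ext x
    rw [mem_rootOf, mem_rootOf, hΩ]
    simp [hv]

theorem Extension.contracts (h : Extension c s t) (ht : t.Struct) (hΩ : t.Ω = insert B s.Ω)
    (hB : B ∉ s.Ω) (hBmem : ∀ v, v ∈ B ↔ ∃ R ∈ a :: C, v ∈ R)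
    (hnode : ∀ R ∈ a :: C, s.IsNode R) :
    AltGraph.Contracts (nodeGraph s hs c F) (nodeGraph t ht c F) B (a :: C) := by
  have hr := h.rootOf_insert hΩ hB
  have hBt : B ∈ t.Ω := by rw [hΩ]; simp
  have hnodeB : ∀ R, t.IsNode R → R ≠ B → s.IsNode R ∧ R ∉ a :: C ∧ ∀ v ∈ R, v ∉ B := by
    rintro R ⟨v, hv, rfl⟩ hne
    have hvB : v ∉ B := fun hm => hne ((hr v).1 hm)
    have e := (hr v).2 hvB
    rw [e]
    refine ⟨⟨v, h.U ▸ hv, rfl⟩, fun hm => hvB ((hBmem v).2 ⟨_, hm, self_mem_rootOf v⟩), ?_⟩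
    intro x hx hxB
    rw [← e] at hx
    have := rootOf_eq_of_mem h.nested hx
    rw [(hr x).1 hxB] at this
    exact hne this.symm
  refine ⟨?_, ?_, ?_, ?_, ?_, ?_⟩
  · rintro b x y hx hy ⟨h1, h2, h3, u, hu, v, hv, h4, h5⟩
    exact ⟨⟨h1, (hnodeB x h2 hx).1, (hnodeB y h3 hy).1, u, hu, v, hv, (h.eligible_iff hs).1 h4,
      h.M ▸ h5⟩, (hnodeB x h2 hx).2.1, (hnodeB y h3 hy).2.1⟩
  · rintro b x ⟨h1, h2, h3, u, hu, v, hv, h4, h5⟩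
    refine ⟨(hnodeB x h2 h1).2.1, ?_⟩
    obtain ⟨R, hR, hvR⟩ := (hBmem v).1 hv
    refine ⟨R, hR, ?_, (hnodeB x h2 h1).1, hnode R hR, u, hu, v, hvR, (h.eligible_iff hs).1 h4,
      h.M ▸ h5⟩
    rintro rfl
    exact (hnodeB x h2 h1).2.1 hR
  · rintro x hx ⟨h1, f, h2, h3, h4⟩
    exact ⟨⟨(hnodeB x h1 hx).1, f, h2, h3, h.free_iff.1 h4⟩, (hnodeB x h1 hx).2.1⟩
  · rintro ⟨h1, f, h2, h3, h4⟩
    obtain ⟨R, hR, hfR⟩ := (hBmem f).1 h3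
    exact ⟨R, hR, hnode R hR, f, h2, hfR, h.free_iff.1 h4⟩
  · rintro x hx ⟨h1, f, h3, h4⟩
    exact ⟨(hnodeB x h1 hx).1, f, h3, h.free_iff.1 h4⟩
  · rintro ⟨h1, f, h3, h4⟩
    obtain ⟨R, hR, hfR⟩ := (hBmem f).1 h3
    exact ⟨R, hR, hnode R hR, f, hfR, h.free_iff.1 h4⟩

/-- As long as an unmatched eligible edge joins two outer nodes, the flower lemma gives an odd cycle
that can be made a blossom. Lifting shows that there is still no augmenting path and no new outer
vertex, so the process continues. It stops because the number of inactive sets decreases; they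
cannot run out, as the empty set is no blossom. -/
theorem exists_maximal_extension : ∀ (n : ℕ) (s : State W) (hs : s.Struct),
    Fintype.card (Finset W) - s.Ω.card ≤ n → (nodeGraph s hs c F).NoAug →
    ∃ t, Extension c s t ∧ (∀ B ∈ t.Ω, B ∉ s.Ω → ∀ v ∈ B, s.Outer c F v ∧ t.Outer c F v) ∧
      (∀ v, t.Outer c F v → s.Outer c F v) ∧
      ∀ u v, s.Eligible c s(u, v) → s(u, v) ∉ s.M → t.Outer c F u → t.Outer c F v →
        rootOf t.Ω u = rootOf t.Ω v := by
  intro n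
  induction n with
  | zero =>
    intro s hs hn hno
    have h1 : s.Ω = univ := by
      rw [← Finset.card_eq_iff_eq_univ]
      exact le_antisymm (Finset.card_le_univ _) (by omega)
    have h2 : (∅ : Finset W) ∈ s.Ω := by rw [h1]; simp
    have := hs.cyclic.three_le_card h2
    simp at this
  | succ n ih =>
    intro s hs hn hno
    by_cases hbad : ∃ u v, s.Eligible c s(u, v) ∧ s(u, v) ∉ s.M ∧ s.Outer c F u ∧
        s.Outer c F v ∧ rootOf s.Ω u ≠ rootOf s.Ω v
    · obtain ⟨u, v, h1, h2, h3, h4, h5⟩ := hbad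
      rw [outer_iff hs] at h3 h4
      obtain ⟨h3U, l, hl, hle⟩ := h3
      obtain ⟨h4U, m, hm, hme⟩ := h4
      have hr : (nodeGraph s hs c F).r false (rootOf s.Ω u) (rootOf s.Ω v) :=
        ⟨h5, hs.isNode_rootOf h3U, hs.isNode_rootOf h4U, u, self_mem_rootOf u, v,
          self_mem_rootOf v, h1, by simp [h2]⟩
      obtain ⟨p, C, a, z, k1, k2, k3, k4, k5, k6⟩ :=
        AltGraph.exists_flower hno _ l m _ _ le_rfl hl hle hm hme hr
      obtain ⟨C, rfl⟩ : ∃ C', C = a :: C' := by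
        cases C with
        | nil => simp at k4
        | cons a' C => simp at k4; exact ⟨C, by rw [k4]⟩
      have hnd := (List.nodup_append.1 k1.1).2.1
      have hch : AltChain (nodeGraph s hs c F).r false (a :: C) := by
        have := ((altChain_append _ _ _).1 k1.2.1).2.1
        rwa [bodd_of_even k2] at this
      have hnode : ∀ R ∈ a :: C, s.IsNode R := fun R hR => k1.isNode hs (by simp [hR])
      obtain ⟨B, s₁, hext, hΩ, hB, hBmem⟩ :=
        exists_extension_of_cycle hs hnd hch hnode k3 k5 k6
      have hs₁ := hext.struct hs
      have hcon := hext.contracts (F := F) hs hs₁ hΩ hB hBmem hnode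
      have hclose : ∀ w, (a :: C).getLast? = some w → (nodeGraph s hs c F).r false w a := by
        intro w hw
        rw [k5] at hw
        exact (Option.some.inj hw) ▸ k6
      have hno₁ := hcon.lift_noAug hnd hch k3 hclose hno
      -- Outer in the contracted graph implies outer before, also for every vertex inside the
      -- contracted cycle.
      have hlift : ∀ v, s₁.Outer c F v → s.Outer c F v := by
        intro v hv
        rw [outer_iff hs₁] at hv
        rw [outer_iff hs]
        refine ⟨hext.U ▸ hv.1, ?_⟩
        by_cases hvB : v ∈ B
        · rw [(hext.rootOf_insert hΩ hB v).1 hvB] at hv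
          obtain ⟨R, hR, hvR⟩ := (hBmem v).1 hvB
          rw [← hs.node_eq (hnode R hR) hvR]
          exact hcon.lift_out_contracted hnd hch k3 hclose hv.2 hR
        · have hne : rootOf s₁.Ω v ≠ B := fun e => hvB (e ▸ self_mem_rootOf v)
          have := hcon.lift_out hnd hch k3 hclose hv.2 hne
          rwa [(hext.rootOf_insert hΩ hB v).2 hvB] at this
      -- The even stem of the flower avoids the cycle and leads to the new node `B` in the
      -- contracted graph.
      have hBout : ∀ v ∈ B, s₁.Outer c F v := by
        intro v hv
        have hBΩ : B ∈ s₁.Ω := by rw [hΩ]; simp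
        have hU := hs₁.cyclic.subset_U B hBΩ hv
        rw [outer_iff hs₁, (hext.rootOf_insert hΩ hB v).1 hv]
        refine ⟨hU, ?_⟩
        have hBnode : s₁.IsNode B := ⟨v, hU, ((hext.rootOf_insert hΩ hB v).1 hv).symm⟩
        have ha : ∀ x ∈ a, x ∈ B := fun x hx => (hBmem x).2 ⟨a, by simp, hx⟩
        have hpnode : ∀ R ∈ p, s₁.IsNode R ∧ R ≠ B := by
          intro R hR
          obtain ⟨x, hx, rfl⟩ := k1.isNode hs (show R ∈ p ++ a :: C by simp [hR])
          have hxB : x ∉ B := by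
            intro hxB
            obtain ⟨R', hR', hxR'⟩ := (hBmem x).1 hxB
            rw [← hs.node_eq (hnode R' hR') hxR'] at hR
            have := k1.1
            rw [List.nodup_append] at this
            exact this.2.2 _ hR _ hR' rfl
          rw [← (hext.rootOf_insert hΩ hB x).2 hxB]
          exact ⟨⟨x, hext.U.symm ▸ hx, rfl⟩, fun e => hxB (e ▸ self_mem_rootOf x)⟩
        have hpath := k1.prefix'
        refine ⟨p, ⟨?_, ?_, ?_⟩, k2⟩
        · rw [List.nodup_append]
          refine ⟨(List.nodup_append.1 k1.1).1, by simp, ?_⟩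
          intro R hR R' hR'
          rw [List.mem_singleton] at hR'
          exact hR' ▸ (hpnode R hR).2
        · have hc := (altChain_append _ _ _).1 hpath.2.1
          rw [altChain_append]
          refine ⟨altChain_mono _ _ ?_ hc.1, by simp, ?_⟩
          · rintro b R hR R' hR' ⟨e1, -, -, x, hx, x', hx', e2, e3⟩
            exact ⟨e1, (hpnode R hR).1, (hpnode R' hR').1, x, hx, x', hx',
              (hext.eligible_iff hs).2 e2, hext.M.symm ▸ e3⟩
          · intro R R' hR hR'
            obtain rfl : B = R' := by simpa using hR'
            obtain ⟨-, -, -, x, hx, x', hx', e2, e3⟩ := hc.2.2 R a hR (by simp)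
            have hRp := hpnode R (List.mem_of_getLast? hR)
            exact ⟨hRp.2, hRp.1, hBnode, x, hx, x', ha x' hx',
              (hext.eligible_iff hs).2 e2, hext.M.symm ▸ e3⟩
        · rcases p with _ | ⟨R, p⟩
          · obtain ⟨-, f, hf, hfa, hfree⟩ := hpath.start
            exact ⟨B, rfl, hBnode, f, hf, ha f hfa, hext.free_iff.2 hfree⟩
          · obtain ⟨-, f, hf, hfa, hfree⟩ := hpath.start
            exact ⟨R, rfl, (hpnode R (by simp)).1, f, hf, hfa, hext.free_iff.2 hfree⟩
      obtain ⟨t, hext', hnew, hto, hfin⟩ := ih s₁ hs₁ (by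
        rw [hΩ, card_insert_of_notMem hB]; omega) hno₁
      have ht := hext'.struct hs₁
      have hH : ∀ u v, s₁.Eligible c s(u, v) → s(u, v) ∉ s₁.M → t.Outer c F u →
          t.Outer c F v → rootOf t.Ω u = rootOf t.Ω v := hfin
      -- Outer vertices stay outer through the remaining contractions only because the end result
      -- has no bad edge left; hence this cannot be shown one contraction at a time.
      have hst : ∀ v, s₁.Outer c F v → t.Outer c F v := fun v hv =>
        hext'.outer_of_outer hs₁ ht hH (fun D hD hD' w hw => (hnew D hD hD' w hw).2) hv
      refine ⟨t, hext.trans hs hext', ?_, fun v hv => hlift v (hto v hv), ?_⟩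
      · intro D hD hDs w hw
        by_cases hD1 : D ∈ s₁.Ω
        · rw [hΩ] at hD1
          rcases mem_insert.1 hD1 with rfl | hD1
          · have := hBout w hw
            exact ⟨hlift w this, hst w this⟩
          · exact absurd hD1 hDs
        · have := hnew D hD hD1 w hw
          exact ⟨hlift w this.1, this.2⟩
      · intro x y hxy hM
        refine hfin x y ((hext.eligible_iff hs).2 hxy) (hext.M.symm ▸ hM)
    · push Not at hbad
      exact ⟨s, Extension.refl hs, fun _ h h' => absurd h h', fun _ h => h, hbad⟩

/-- If there is no augmenting path, Blossom Shrinking is possible. -/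
theorem exists_shrink (hs : s.Struct) (hz : ∀ B, B ∉ s.Ω → s.z B = 0) (hno : ¬ ∃ ρ, s.IsAugPath c F ρ) :
    ∃ t, Shrink c F s t := by
  rw [noAug_iff hs] at hno
  obtain ⟨t, hext, hnew, hto, hfin⟩ := exists_maximal_extension _ s hs le_rfl hno
  have hst : ∀ v, s.Outer c F v → t.Outer c F v := fun v hv =>
    hext.outer_of_outer hs (hext.struct hs) hfin (fun D hD hD' w hw => (hnew D hD hD' w hw).2) hv
  have hΩ : s.Ω ∪ (t.Ω \ s.Ω) = t.Ω := Finset.union_sdiff_of_subset hext.Ω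
  refine ⟨t, t.Ω \ s.Ω, t.EB, ?_, hext.EB, hext.nested, ?_, ?_⟩
  · obtain ⟨hU, hE, hM, hw, hy, hz', -⟩ := hext
    have e : (fun B => if B ∈ t.Ω \ s.Ω then 0 else s.z B) = t.z := by
      funext B
      rw [hz']
      split_ifs with h
      · exact (hz B (mem_sdiff.1 h).2).symm
      · rfl
    rw [e, hΩ, ← hU, ← hE, ← hM, ← hw, ← hy]
  · intro B hB
    rw [mem_sdiff] at hB
    exact ⟨fun v hv => (hnew B hB.1 hB.2 v hv).1, hext.not_subset B hB.1 hB.2,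
      hext.blossom B hB.1 hB.2⟩
  · intro u v he hM hu hv hne
    have h1 := hfin u v he hM (hst u hu) (hst v hv)
    obtain ⟨h2, h3⟩ := hext.exists_new hne h1 hs
    exact ⟨_, mem_sdiff.2 ⟨h2, h3⟩, self_mem_rootOf u, h1 ▸ self_mem_rootOf v⟩

end Shrinking

/-! ### Reached vertices before an adjustment: parity and matched edges -/

section Adjust
variable {W : Type u} [Fintype W] [DecidableEq W]
variable {s t : State W} {c : Criterion} {F : Finset W}

/-- The invariants common to all stages. -/
structure State.Good (s : State W) : Prop where
  rcs : s.RCS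
  noloop : ∀ e ∈ s.E, ¬ e.IsDiag
  ends : ∀ e ∈ s.E, ∀ v ∈ e, v ∈ s.U
  parity : ∀ B ∈ s.Ω, ∀ u ∈ B, ∀ v ∈ B, Even (s.y u - s.y v)

theorem State.Good.struct (hg : s.Good) : s.Struct :=
  State.Struct.of_isBlossom hg.noloop hg.ends hg.rcs.matching hg.rcs.nested hg.rcs.blossoms

@[simp] theorem endSum_mk (y : W → ℤ) (u v : W) : endSum y s(u, v) = y u + y v := rfl

theorem State.yz_mk (s : State W) (u v : W) :
    s.yz s(u, v) = s.y u + s.y v + ∑ B ∈ univ.filter (fun B : Finset W => u ∈ B ∧ v ∈ B), s.z B := by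
  classical
  unfold State.yz
  rw [endSum_mk]
  congr 2
  ext B
  simp

theorem even_yz_iff (hz : ∀ B, Even (s.z B)) (u v : W) :
    Even (s.yz s(u, v)) ↔ Even (s.y u - s.y v) := by
  rw [s.yz_mk, Int.even_add]
  have : Even (∑ B ∈ univ.filter (fun B : Finset W => u ∈ B ∧ v ∈ B), s.z B) :=
    Finset.even_sum _ fun B _ => hz B
  simp only [this, iff_true, Int.even_add, Int.even_sub]

/-- Mostly `yz` is `w` or `w - 2`. A blossom edge eligible under `batch` may have another value;
there the constant parity of `y` on the blossom is used. -/
theorem State.Good.eligible_even (hg : s.Good) {e : Sym2 W} (he : s.Eligible c e) :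
    Even (s.yz e) := by
  have hw := hg.rcs.even_weight e he.1
  obtain ⟨heE, h⟩ := he
  cases c with
  | tight => simp only at h; rwa [h]
  | near =>
    simp only at h
    rcases h with h | h <;> rw [h]
    · exact hw
    · exact hw.sub even_two
  | batch =>
    simp only at h
    rcases h with ⟨B, hB, he⟩ | ⟨-, h⟩ | ⟨-, h⟩
    · induction e with
      | _ u v =>
      rw [even_yz_iff fun B => (hg.rcs.granularity B).2]
      have hin := hg.struct.cyclic.inside B hB _ he
      exact hg.parity B hB u (hin u (by simp)) v (hin v (by simp))
    · rw [h]; exact hw.sub even_two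
    · rw [h]; exact hw

/-- The result of Blossom Shrinking in a state without augmenting paths. -/
structure ShrinkData (c : Criterion) (F : Finset W) (s t : State W) : Prop where
  struct : s.Struct
  noAug : (nodeGraph s struct c F).NoAug
  ext : Extension c s t
  new : ∀ B ∈ t.Ω, B ∉ s.Ω → ∀ v ∈ B, s.Outer c F v
  joined : ∀ u v, s.Eligible c s(u, v) → s(u, v) ∉ s.M → s.Outer c F u → s.Outer c F v →
    rootOf t.Ω u = rootOf t.Ω v

theorem Shrink.shrinkData (h : Shrink c F s t) (hs : s.Struct) (hz : ∀ B, B ∉ s.Ω → s.z B = 0)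
    (hno : (nodeGraph s hs c F).NoAug) : ShrinkData c F s t := by
  obtain ⟨Ωn, EB', rfl, h1, h2, h3, h4⟩ := h
  have hnotin : ∀ B ∈ Ωn, B ∉ s.Ω := fun B hB hBs => (h3 B hB).2.1 B hBs (Finset.Subset.refl _)
  have hnew : ∀ B ∈ s.Ω ∪ Ωn, B ∉ s.Ω → B ∈ Ωn := fun B hB hBs =>
    (mem_union.1 hB).resolve_left hBs
  refine ⟨hs, hno, ⟨rfl, rfl, rfl, rfl, rfl, ?_, Finset.subset_union_left, h1, h2, ?_, ?_⟩, ?_, ?_⟩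
  · funext B
    by_cases hB : B ∈ Ωn
    · simp [hB, hz B (hnotin B hB)]
    · simp [hB]
  · exact fun B hB hBs => (h3 B (hnew B hB hBs)).2.1
  · exact fun B hB hBs => (h3 B (hnew B hB hBs)).2.2
  · exact fun B hB hBs => (h3 B (hnew B hB hBs)).1
  · intro u v he hM hu hv
    by_cases hne : rootOf s.Ω u = rootOf s.Ω v
    · rcases rootOf_cases hs.nested u with ⟨e1, e2⟩ | ⟨e1, e2⟩
      · have : v ∈ rootOf s.Ω u := hne ▸ self_mem_rootOf v
        rw [e1, mem_singleton] at this
        rw [this]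
      · exact rootOf_eq_of_blossom h2 (mem_union_left _ e1) (self_mem_rootOf u)
          (hne ▸ self_mem_rootOf v)
    · obtain ⟨B, hB, hu, hv⟩ := h4 u v he hM hu hv hne
      exact rootOf_eq_of_blossom h2 (mem_union_right _ hB) hu hv

theorem State.Outer.congr (hs : s.Struct) {u v : W} (hu : s.Outer c F u)
    (h : rootOf s.Ω u = rootOf s.Ω v) : s.Outer c F v := by
  rw [outer_iff hs] at hu ⊢
  exact ⟨hs.rootOf_subset_U hu.1 (h ▸ self_mem_rootOf v), h ▸ hu.2⟩

theorem State.Inner.congr (hs : s.Struct) {u v : W} (hu : s.Inner c F u)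
    (h : rootOf s.Ω u = rootOf s.Ω v) : s.Inner c F v := by
  rw [inner_iff hs] at hu ⊢
  exact ⟨hs.rootOf_subset_U hu.1 (h ▸ self_mem_rootOf v), fun h' => hu.2.1 (h'.congr hs h.symm),
    h ▸ hu.2.2⟩

theorem outer_or_inner (hs : s.Struct) {v : W} (hv : v ∈ s.U)
    (h : (nodeGraph s hs c F).Out (rootOf s.Ω v) ∨ (nodeGraph s hs c F).In (rootOf s.Ω v)) :
    s.Outer c F v ∨ s.Inner c F v := by
  by_cases ho : s.Outer c F v
  · exact Or.inl ho
  · refine Or.inr ((inner_iff hs).2 ⟨hv, ho, h.resolve_left fun h' => ho ((outer_iff hs).2 ⟨hv, h'⟩)⟩)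

theorem State.Outer.unmatched (hs : s.Struct) {u v : W} (hu : s.Outer c F u)
    (he : s.Eligible c s(u, v)) (hM : s(u, v) ∉ s.M) : s.Outer c F v ∨ s.Inner c F v := by
  by_cases hne : rootOf s.Ω u = rootOf s.Ω v
  · exact Or.inl (hu.congr hs hne)
  · have hv := hs.ends _ he.1 v (by simp)
    rw [outer_iff hs] at hu
    exact outer_or_inner hs hv (hu.2.unmatched ⟨hne, hs.isNode_rootOf hu.1, hs.isNode_rootOf hv, u,
      self_mem_rootOf u, v, self_mem_rootOf v, he, by simp [hM]⟩)

theorem State.Inner.matched (hs : s.Struct) {u v : W} (hu : s.Inner c F u)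
    (he : s.Eligible c s(u, v)) (hM : s(u, v) ∈ s.M) (hne : rootOf s.Ω u ≠ rootOf s.Ω v) :
    s.Outer c F v := by
  have hv := hs.ends _ he.1 v (by simp)
  rw [inner_iff hs] at hu
  exact (outer_iff hs).2 ⟨hv, hu.2.2.matched ⟨hne, hs.isNode_rootOf hu.1, hs.isNode_rootOf hv, u,
      self_mem_rootOf u, v, self_mem_rootOf v, he, by simp [hM]⟩⟩

/-- An outer node with a matched edge contains no free vertex, so its even path arrives over its
unique matched edge. That edge is therefore eligible and its other end is reached. -/
theorem State.Outer.matched (hs : s.Struct) {u v : W} (hu : s.Outer c F u)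
    (hM : s(u, v) ∈ s.M) (hne : rootOf s.Ω u ≠ rootOf s.Ω v) :
    s.Eligible c s(u, v) ∧ (s.Outer c F v ∨ s.Inner c F v) := by
  have hv := hs.ends _ (hs.matching.1 hM) v (by simp)
  rw [outer_iff hs] at hu
  have hvn : v ∉ rootOf s.Ω u := fun h => hne (rootOf_eq_of_mem hs.nested h).symm
  have hnode := hs.isNode_rootOf hu.1
  rcases hu.2.start_or_mate with ⟨-, f, -, hf, hfree⟩ | ⟨R, ⟨h1, h2, h3, u', hu', v', hv', h4, h5⟩, hI⟩
  · exact absurd hfree (hs.not_free_of_matched (hs.node_part hnode) hM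
      (hs.not_mem_blossomEdges hvn) (Sym2.mem_mk_left _ _) (self_mem_rootOf u) hf)
  · have hvn' : v' ∉ rootOf s.Ω u := fun h => h1 (hs.node_eq_of_mem h2 h3 h hv')
    obtain ⟨e1, rfl⟩ := hs.matched_unique (hs.node_part hnode) hM (h5.2 rfl)
      (hs.not_mem_blossomEdges hvn) (hs.not_mem_blossomEdges hvn')
      (Sym2.mem_mk_left _ _) (self_mem_rootOf u) (Sym2.mem_mk_left _ _) hu'
    rw [Sym2.congr_right] at e1
    subst e1
    rw [hs.node_eq h3 hv'] at hI
    exact ⟨h4, outer_or_inner hs hv (Or.inr hI)⟩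

theorem free_outer (hs : s.Struct) {f : W} (hf : f ∈ F) (hfree : s.Free f) : s.Outer c F f :=
  (outer_iff hs).2 ⟨hfree.1, AltGraph.out_of_start ⟨hs.isNode_rootOf hfree.1, f, hf,
    self_mem_rootOf f, hfree⟩⟩

/-- A node with a free vertex has no matched edge, so it can be outer only as the start of a path;
its only free vertex is its base, which would then lie in `F`. -/
theorem free_not_outer (hs : s.Struct) {v : W} (hv : v ∉ F) (hfree : s.Free v) :
    ¬ s.Outer c F v := by
  intro ho
  rw [outer_iff hs] at ho
  have hT : (nodeGraph s hs c F).T (rootOf s.Ω v) :=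
    ⟨hs.isNode_rootOf ho.1, v, self_mem_rootOf v, hfree⟩
  rcases ho.2.start_or_mate with ⟨h1, f, hfF, hf, hff⟩ | ⟨R, hR, -⟩
  · obtain ⟨b, hb⟩ := hs.exists_base (hs.node_part h1)
    have := (hb.eq_of_free hff hf).trans (hb.eq_of_free hfree (self_mem_rootOf v)).symm
    exact hv (this ▸ hfF)
  · exact (nodeGraph s hs c F).free_unmatched hT hR

theorem free_not_inner (hs : s.Struct) (hno : (nodeGraph s hs c F).NoAug) {v : W}
    (hfree : s.Free v) : ¬ s.Inner c F v := by
  intro hi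
  rw [inner_iff hs] at hi
  exact hno _ ⟨hs.isNode_rootOf hi.1, v, self_mem_rootOf v, hfree⟩ hi.2.2

/-- All vertices reached have `y`-values of the same parity. -/
theorem State.Good.reached_parity (hg : s.Good) {p : ℤ}
    (hF : ∀ f ∈ F, s.Free f → Even (s.y f - p)) {v : W} (hv : s.Outer c F v ∨ s.Inner c F v) :
    Even (s.y v - p) := by
  have hs := hg.struct
  have hnode : ∀ R, s.IsNode R → ∀ u ∈ R, ∀ v ∈ R, Even (s.y u - s.y v) := by
    intro R hR u hu v hv
    rcases hs.node_part hR with h | ⟨w, -, rfl⟩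
    · exact hg.parity R h u hu v hv
    · rw [mem_singleton] at hu hv
      simp [hu, hv]
  -- The parity of `y` is constant on a node and, since `yz` is even on eligible edges, the same at
  -- both ends of each path edge.
  have key : ∀ (l : List (Finset W)) (R : Finset W), (nodeGraph s hs c F).IsPath (l ++ [R]) →
      ∀ v ∈ R, Even (s.y v - p) := by
    intro l
    induction l using List.reverseRecOn with
    | nil =>
      intro R hR v hv
      obtain ⟨h1, f, hf, hfR, hfree⟩ := hR.start
      have := (hnode R h1 v hv f hfR).add (hF f hf hfree)
      simpa using this
    | append_singleton l Q ih =>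
      intro R hR v hv
      have h1 : (nodeGraph s hs c F).IsPath (l ++ Q :: [R]) := by simpa using hR
      obtain ⟨-, hQ, hRn, x, hx, x', hx', h4, -⟩ := h1.edge
      have h5 := ih Q h1.prefix' x hx
      have h6 := hg.eligible_even h4
      rw [even_yz_iff fun B => (hg.rcs.granularity B).2] at h6
      have h7 := (hnode R hRn v hv x' hx').sub h6 |>.add h5
      have h8 : s.y v - s.y x' - (s.y x - s.y x') + (s.y x - p) = s.y v - p := by ring
      rwa [h8] at h7
  rcases hv with hv | hv
  · rw [outer_iff hs] at hv
    obtain ⟨-, l, hl, -⟩ := hv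
    exact key l _ hl v (self_mem_rootOf v)
  · rw [inner_iff hs] at hv
    obtain ⟨-, -, l, hl, -⟩ := hv
    exact key l _ hl v (self_mem_rootOf v)

end Adjust

/-! ### Effect of an adjustment on the duals and on RCS -/

section Adjust
variable {W : Type u} [Fintype W] [DecidableEq W]
variable {s t : State W} {c : Criterion} {F : Finset W}

open Classical in
/-- The change of `y(v)` in a dual adjustment. -/
def dualStep (c : Criterion) (F : Finset W) (s : State W) (v : W) : ℤ :=
  if s.Outer c F v then -1 else if s.Inner c F v then 1 else 0

theorem dualStep_outer {v : W} (h : s.Outer c F v) : dualStep c F s v = -1 := if_pos h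

theorem dualStep_inner {v : W} (h : s.Inner c F v) : dualStep c F s v = 1 := by
  rw [dualStep, if_neg h.2.1, if_pos h]

theorem dualStep_none {v : W} (h1 : ¬ s.Outer c F v) (h2 : ¬ s.Inner c F v) :
    dualStep c F s v = 0 := by
  rw [dualStep, if_neg h1, if_neg h2]

theorem adjust_y (v : W) : (adjust c F s t).y v = t.y v + dualStep c F s v := by
  unfold adjust dualStep
  simp only
  split_ifs <;> ring

namespace ShrinkData
variable (d : ShrinkData c F s t)
include d

theorem struct_new : t.Struct := d.ext.struct d.struct

theorem outer_congr {u v : W} (hu : s.Outer c F u) (h : rootOf t.Ω u = rootOf t.Ω v) :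
    s.Outer c F v := by
  by_cases hne : rootOf s.Ω u = rootOf s.Ω v
  · exact hu.congr d.struct hne
  · obtain ⟨h1, h2⟩ := d.ext.exists_new hne h d.struct
    exact d.new _ h1 h2 v (h ▸ self_mem_rootOf v)

theorem inner_congr {u v : W} (hu : s.Inner c F u) (h : rootOf t.Ω u = rootOf t.Ω v) :
    s.Inner c F v := by
  by_cases hne : rootOf s.Ω u = rootOf s.Ω v
  · exact hu.congr d.struct hne
  · obtain ⟨h1, h2⟩ := d.ext.exists_new hne h d.struct
    exact absurd (d.new _ h1 h2 u (self_mem_rootOf u)) hu.2.1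

theorem dualStep_congr {u v : W} (h : rootOf t.Ω u = rootOf t.Ω v) :
    dualStep c F s u = dualStep c F s v := by
  by_cases h1 : s.Outer c F u
  · rw [dualStep_outer h1, dualStep_outer (d.outer_congr h1 h)]
  · have h1' : ¬ s.Outer c F v := fun h' => h1 (d.outer_congr h' h.symm)
    by_cases h2 : s.Inner c F u
    · rw [dualStep_inner h2, dualStep_inner (d.inner_congr h2 h)]
    · rw [dualStep_none h1 h2, dualStep_none h1' fun h' => h2 (d.inner_congr h' h.symm)]

theorem rootOf_of_isRoot {B : Finset W} (hB : t.IsRoot B) {v : W} (hv : v ∈ B) :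
    rootOf t.Ω v = B := rootOf_eq_of_maximal d.ext.nested hB.1 hB.2 hv

theorem adjust_z_of_not_root {B : Finset W} (hB : ¬ t.IsRoot B) :
    (adjust c F s t).z B = t.z B := by
  simp [adjust, hB]

/-- A root of `t` consists only of outer, only of inner, or only of other vertices, so any one of
its vertices decides the change of `z`. -/
theorem adjust_z_root {B : Finset W} (hB : t.IsRoot B) {v : W} (hv : v ∈ B) :
    (adjust c F s t).z B = t.z B - 2 * dualStep c F s v := by
  have hall : ∀ u ∈ B, rootOf t.Ω v = rootOf t.Ω u := fun u hu =>
    (d.rootOf_of_isRoot hB hv).trans (d.rootOf_of_isRoot hB hu).symm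
  unfold adjust
  simp only
  by_cases h1 : s.Outer c F v
  · rw [if_pos ⟨hB, fun u hu => d.outer_congr h1 (hall u hu)⟩, dualStep_outer h1]
    ring
  · rw [if_neg fun h => h1 (h.2 v hv)]
    by_cases h2 : s.Inner c F v
    · rw [if_pos ⟨hB, fun u hu => d.inner_congr h2 (hall u hu)⟩, dualStep_inner h2]
      ring
    · rw [if_neg fun h => h2 (h.2 v hv), dualStep_none h1 h2]
      ring

/-- Both ends move by the same step, and of all sets containing them only the common root changes
its dual, by minus twice that step. -/
theorem adjust_yz_of_eq {u v : W} (huv : u ≠ v) (h : rootOf t.Ω u = rootOf t.Ω v) :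
    (adjust c F s t).yz s(u, v) = s.yz s(u, v) := by
  rw [← d.ext.yz_eq, State.yz_mk, State.yz_mk, adjust_y, adjust_y, ← d.dualStep_congr h]
  obtain ⟨B, hB, hu, hv⟩ := exists_blossom_of_rootOf_eq d.ext.nested h huv
  set R := rootOf t.Ω u with hR
  have hRroot : t.IsRoot R := rootOf_mem d.ext.nested hB hu
  have huR : u ∈ R := self_mem_rootOf u
  have hvR : v ∈ R := h ▸ self_mem_rootOf v
  have hmem : R ∈ univ.filter (fun B : Finset W => u ∈ B ∧ v ∈ B) := by simp [huR, hvR]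
  rw [← Finset.add_sum_erase _ _ hmem, ← Finset.add_sum_erase _ t.z hmem,
    d.adjust_z_root hRroot huR]
  have : ∑ x ∈ (univ.filter (fun B : Finset W => u ∈ B ∧ v ∈ B)).erase R,
      (adjust c F s t).z x =
      ∑ x ∈ (univ.filter (fun B : Finset W => u ∈ B ∧ v ∈ B)).erase R, t.z x := by
    refine Finset.sum_congr rfl fun D hD => d.adjust_z_of_not_root fun hr => ?_
    rw [mem_erase, mem_filter] at hD
    exact hD.1 (d.rootOf_of_isRoot hr hD.2.2.1).symm
  rw [this]
  ring

theorem adjust_yz_of_ne {u v : W} (h : rootOf t.Ω u ≠ rootOf t.Ω v) :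
    (adjust c F s t).yz s(u, v) = s.yz s(u, v) + dualStep c F s u + dualStep c F s v := by
  rw [← d.ext.yz_eq, State.yz_mk, State.yz_mk, adjust_y, adjust_y]
  have : ∑ x ∈ univ.filter (fun B : Finset W => u ∈ B ∧ v ∈ B), (adjust c F s t).z x =
      ∑ x ∈ univ.filter (fun B : Finset W => u ∈ B ∧ v ∈ B), t.z x := by
    refine Finset.sum_congr rfl fun D hD => d.adjust_z_of_not_root fun hr => ?_
    rw [mem_filter] at hD
    exact h ((d.rootOf_of_isRoot hr hD.2.1).trans (d.rootOf_of_isRoot hr hD.2.2).symm)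
  rw [this]
  ring

/-- Shrinking only demands that unmatched edges between outer nodes be absorbed. For matched edges
this follows from the way alternating paths enter blocks. -/
theorem rootOf_eq_of_matched {u v : W} (hu : s.Outer c F u) (hv : s.Outer c F v)
    (hM : s(u, v) ∈ s.M) : rootOf t.Ω u = rootOf t.Ω v := by
  have hs := d.struct
  have hu' := (outer_iff hs).1 hu
  have hv' := (outer_iff hs).1 hv
  by_cases hne : rootOf s.Ω u = rootOf s.Ω v
  · exact d.ext.rootOf_eq hne
  have hq : ∀ {w : W}, w ∈ s.U →
      (rootOf s.Ω w).biUnion (rootOf t.Ω) = rootOf t.Ω w := fun hw =>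
    d.ext.biUnion_rootOf hs (hs.isNode_rootOf hw) (self_mem_rootOf _)
  rw [← hq hu'.1, ← hq hv'.1]
  refine AltGraph.block_eq_of_matched (g := nodeGraph s hs c F)
    (q := fun R => R.biUnion (rootOf t.Ω)) ?_ ?_ ?_ ?_ hu'.2 hv'.2 ?_
  · rintro x y hx hy ⟨h1, h2, h3, a, ha, b, hb, h4, h5⟩
    rw [d.ext.biUnion_rootOf hs h2 ha, d.ext.biUnion_rootOf hs h3 hb]
    refine d.joined a b h4 (fun hm => by simpa using h5.1 hm) ?_ ?_
    · exact (outer_iff hs).2 ⟨hs.node_subset_U h2 ha, hs.node_eq h2 ha ▸ hx⟩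
    · exact (outer_iff hs).2 ⟨hs.node_subset_U h3 hb, hs.node_eq h3 hb ▸ hy⟩
  · exact fun hxy hne hxy' heq hne' => d.ext.matched_unique hs hxy hne hxy' heq hne'
  · rintro x y z ⟨h1, h2, h3, a, ha, b, hb, h4, h5⟩ hne' ⟨k1, f, -, hf, hfree⟩ heq
    rw [d.ext.biUnion_rootOf hs h2 ha] at hne' heq
    rw [d.ext.biUnion_rootOf hs h3 hb] at hne'
    rw [d.ext.biUnion_rootOf hs k1 hf] at heq
    have hbn : b ∉ rootOf t.Ω a := fun hm => hne' (rootOf_eq_of_mem d.ext.nested hm).symm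
    have haU : a ∈ t.U := d.ext.U ▸ hs.node_subset_U h2 ha
    exact d.struct_new.not_free_of_matched (d.struct_new.rootOf_part haU)
      (d.ext.M ▸ h5.2 rfl) (d.struct_new.not_mem_blossomEdges hbn) (Sym2.mem_mk_left _ _)
      (self_mem_rootOf a) (heq ▸ self_mem_rootOf f) (d.ext.free_iff.2 hfree)
  · rintro x y w hx ⟨-, -, hyn, -⟩ heq
    obtain ⟨l, hl, -⟩ := id hx
    have hxn : s.IsNode x := hl.isNode hs (by simp)
    obtain ⟨a, ha, rfl⟩ := hxn
    rw [hq ha] at heq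
    obtain ⟨b, hb, hab⟩ : ∃ b ∈ y, a ∈ rootOf t.Ω b := by
      have := self_mem_rootOf (Ω := t.Ω) a
      rw [← heq, mem_biUnion] at this
      exact this
    have hba := rootOf_eq_of_mem d.ext.nested hab
    have hbo := d.outer_congr ((outer_iff hs).2 ⟨ha, hx⟩) hba
    rw [hs.node_eq hyn hb]
    exact ((outer_iff hs).1 hbo).2
  · exact ⟨hne, hs.isNode_rootOf hu'.1, hs.isNode_rootOf hv'.1, u, self_mem_rootOf u, v,
      self_mem_rootOf v, (hu.matched hs hM hne).1,
      by simp [hM]⟩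

/-- How `yz(e)` can change in a dual adjustment. -/
theorem adjust_yz_cases {p : ℤ} (hz : ∀ B, Even (s.z B))
    (hp : ∀ v, s.Outer c F v ∨ s.Inner c F v → Even (s.y v - p)) {e : Sym2 W} (he : e ∈ s.E) :
    (adjust c F s t).yz e = s.yz e ∨ (∀ B ∈ t.Ω, e ∉ t.EB B) ∧
      (¬ s.Eligible c e ∧ e ∉ s.M ∧ Even (s.yz e) ∧ (adjust c F s t).yz e = s.yz e - 2 ∨
        ¬ s.Eligible c e ∧ e ∉ s.M ∧ (adjust c F s t).yz e = s.yz e - 1 ∨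
        (e ∈ s.M → ¬ s.Eligible c e) ∧ Even (s.yz e) ∧ (adjust c F s t).yz e = s.yz e + 2 ∨
        (e ∈ s.M → ¬ s.Eligible c e) ∧ (adjust c F s t).yz e = s.yz e + 1) := by
  have hs := d.struct
  induction e with
  | _ u v =>
  have huv : u ≠ v := fun h => hs.noloop _ he (by simp [h])
  by_cases heq : rootOf t.Ω u = rootOf t.Ω v
  · exact Or.inl (d.adjust_yz_of_eq huv heq)
  have hne : rootOf s.Ω u ≠ rootOf s.Ω v := fun h => heq (d.ext.rootOf_eq h)
  have hyz := d.adjust_yz_of_ne heq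
  have hEB : ∀ B ∈ t.Ω, s(u, v) ∉ t.EB B := by
    intro B hB h
    have hin := d.struct_new.cyclic.inside B hB _ h
    exact heq (rootOf_eq_of_blossom d.ext.nested hB (hin u (by simp)) (hin v (by simp)))
  have hev : (s.Outer c F u ∨ s.Inner c F u) → (s.Outer c F v ∨ s.Inner c F v) →
      Even (s.yz s(u, v)) := by
    intro h1 h2
    rw [even_yz_iff hz]
    have := (hp u h1).sub (hp v h2)
    rwa [sub_sub_sub_cancel_right] at this
  -- an outer vertex next to an unreached one
  have hnone : ∀ a b : W, s(a, b) ∈ s.E → rootOf s.Ω a ≠ rootOf s.Ω b → s.Outer c F a →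
      ¬ s.Outer c F b → ¬ s.Inner c F b → ¬ s.Eligible c s(a, b) ∧ s(a, b) ∉ s.M := by
    intro a b hab hne ha hb1 hb2
    have hM : s(a, b) ∉ s.M := fun hM => (ha.matched hs hM hne).2.elim hb1 hb2
    exact ⟨fun h => (ha.unmatched hs h hM).elim hb1 hb2, hM⟩
  have hin : ∀ a b : W, rootOf s.Ω a ≠ rootOf s.Ω b → s.Inner c F a → ¬ s.Outer c F b →
      s(a, b) ∈ s.M → ¬ s.Eligible c s(a, b) :=
    fun a b hne ha hb hM he => hb (ha.matched hs he hM hne)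
  by_cases hu : s.Outer c F u
  · rw [dualStep_outer hu] at hyz
    by_cases hv : s.Outer c F v
    · rw [dualStep_outer hv] at hyz
      have hM : s(u, v) ∉ s.M := fun hM => heq (d.rootOf_eq_of_matched hu hv hM)
      exact Or.inr ⟨hEB, Or.inl ⟨fun h => heq (d.joined u v h hM hu hv), hM,
        hev (Or.inl hu) (Or.inl hv), by rw [hyz]; ring⟩⟩
    · by_cases hv' : s.Inner c F v
      · rw [dualStep_inner hv'] at hyz
        exact Or.inl (by rw [hyz]; ring)
      · rw [dualStep_none hv hv'] at hyz
        obtain ⟨h1, h2⟩ := hnone u v he hne hu hv hv'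
        exact Or.inr ⟨hEB, Or.inr (Or.inl ⟨h1, h2, by rw [hyz]; ring⟩)⟩
  · by_cases hu' : s.Inner c F u
    · rw [dualStep_inner hu'] at hyz
      by_cases hv : s.Outer c F v
      · rw [dualStep_outer hv] at hyz
        exact Or.inl (by rw [hyz]; ring)
      · have h1 := hin u v hne hu' hv
        by_cases hv' : s.Inner c F v
        · rw [dualStep_inner hv'] at hyz
          exact Or.inr ⟨hEB, Or.inr (Or.inr (Or.inl ⟨h1, hev (Or.inr hu') (Or.inr hv'),
            by rw [hyz]; ring⟩))⟩
        · rw [dualStep_none hv hv'] at hyz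
          exact Or.inr ⟨hEB, Or.inr (Or.inr (Or.inr ⟨h1, by rw [hyz]; ring⟩))⟩
    · rw [dualStep_none hu hu'] at hyz
      by_cases hv : s.Outer c F v
      · rw [dualStep_outer hv] at hyz
        obtain ⟨h1, h2⟩ := hnone v u (by rwa [Sym2.eq_swap]) hne.symm hv hu hu'
        rw [Sym2.eq_swap] at h1 h2
        exact Or.inr ⟨hEB, Or.inr (Or.inl ⟨h1, h2, by rw [hyz]; ring⟩)⟩
      · by_cases hv' : s.Inner c F v
        · rw [dualStep_inner hv'] at hyz
          have h1 := hin v u hne.symm hv' hu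
          rw [Sym2.eq_swap] at h1
          exact Or.inr ⟨hEB, Or.inr (Or.inr (Or.inr ⟨h1, by rw [hyz]; ring⟩))⟩
        · rw [dualStep_none hv hv'] at hyz
          exact Or.inl (by rw [hyz]; ring)

end ShrinkData

theorem dissolve_mem {s : State W} {B : Finset W} :
    B ∈ (dissolve s).Ω ↔ B ∈ s.Ω ∧ ∃ C ∈ s.Ω, B ⊆ C ∧ s.z C ≠ 0 := by
  simp [dissolve]

/-- Survival passes to active subsets, so the constituents of a surviving blossom survive and its
cycle is intact. -/
theorem dissolve_struct {s : State W} (hs : s.Struct) : (dissolve s).Struct where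
  noloop := hs.noloop
  ends := hs.ends
  matching := hs.matching
  nested A hA B hB := hs.nested A (dissolve_mem.1 hA).1 B (dissolve_mem.1 hB).1
  active B hB := hs.active B (dissolve_mem.1 hB).1
  cycles B hB := by
    obtain ⟨hBs, D, hD, hBD, hz⟩ := dissolve_mem.1 hB
    obtain ⟨ℓ, A, a, b, hc⟩ := hs.cycles B hBs
    have hA : ∀ i < ℓ, A i ∈ s.Ω → A i ∈ (dissolve s).Ω := fun i hi h =>
      dissolve_mem.2 ⟨h, D, hD, (hc.subset hi).trans hBD, hz⟩
    refine ⟨ℓ, A, a, b, hc.odd, hc.three, hc.wrap, hc.disj, ?_, hc.edge, hc.union, ?_, ?_⟩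
    · exact fun i hi => (hc.child i hi).imp (hA i hi) id
    · refine hc.edges.trans ?_
      congr 1
      refine biUnion_congr rfl fun i hi => ?_
      unfold State.blossomEdges
      by_cases h : A i ∈ s.Ω
      · rw [if_pos h, if_pos (hA i (mem_range.1 hi) h)]
        rfl
      · rw [if_neg h, if_neg fun h' => h (dissolve_mem.1 h').1]
    · exact fun X hX hXB => hc.inside X (dissolve_mem.1 hX).1 hXB

theorem adjust_struct (hs : t.Struct) : (adjust c F s t).Struct where
  noloop := hs.noloop
  ends := hs.ends
  matching := hs.matching
  nested := hs.nested
  active := hs.active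
  cycles B hB := by
    obtain ⟨ℓ, A, a, b, hc⟩ := hs.cycles B hB
    exact ⟨ℓ, A, a, b, ⟨hc.odd, hc.three, hc.wrap, hc.disj, hc.child, hc.edge, hc.union, hc.edges,
      hc.inside⟩⟩

theorem State.IsRoot.nonempty (hs : t.Struct) {B : Finset W} (hB : t.IsRoot B) : ∃ v, v ∈ B := by
  have := hs.cyclic.three_le_card hB.1
  exact Finset.card_pos.1 (by omega)

/-- Shrinking, dual adjustment and dissolution preserve the invariants, provided that they preserve
near domination and near tightness. -/
theorem ShrinkData.good (d : ShrinkData c F s t) (hg : s.Good) {p : ℤ}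
    (hF : ∀ f ∈ F, s.Free f → Even (s.y f - p))
    (hdom : ∀ e ∈ s.E, s.w e - 2 ≤ (adjust c F s t).yz e)
    (htight : ∀ e, (e ∈ s.M ∨ ∃ B ∈ t.Ω, e ∈ t.EB B) → (adjust c F s t).yz e ≤ s.w e) :
    (dissolve (adjust c F s t)).Good := by
  have hs := d.struct
  have hst : (dissolve (adjust c F s t)).Struct := dissolve_struct (adjust_struct d.struct_new)
  have hgran : ∀ B, 0 ≤ (adjust c F s t).z B ∧ Even ((adjust c F s t).z B) := by
    intro B
    by_cases hB : t.IsRoot B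
    · obtain ⟨v, hv⟩ := hB.nonempty d.struct_new
      have hzB := hg.rcs.granularity B
      rw [d.adjust_z_root hB hv, d.ext.z]
      refine ⟨?_, hzB.2.sub (by simp)⟩
      by_cases h1 : s.Outer c F v
      · rw [dualStep_outer h1]; linarith [hzB.1]
      · by_cases h2 : s.Inner c F v
        · rw [dualStep_inner h2]
          -- New blossoms are outer, so an inner root is an old one and has positive even dual, at
          -- least 2: subtracting 2 is safe.
          have hBs : B ∈ s.Ω := by
            by_contra hn
            exact h1 (d.new B hB.1 hn v hv)
          have hpos := hg.rcs.root_pos B ⟨hBs, fun C hC => hB.2 C (d.ext.Ω hC)⟩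
          obtain ⟨k, hk⟩ := hzB.2
          omega
        · rw [dualStep_none h1 h2]; linarith [hzB.1]
    · rw [d.adjust_z_of_not_root hB, d.ext.z]
      exact hg.rcs.granularity B
  refine ⟨⟨?_, ?_, hst.nested, fun B hB => hst.isBlossom hB, hgran, hst.active, ?_, ?_, ?_, ?_⟩,
    hst.noloop, hst.ends, ?_⟩
  · intro e he
    have : e ∈ s.E := d.ext.E ▸ he
    exact (congrFun d.ext.w e).symm ▸ hg.rcs.even_weight e this
  · exact hst.matching
  · intro B hB
    obtain ⟨hB1, hB2⟩ := hB
    obtain ⟨h1, D, hD, hBD, hz⟩ := dissolve_mem.1 hB1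
    have := hB2 D (dissolve_mem.2 ⟨hD, D, hD, Finset.Subset.refl _, hz⟩) hBD
    subst this
    exact lt_of_le_of_ne (hgran D).1 (Ne.symm hz)
  · intro B hB
    by_cases hBt : B ∈ t.Ω
    · by_contra hz
      exact hB (dissolve_mem.2 ⟨hBt, B, hBt, Finset.Subset.refl _, hz⟩)
    · refine (d.adjust_z_of_not_root fun h => hBt h.1).trans ?_
      rw [d.ext.z]
      exact hg.rcs.inactive B fun h => hBt (d.ext.Ω h)
  · intro e he
    have := hdom e (d.ext.E ▸ he)
    rw [← d.ext.w] at this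
    exact this
  · intro e he
    have := htight e (he.imp (fun h => d.ext.M ▸ h) fun ⟨B, hB, h⟩ => ⟨B, (dissolve_mem.1 hB).1, h⟩)
    rw [← d.ext.w] at this
    exact this
  · intro B hB u hu v hv
    have hBt : B ∈ t.Ω := (dissolve_mem.1 hB).1
    change Even ((adjust c F s t).y u - (adjust c F s t).y v)
    rw [adjust_y, adjust_y, d.dualStep_congr (rootOf_eq_of_blossom d.ext.nested hBt hu hv), d.ext.y,
      add_sub_add_right_eq_sub]
    by_cases hBs : B ∈ s.Ω
    · exact hg.parity B hBs u hu v hv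
    · have h1 := hg.reached_parity hF (Or.inl (d.new B hBt hBs u hu))
      have h2 := hg.reached_parity hF (Or.inl (d.new B hBt hBs v hv))
      have := h1.sub h2
      rwa [sub_sub_sub_cancel_right] at this

theorem ShrinkData.adjust_yz_blossom (d : ShrinkData c F s t) (hg : s.Good) {p : ℤ}
    (hF : ∀ f ∈ F, s.Free f → Even (s.y f - p)) {e : Sym2 W} (he : ∃ B ∈ t.Ω, e ∈ t.EB B) :
    (adjust c F s t).yz e = s.yz e := by
  obtain ⟨B, hB, heB⟩ := he
  have heE : e ∈ s.E := d.ext.E ▸ d.struct_new.cyclic.EB_subset B hB heB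
  rcases d.adjust_yz_cases (fun B => (hg.rcs.granularity B).2)
    (fun v hv => hg.reached_parity hF hv) heE with h | ⟨h, -⟩
  · exact h
  · exact absurd heB (h B hB)

/-- The invariants are preserved for the criteria `batch` and `near`. -/
theorem ShrinkData.good_of_ne_tight (d : ShrinkData c F s t) (hg : s.Good) {p : ℤ}
    (hF : ∀ f ∈ F, s.Free f → Even (s.y f - p)) (hc : c ≠ .tight) :
    (dissolve (adjust c F s t)).Good := by
  have hcases := fun {e} (he : e ∈ s.E) => d.adjust_yz_cases
    (fun B => (hg.rcs.granularity B).2) (fun v hv => hg.reached_parity hF hv) he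
  refine d.good hg hF ?_ ?_
  · intro e he
    have h1 := hg.rcs.near_domination e he
    have hw := hg.rcs.even_weight e he
    -- A decreasing `yz` occurs on ineligible unmatched edges only, where the lower bound is not
    -- attained. If the decrease is 2, then `yz` and `w` are even, so the slack is at least 2.
    have helig : e ∉ s.M → ¬ s.Eligible c e → s.yz e ≠ s.w e - 2 := by
      intro hM hel h
      apply hel
      refine ⟨he, ?_⟩
      cases c with
      | tight => exact absurd rfl hc
      | near => exact Or.inr h
      | batch => exact Or.inr (Or.inl ⟨hM, h⟩)
    rcases hcases he with h | ⟨-, ⟨h2, h3, h4, h⟩ | ⟨h2, h3, h⟩ | ⟨h2, h3, h⟩ | ⟨h2, h⟩⟩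
    · rw [h]; exact h1
    · have h5 := helig h3 h2
      rw [h]
      obtain ⟨k, hk⟩ := hw
      obtain ⟨m, hm⟩ := h4
      omega
    · have h5 := helig h3 h2
      omega
    · omega
    · omega
  · intro e he
    by_cases heB : ∃ B ∈ t.Ω, e ∈ t.EB B
    · rw [d.adjust_yz_blossom hg hF heB]
      obtain ⟨B, hB, heB⟩ := heB
      rcases d.ext.mem_EB d.struct B hB e heB with h | h
      · obtain ⟨h1, h2⟩ := h
        cases c with
        | tight => exact absurd rfl hc
        | near => simp only at h2; omega
        | batch =>
          simp only at h2
          rcases h2 with h | h | h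
          · exact hg.rcs.near_tightness e (Or.inr h)
          · omega
          · omega
      · exact hg.rcs.near_tightness e (Or.inr h)
    · have heM := he.resolve_right heB
      have heE := hg.rcs.matching.1 heM
      have h1 := hg.rcs.near_tightness e (Or.inl heM)
      have hw := hg.rcs.even_weight e heE
      -- Dually, `yz` of a matched edge increases only if the edge is ineligible, hence not tight,
      -- and evenness again provides room for 2.
      have helig : ¬ s.Eligible c e → s.yz e ≠ s.w e := by
        intro hel h
        apply hel
        refine ⟨heE, ?_⟩
        cases c with
        | tight => exact absurd rfl hc
        | near => exact Or.inl h
        | batch => exact Or.inr (Or.inr ⟨heM, h⟩)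
      rcases hcases heE with h | ⟨-, ⟨h2, h3, h4, h⟩ | ⟨h2, h3, h⟩ | ⟨h2, h3, h⟩ | ⟨h2, h⟩⟩
      · rw [h]; exact h1
      · exact absurd heM h3
      · exact absurd heM h3
      · have h5 := helig (h2 heM)
        rw [h]
        obtain ⟨k, hk⟩ := hw
        obtain ⟨m, hm⟩ := h3
        omega
      · have h5 := helig (h2 heM)
        omega

/-- The additional invariant of the first phase of a scale. -/
structure State.Tight (s : State W) : Prop where
  dom : ∀ e ∈ s.E, s.w e ≤ s.yz e
  tight : ∀ e, (e ∈ s.M ∨ ∃ B ∈ s.Ω, e ∈ s.EB B) → s.yz e = s.w e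

/-- Eligible now means tight. An edge whose `yz` falls is not tight, with even slack if the fall is
2, and matched and blossom edges, all tight, do not change `yz` at all. -/
theorem ShrinkData.good_of_tight (d : ShrinkData .tight F s t) (hg : s.Good) (ht : s.Tight) {p : ℤ}
    (hF : ∀ f ∈ F, s.Free f → Even (s.y f - p)) :
    (dissolve (adjust .tight F s t)).Good ∧ (dissolve (adjust .tight F s t)).Tight := by
  have hcases := fun {e} (he : e ∈ s.E) => d.adjust_yz_cases
    (fun B => (hg.rcs.granularity B).2) (fun v hv => hg.reached_parity hF hv) he
  have hdom : ∀ e ∈ s.E, s.w e ≤ (adjust .tight F s t).yz e := by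
    intro e he
    have h1 := ht.dom e he
    have hw := hg.rcs.even_weight e he
    rcases hcases he with h | ⟨-, ⟨h2, h3, h4, h⟩ | ⟨h2, h3, h⟩ | ⟨h2, h3, h⟩ | ⟨h2, h⟩⟩
    · rw [h]; exact h1
    · have h5 : s.yz e ≠ s.w e := fun h => h2 ⟨he, h⟩
      rw [h]
      obtain ⟨k, hk⟩ := hw
      obtain ⟨m, hm⟩ := h4
      omega
    · have h5 : s.yz e ≠ s.w e := fun h => h2 ⟨he, h⟩
      omega
    · omega
    · omega
  have htight : ∀ e, (e ∈ s.M ∨ ∃ B ∈ t.Ω, e ∈ t.EB B) → (adjust .tight F s t).yz e = s.w e := by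
    intro e he
    by_cases heB : ∃ B ∈ t.Ω, e ∈ t.EB B
    · rw [d.adjust_yz_blossom hg hF heB]
      obtain ⟨B, hB, heB⟩ := heB
      rcases d.ext.mem_EB d.struct B hB e heB with h | h
      · exact h.2
      · exact ht.tight e (Or.inr h)
    · have heM := he.resolve_right heB
      have heE := hg.rcs.matching.1 heM
      have h1 := ht.tight e (Or.inl heM)
      have hel : s.Eligible .tight e := ⟨heE, h1⟩
      rcases hcases heE with h | ⟨-, ⟨h2, -⟩ | ⟨h2, -⟩ | ⟨h2, -⟩ | ⟨h2, -⟩⟩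
      · rw [h]; exact h1
      · exact absurd hel h2
      · exact absurd hel h2
      · exact absurd hel (h2 heM)
      · exact absurd hel (h2 heM)
  refine ⟨d.good hg hF (fun e he => by linarith [hdom e he]) fun e he => (htight e he).le, ?_, ?_⟩
  · intro e he
    have := hdom e (d.ext.E ▸ he)
    rw [← d.ext.w] at this
    exact this
  · intro e he
    have := htight e (he.imp (fun h => d.ext.M ▸ h) fun ⟨B, hB, h⟩ => ⟨B, (dissolve_mem.1 hB).1, h⟩)
    rw [← d.ext.w] at this
    exact this

theorem ShrinkData.free_iff (d : ShrinkData c F s t) {v : W} :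
    (dissolve (adjust c F s t)).Free v ↔ s.Free v := d.ext.free_iff

theorem ShrinkData.free_y (d : ShrinkData c F s t) {v : W} (hv : s.Free v) :
    (dissolve (adjust c F s t)).y v = if v ∈ F then s.y v - 1 else s.y v := by
  refine (adjust_y v).trans ?_
  rw [d.ext.y]
  split_ifs with h
  · rw [dualStep_outer (free_outer d.struct h hv)]; ring
  · rw [dualStep_none (free_not_outer d.struct h hv) (free_not_inner d.struct d.noAug hv)]; ring

end Adjust

/-! ### Augmentation preserves the invariants -/

section Augmentation
variable {W : Type u} [Fintype W] [DecidableEq W]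
variable {s : State W}

theorem mem_pathEdges {P : List W} {e : Sym2 W} :
    e ∈ pathEdges P ↔ ∃ j u v, P[j]? = some u ∧ P[j + 1]? = some v ∧ e = s(u, v) := by
  unfold pathEdges
  rw [List.mem_toFinset, List.mem_map]
  constructor
  · rintro ⟨⟨u, v⟩, h, rfl⟩
    obtain ⟨j, hj⟩ := List.mem_iff_getElem?.1 h
    rw [List.getElem?_zip_eq_some] at hj
    exact ⟨j, u, v, hj.1, by simpa using hj.2, rfl⟩
  · rintro ⟨j, u, v, h1, h2, rfl⟩
    refine ⟨(u, v), List.mem_iff_getElem?.2 ⟨j, ?_⟩, rfl⟩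
    rw [List.getElem?_zip_eq_some]
    exact ⟨h1, by simpa using h2⟩

theorem mem_of_mem_pathEdges {P : List W} {e : Sym2 W} (he : e ∈ pathEdges P) {v : W}
    (hv : v ∈ e) : v ∈ P := by
  obtain ⟨j, x, y, hx, hy, rfl⟩ := mem_pathEdges.1 he
  rcases Sym2.mem_iff.1 hv with rfl | rfl
  · exact List.mem_of_getElem? hx
  · exact List.mem_of_getElem? hy

/-- Exchange the edges of `S` between the matching and its complement. -/
def State.flip (s : State W) (S : Finset (Sym2 W)) : State W := { s with M := symmDiff s.M S }

/-- An augmenting path that passes through the blossoms properly. -/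
structure State.Augmenting (s : State W) (P : List W) : Prop where
  nodup : P.Nodup
  two_le : 2 ≤ P.length
  free_ends : ∀ v, P.head? = some v ∨ P.getLast? = some v → s.Free v
  alternating : ∀ (j : ℕ) (u v : W), P[j]? = some u → P[j + 1]? = some v →
    s(u, v) ∈ s.E ∧ (s(u, v) ∈ s.M ↔ Odd j)
  stretch : ∀ B ∈ s.Ω, ∃ a b : ℕ, b ≤ P.length ∧ (a < b → Odd (b - a)) ∧
    ∀ (j : ℕ) (v : W), P[j]? = some v → (v ∈ B ↔ a ≤ j ∧ j < b)
  inside : ∀ B ∈ s.Ω, ∀ (j : ℕ) (u v : W), P[j]? = some u → P[j + 1]? = some v →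
    u ∈ B → v ∈ B → s(u, v) ∈ s.EB B

theorem getElem?_index_eq {P : List W} (hP : P.Nodup) {i j : ℕ} {v : W} (hi : P[i]? = some v)
    (hj : P[j]? = some v) : i = j := by
  obtain ⟨h1, h2⟩ := List.getElem?_eq_some_iff.1 hi
  exact (List.getElem?_inj h1 hP).1 (hi.trans hj.symm)

theorem card_Ico_odd (a k : ℕ) : ((Ico a (a + 2 * k)).filter Odd).card =
    ((Ico a (a + 2 * k)).filter fun j => ¬ Odd j).card := by
  induction k with
  | zero => simp
  | succ k ih =>
    have h1 : Ico a (a + 2 * (k + 1)) =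
        insert (a + 2 * k) (insert (a + 2 * k + 1) (Ico a (a + 2 * k))) := by
      ext j
      simp only [mem_Ico, mem_insert]
      omega
    rw [h1]
    simp only [filter_insert]
    by_cases ha : Odd (a + 2 * k)
    · have hb : ¬ Odd (a + 2 * k + 1) := Nat.not_odd_iff_even.2 ha.add_one
      rw [if_pos ha, if_neg hb, if_neg (not_not.2 ha), if_pos hb, card_insert_of_notMem (by simp),
        card_insert_of_notMem (by simp), ih]
    · have hb : Odd (a + 2 * k + 1) := (Nat.not_odd_iff_even.1 ha).add_one
      rw [if_neg ha, if_pos hb, if_pos ha, if_neg (not_not.2 hb), card_insert_of_notMem (by simp),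
        card_insert_of_notMem (by simp), ih]

namespace State.Augmenting
variable {P : List W} (hP : s.Augmenting P)
include hP

theorem exists_get : ∃ g : ℕ → W, ∀ j < P.length, P[j]? = some (g j) := by
  have h0 : 0 < P.length := by have := hP.two_le; omega
  exact ⟨fun j => if h : j < P.length then P[j] else P[0], fun j hj => by
    simp only [dif_pos hj]; exact List.getElem?_eq_getElem hj⟩

/-- The last vertex is free, so the last edge is unmatched and has even index. -/
theorem even_length : Even P.length := by
  obtain ⟨g, hg⟩ := hP.exists_get
  have h2 := hP.two_le
  have h1 := hP.alternating (P.length - 2) _ _ (hg _ (by omega)) (hg _ (by omega))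
  have h3 : P.length - 2 + 1 = P.length - 1 := by omega
  have hfree := hP.free_ends (g (P.length - 1)) (Or.inr (by
    rw [List.getLast?_eq_getElem?]
    exact hg _ (by omega)))
  rw [h3] at h1
  have h4 : ¬ Odd (P.length - 2) := fun h => hfree.2 _ (h1.2.2 h) (by simp)
  rw [Nat.not_odd_iff_even] at h4
  have : P.length = P.length - 2 + 2 := by omega
  rw [this]
  exact h4.add even_two

theorem exists_unmatched {v : W} (hv : v ∈ P) : ∃ e ∈ pathEdges P, e ∉ s.M ∧ v ∈ e := by
  obtain ⟨g, hg⟩ := hP.exists_get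
  obtain ⟨i, hi⟩ := List.mem_iff_getElem?.1 hv
  obtain ⟨hiL, -⟩ := List.getElem?_eq_some_iff.1 hi
  have hL := hP.even_length
  rcases Nat.even_or_odd i with he | ho
  · have hlt : i + 1 < P.length := by
      rcases Nat.lt_or_ge (i + 1) P.length with h | h
      · exact h
      · have : P.length = i + 1 := by omega
        rw [this] at hL
        exact absurd he.add_one (Nat.not_odd_iff_even.2 hL)
    refine ⟨s(v, g (i + 1)), mem_pathEdges.2 ⟨i, _, _, hi, hg _ hlt, rfl⟩, ?_, by simp⟩
    rw [(hP.alternating i _ _ hi (hg _ hlt)).2]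
    exact Nat.not_odd_iff_even.2 he
  · obtain ⟨k, rfl⟩ : ∃ k, i = k + 1 := ⟨i - 1, by obtain ⟨m, hm⟩ := ho; omega⟩
    refine ⟨s(g k, v), mem_pathEdges.2 ⟨k, _, _, hg _ (by omega), hi, rfl⟩, ?_, by simp⟩
    rw [(hP.alternating k _ _ (hg _ (by omega)) hi).2]
    simpa [Nat.odd_add_one] using ho

/-- The ends of the path are free, and every interior vertex is matched along the path. -/
theorem mem_pathEdges_of_matched (hs : s.Struct) {e : Sym2 W} (he : e ∈ s.M) {v : W} (hv : v ∈ e)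
    (hvP : v ∈ P) : e ∈ pathEdges P := by
  obtain ⟨g, hg⟩ := hP.exists_get
  obtain ⟨i, hi⟩ := List.mem_iff_getElem?.1 hvP
  obtain ⟨hiL, -⟩ := List.getElem?_eq_some_iff.1 hi
  have hnf : ¬ s.Free v := fun h => h.2 e he hv
  have h0 : i ≠ 0 := by
    rintro rfl
    exact hnf (hP.free_ends v (Or.inl (by rw [List.head?_eq_getElem?]; exact hi)))
  have h1 : i + 1 < P.length := by
    rcases Nat.lt_or_ge (i + 1) P.length with h | h
    · exact h
    · have : i = P.length - 1 := by omega
      rw [this] at hi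
      exact absurd (hP.free_ends v (Or.inr (by rw [List.getLast?_eq_getElem?]; exact hi))) hnf
  rcases Nat.even_or_odd i with hi' | hi'
  · obtain ⟨k, rfl⟩ : ∃ k, i = k + 1 := ⟨i - 1, by omega⟩
    have hk := (hP.alternating k _ _ (hg k (by omega)) hi).2.2 (by
      simpa [Nat.even_add_one] using hi')
    have := hs.matching.2 e he _ hk v hv (by simp)
    exact mem_pathEdges.2 ⟨k, _, _, hg k (by omega), hi, this⟩
  · have hk := (hP.alternating i _ _ hi (hg _ h1)).2.2 hi'
    have := hs.matching.2 e he _ hk v hv (by simp)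
    exact mem_pathEdges.2 ⟨i, _, _, hi, hg _ h1, this⟩

theorem unmatched_unique {e f : Sym2 W} (he : e ∈ pathEdges P) (hf : f ∈ pathEdges P)
    (heM : e ∉ s.M) (hfM : f ∉ s.M) {v : W} (hv : v ∈ e) (hv' : v ∈ f) : e = f := by
  obtain ⟨i, a, b, ha, hb, rfl⟩ := mem_pathEdges.1 he
  obtain ⟨j, a', b', ha', hb', rfl⟩ := mem_pathEdges.1 hf
  have hi := heM
  have hj := hfM
  rw [(hP.alternating i a b ha hb).2, Nat.not_odd_iff_even] at hi
  rw [(hP.alternating j a' b' ha' hb').2, Nat.not_odd_iff_even] at hj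
  have hij : i = j := by
    rcases Sym2.mem_iff.1 hv with rfl | rfl <;> rcases Sym2.mem_iff.1 hv' with rfl | rfl
    · exact getElem?_index_eq hP.nodup ha ha'
    · have := getElem?_index_eq hP.nodup ha hb'
      rw [this] at hi
      exact absurd hj (by simpa [Nat.even_add_one] using hi)
    · have := getElem?_index_eq hP.nodup hb ha'
      rw [← this] at hj
      exact absurd hi (by simpa [Nat.even_add_one] using hj)
    · have := getElem?_index_eq hP.nodup hb hb'
      omega
  subst hij
  rw [ha] at ha'
  rw [hb] at hb'
  rw [Option.some.inj ha', Option.some.inj hb']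

theorem mem_flip {e : Sym2 W} : e ∈ (s.flip (pathEdges P)).M ↔
    (e ∈ s.M ∧ e ∉ pathEdges P) ∨ (e ∈ pathEdges P ∧ e ∉ s.M) := Finset.mem_symmDiff

theorem flip_matching (hs : s.Struct) : IsMatching s.E (s.flip (pathEdges P)).M := by
  constructor
  · intro e he
    rcases hP.mem_flip.1 he with ⟨h, -⟩ | ⟨h, -⟩
    · exact hs.matching.1 h
    · obtain ⟨j, u, v, hu, hv, rfl⟩ := mem_pathEdges.1 h
      exact (hP.alternating j u v hu hv).1
  · intro e he f hf v hve hvf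
    rcases hP.mem_flip.1 he with ⟨h1, h2⟩ | ⟨h1, h2⟩ <;>
      rcases hP.mem_flip.1 hf with ⟨h3, h4⟩ | ⟨h3, h4⟩
    · exact hs.matching.2 e h1 f h3 v hve hvf
    · exact absurd (hP.mem_pathEdges_of_matched hs h1 hve (mem_of_mem_pathEdges h3 hvf)) h2
    · exact absurd (hP.mem_pathEdges_of_matched hs h3 hvf (mem_of_mem_pathEdges h1 hve)) h4
    · exact hP.unmatched_unique h1 h3 h2 h4 hve hvf

theorem flip_free {v : W} : (s.flip (pathEdges P)).Free v ↔ s.Free v ∧ v ∉ P := by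
  constructor
  · rintro ⟨hU, h⟩
    have hvP : v ∉ P := by
      intro hvP
      obtain ⟨e, he, heM, hve⟩ := hP.exists_unmatched hvP
      exact h e (hP.mem_flip.2 (Or.inr ⟨he, heM⟩)) hve
    refine ⟨⟨hU, fun e he hve => ?_⟩, hvP⟩
    exact h e (hP.mem_flip.2 (Or.inl ⟨he, fun h' => hvP (mem_of_mem_pathEdges h' hve)⟩)) hve
  · rintro ⟨⟨hU, h⟩, hvP⟩
    refine ⟨hU, fun e he hve => ?_⟩
    rcases hP.mem_flip.1 he with ⟨h1, -⟩ | ⟨h1, -⟩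
    · exact h e h1 hve
    · exact hvP (mem_of_mem_pathEdges h1 hve)

/-- The path runs through `B` along an odd number of consecutive vertices, thus an even number of
alternating edges of `E_B`: as many matched as unmatched ones, and these are swapped. -/
theorem flip_card (hs : s.Struct) {B : Finset W} (hB : B ∈ s.Ω) :
    ((s.flip (pathEdges P)).M ∩ s.EB B).card = (s.M ∩ s.EB B).card := by
  obtain ⟨g, hg⟩ := hP.exists_get
  obtain ⟨a, b, hbL, hab, hst⟩ := hP.stretch B hB
  set f : ℕ → Sym2 W := fun j => s(g j, g (j + 1)) with hf
  have hfinj : ∀ i j, i + 1 < P.length → j + 1 < P.length → f i = f j → i = j := by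
    intro i j hi hj hij
    simp only [hf, Sym2.eq_iff] at hij
    rcases hij with ⟨h1, -⟩ | ⟨h1, h2⟩
    · have := hg i (by omega)
      rw [h1] at this
      exact getElem?_index_eq hP.nodup this (hg j (by omega))
    · have e1 := hg i (by omega)
      rw [h1] at e1
      have e2 := hg (i + 1) (by omega)
      rw [h2] at e2
      have := getElem?_index_eq hP.nodup e1 (hg (j + 1) (by omega))
      have := getElem?_index_eq hP.nodup e2 (hg j (by omega))
      omega
  -- The edges inside `B` are those with index at least `a` and below `b - 1`; if the path misses
  -- `B`, this interval is empty.
  obtain ⟨b', hb'L, hI⟩ : ∃ b', b' + 1 ≤ P.length ∧ (∃ k, Ico a b' = Ico a (a + 2 * k)) ∧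
      ∀ j, (a ≤ j ∧ j + 1 < b) ↔ j ∈ Ico a b' := by
    have h2 := hP.two_le
    refine ⟨b - 1, by omega, ?_, fun j => by rw [mem_Ico]; omega⟩
    rcases Nat.lt_or_ge a b with h | h
    · obtain ⟨k, hk⟩ := hab h
      exact ⟨k, by congr 1; omega⟩
    · exact ⟨0, by ext j; simp only [mem_Ico]; omega⟩
  obtain ⟨⟨k, hk⟩, hI⟩ := hI
  have hmem : ∀ e, e ∈ pathEdges P ∩ s.EB B ↔ ∃ j ∈ Ico a b', f j = e := by
    intro e
    rw [mem_inter]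
    constructor
    · rintro ⟨h1, h2⟩
      obtain ⟨j, u, v, hu, hv, rfl⟩ := mem_pathEdges.1 h1
      have hin := hs.cyclic.inside B hB _ h2
      have h3 := (hst j u hu).1 (hin u (by simp))
      have h4 := (hst (j + 1) v hv).1 (hin v (by simp))
      refine ⟨j, (hI j).1 ⟨h3.1, h4.2⟩, ?_⟩
      have e1 := hg j (by omega)
      have e2 := hg (j + 1) (by omega)
      rw [hu] at e1
      rw [hv] at e2
      simp only [hf]
      rw [← Option.some.inj e1, ← Option.some.inj e2]
    · rintro ⟨j, hj, rfl⟩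
      have hj' := (hI j).2 hj
      have e1 := hg j (by omega)
      have e2 := hg (j + 1) (by omega)
      exact ⟨mem_pathEdges.2 ⟨j, _, _, e1, e2, rfl⟩, hP.inside B hB j _ _ e1 e2
        ((hst _ _ e1).2 ⟨hj'.1, by omega⟩) ((hst _ _ e2).2 ⟨by omega, hj'.2⟩)⟩
  have hmM : ∀ j ∈ Ico a b', (f j ∈ s.M ↔ Odd j) := by
    intro j hj
    have hj' := (hI j).2 hj
    exact (hP.alternating j _ _ (hg j (by omega)) (hg (j + 1) (by omega))).2
  have hinj : Set.InjOn f (Ico a b' : Finset ℕ) := by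
    intro i hi j hj hij
    have hi' := (hI i).2 hi
    have hj' := (hI j).2 hj
    exact hfinj i j (by omega) (by omega) hij
  have hcard1 : (s.M ∩ (pathEdges P ∩ s.EB B)).card = ((Ico a b').filter Odd).card := by
    rw [← card_image_of_injOn (hinj.mono (s₁ := ((Ico a b').filter Odd : Finset ℕ))
      (coe_subset.2 (filter_subset _ _)))]
    congr 1
    ext e
    rw [mem_inter, hmem, mem_image]
    constructor
    · rintro ⟨h1, j, hj, rfl⟩
      exact ⟨j, mem_filter.2 ⟨hj, (hmM j hj).1 h1⟩, rfl⟩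
    · rintro ⟨j, hj, rfl⟩
      rw [mem_filter] at hj
      exact ⟨(hmM j hj.1).2 hj.2, j, hj.1, rfl⟩
  have hcard2 : ((pathEdges P ∩ s.EB B) \ s.M).card =
      ((Ico a b').filter fun j => ¬ Odd j).card := by
    rw [← card_image_of_injOn (hinj.mono (s₁ := ((Ico a b').filter (fun j => ¬ Odd j) : Finset ℕ))
      (coe_subset.2 (filter_subset _ _)))]
    congr 1
    ext e
    rw [mem_sdiff, hmem, mem_image]
    constructor
    · rintro ⟨⟨j, hj, rfl⟩, h1⟩
      exact ⟨j, mem_filter.2 ⟨hj, fun h => h1 ((hmM j hj).2 h)⟩, rfl⟩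
    · rintro ⟨j, hj, rfl⟩
      rw [mem_filter] at hj
      exact ⟨⟨j, hj.1, rfl⟩, fun h => hj.2 ((hmM j hj.1).1 h)⟩
  rw [hk] at hcard1 hcard2
  rw [card_Ico_odd, ← hcard2] at hcard1
  have h1 : (s.flip (pathEdges P)).M ∩ s.EB B =
      ((s.M ∩ s.EB B) \ pathEdges P) ∪ ((pathEdges P ∩ s.EB B) \ s.M) := by
    ext e
    rw [mem_inter, hP.mem_flip]
    simp only [mem_union, mem_sdiff, mem_inter]
    tauto
  rw [h1, card_union_of_disjoint, ← hcard1]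
  · have h2 : s.M ∩ (pathEdges P ∩ s.EB B) = (s.M ∩ s.EB B) ∩ pathEdges P := by
      ext e; simp only [mem_inter]; tauto
    rw [h2, card_sdiff_add_card_inter]
  · rw [Finset.disjoint_left]
    intro e he he'
    simp only [mem_sdiff, mem_inter] at he he'
    exact he'.2 he.1.1

theorem flip_struct (hs : s.Struct) : (s.flip (pathEdges P)).Struct where
  noloop := hs.noloop
  ends := hs.ends
  matching := hP.flip_matching hs
  nested := hs.nested
  cycles B hB := by
    obtain ⟨ℓ, A, a, b, hc⟩ := hs.cycles B hB
    exact ⟨ℓ, A, a, b, ⟨hc.odd, hc.three, hc.wrap, hc.disj, hc.child, hc.edge, hc.union, hc.edges,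
      hc.inside⟩⟩
  active B hB := (hP.flip_card hs hB).trans (hs.active B hB)

theorem flip_good (hg : s.Good) (ht : ∀ e ∈ pathEdges P, e ∉ s.M → s.yz e ≤ s.w e) :
    (s.flip (pathEdges P)).Good := by
  have hst := hP.flip_struct hg.struct
  refine ⟨⟨hg.rcs.even_weight, hst.matching, hst.nested, fun B hB => hst.isBlossom hB,
    hg.rcs.granularity, hst.active, hg.rcs.root_pos, hg.rcs.inactive, hg.rcs.near_domination, ?_⟩,
    hg.noloop, hg.ends, hg.parity⟩
  rintro e (he | he)
  · rcases hP.mem_flip.1 he with ⟨h1, -⟩ | ⟨h1, h2⟩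
    · exact hg.rcs.near_tightness e (Or.inl h1)
    · exact ht e h1 h2
  · exact hg.rcs.near_tightness e (Or.inr he)

theorem of_disjoint {Q : List W} (hQ : s.Augmenting Q) (hdis : List.Disjoint P Q) :
    (s.flip (pathEdges P)).Augmenting Q := by
  refine ⟨hQ.nodup, hQ.two_le, ?_, ?_, hQ.stretch, hQ.inside⟩
  · intro v hv
    refine hP.flip_free.2 ⟨hQ.free_ends v hv, fun h => hdis h ?_⟩
    rcases hv with hv | hv
    · exact List.mem_of_head? hv
    · exact List.mem_of_getLast? hv
  · intro j u v hu hv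
    have h1 := hQ.alternating j u v hu hv
    refine ⟨h1.1, ?_⟩
    rw [← h1.2, hP.mem_flip]
    have : s(u, v) ∉ pathEdges P := fun h =>
      hdis (mem_of_mem_pathEdges h (Sym2.mem_mk_left u v)) (List.mem_of_getElem? hu)
    tauto

end State.Augmenting

/-- Simultaneous augmentation along disjoint paths. -/
theorem State.Good.flip_all : ∀ {Ps : List (List W)} {s : State W}, s.Good →
    (∀ P ∈ Ps, s.Augmenting P) → Ps.Pairwise List.Disjoint →
    (∀ P ∈ Ps, ∀ e ∈ pathEdges P, e ∉ s.M → s.yz e ≤ s.w e) →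
    (s.flip (Ps.toFinset.biUnion pathEdges)).Good ∧
      ∀ v, (s.flip (Ps.toFinset.biUnion pathEdges)).Free v ↔ s.Free v ∧ ∀ P ∈ Ps, v ∉ P := by
  intro Ps
  induction Ps with
  | nil =>
    intro s hg _ _ _
    have : s.flip (([] : List (List W)).toFinset.biUnion pathEdges) = s := by
      have h0 : symmDiff s.M (∅ : Finset (Sym2 W)) = s.M := symmDiff_bot s.M
      simp [State.flip, h0]
    rw [this]
    exact ⟨hg, by simp⟩
  | cons P Ps ih =>
    intro s hg hA hdis ht
    rw [List.pairwise_cons] at hdis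
    have hP := hA P (by simp)
    -- Disjoint paths have disjoint edge sets, so the simultaneous exchange is a succession of
    -- single ones.
    have hflip : s.flip ((P :: Ps).toFinset.biUnion pathEdges) =
        (s.flip (pathEdges P)).flip (Ps.toFinset.biUnion pathEdges) := by
      have hd : Disjoint (pathEdges P) (Ps.toFinset.biUnion pathEdges) := by
        rw [Finset.disjoint_left]
        intro e he he'
        obtain ⟨Q, hQ, heQ⟩ := mem_biUnion.1 he'
        induction e with
        | _ x y =>
        exact hdis.1 Q (List.mem_toFinset.1 hQ) (mem_of_mem_pathEdges he (Sym2.mem_mk_left x y))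
          (mem_of_mem_pathEdges heQ (Sym2.mem_mk_left x y))
      simp only [State.flip]
      rw [symmDiff_assoc, hd.symmDiff_eq_sup, List.toFinset_cons, biUnion_insert]
      rfl
    rw [hflip]
    obtain ⟨h1, h2⟩ := ih (hP.flip_good hg (ht P (by simp)))
      (fun Q hQ => hP.of_disjoint (hA Q (by simp [hQ])) (hdis.1 Q hQ)) hdis.2 (by
        intro Q hQ e he hM
        refine ht Q (by simp [hQ]) e he fun h => hM (hP.mem_flip.2 (Or.inl ⟨h, fun h' => ?_⟩))
        induction e with
        | _ x y =>
        exact hdis.1 Q hQ (mem_of_mem_pathEdges h' (Sym2.mem_mk_left x y))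
          (mem_of_mem_pathEdges he (Sym2.mem_mk_left x y)))
    refine ⟨h1, fun v => ?_⟩
    rw [h2, hP.flip_free]
    simp only [List.mem_cons, forall_eq_or_imp]
    tauto

/-! ### Extensions of augmenting paths -/

theorem mem_destutter'_ne {α : Type*} [DecidableEq α] : ∀ (l : List α) (a x : α),
    x ∈ l.destutter' (· ≠ ·) a ↔ x ∈ a :: l
  | [], a, x => by simp
  | b :: l, a, x => by
    rw [List.destutter'_cons]
    split_ifs with h
    · rw [List.mem_cons, mem_destutter'_ne l b x]
      simp
    · rw [mem_destutter'_ne l a x]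
      rw [not_not] at h
      subst h
      simp

theorem mem_destutter_ne {α : Type*} [DecidableEq α] (l : List α) (x : α) :
    x ∈ l.destutter (· ≠ ·) ↔ x ∈ l := by
  cases l with
  | nil => simp
  | cons a l => rw [List.destutter_cons', mem_destutter'_ne]

variable {c : Criterion} {F : Finset W} {ρ : List (Finset W)} {P : List W}

theorem State.Extends.mem_iff (h : s.Extends c ρ P) {R : Finset W} : R ∈ ρ ↔ ∃ v ∈ P, rootOf s.Ω v = R := by
  rw [← h.contracts]
  exact (mem_destutter_ne _ _).trans (by simp)

theorem State.Extends.augmenting (h : s.Extends c ρ P) (hρ : s.IsAugPath c F ρ) :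
    s.Augmenting P := by
  refine ⟨h.nodup, ?_, h.free_ends, fun j u v hu hv =>
    ⟨(h.alternating j u v hu hv).1, (h.alternating j u v hu hv).2.1⟩, h.stretch, h.inside⟩
  obtain ⟨⟨-, -, ⟨R, hR, -⟩, -⟩, he, -⟩ := hρ
  have hc := h.contracts
  match P, hc with
  | [], hc => simp at hc; rw [hc] at hR; simp at hR
  | [v], hc => simp at hc; rw [← hc] at he; simp at he
  | _ :: _ :: _, _ => simp

theorem State.Extends.edge_cases (h : s.Extends c ρ P) (hs : s.Struct) {e : Sym2 W}
    (he : e ∈ pathEdges P) : s.Eligible c e ∨ ∃ B ∈ s.Ω, e ∈ s.EB B := by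
  obtain ⟨j, u, v, hu, hv, rfl⟩ := mem_pathEdges.1 he
  by_cases hr : rootOf s.Ω u = rootOf s.Ω v
  · have hne := nodup_getElem_ne h.nodup hu hv
    obtain ⟨B, hB, huB, hvB⟩ := exists_blossom_of_rootOf_eq hs.nested hr hne
    exact Or.inr ⟨B, hB, h.inside B hB j u v hu hv huB hvB⟩
  · exact Or.inl ((h.alternating j u v hu hv).2.2 hr)

theorem State.Good.eligible_le (hg : s.Good) {e : Sym2 W}
    (h : s.Eligible c e ∨ ∃ B ∈ s.Ω, e ∈ s.EB B) : s.yz e ≤ s.w e := by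
  rcases h with ⟨-, h⟩ | h
  · cases c with
    | tight => exact le_of_eq h
    | near => simp only at h; omega
    | batch =>
      simp only at h
      rcases h with h | h | h
      · exact hg.rcs.near_tightness e (Or.inr h)
      · omega
      · omega
  · exact hg.rcs.near_tightness e (Or.inr h)

theorem Augment.exists {s' : State W} (h : Augment c F s s') : ∃ ρ P, s.IsAugPath c F ρ ∧
    s.Extends c ρ P ∧ s' = s.flip (pathEdges P) := h

theorem Augment.good {s' : State W} (h : Augment c F s s') (hg : s.Good) : s'.Good := by
  obtain ⟨ρ, P, h1, h2, rfl⟩ := h.exists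
  exact (h2.augmenting h1).flip_good hg fun e he _ => hg.eligible_le (h2.edge_cases hg.struct he)

theorem Augment.free_subset {s' : State W} (h : Augment c F s s') {v : W} (hv : s'.Free v) :
    s.Free v := by
  obtain ⟨ρ, P, h1, h2, rfl⟩ := h.exists
  exact ((h2.augmenting h1).flip_free.1 hv).1

theorem Augment.exists_covered {s' : State W} (h : Augment c F s s') :
    ∃ v, s.Free v ∧ ¬ s'.Free v := by
  obtain ⟨ρ, P, h1, h2, rfl⟩ := h.exists
  have hP := h2.augmenting h1
  obtain ⟨g, hg⟩ := hP.exists_get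
  have h0 : 0 < P.length := by have := hP.two_le; omega
  refine ⟨g 0, hP.free_ends _ (Or.inl (by rw [List.head?_eq_getElem?]; exact hg 0 h0)), ?_⟩
  intro hf
  exact (hP.flip_free.1 hf).2 (List.mem_of_getElem? (hg 0 h0))

theorem Augment.tight {s' : State W} (h : Augment .tight F s s') (hg : s.Good) (ht : s.Tight) :
    s'.Tight := by
  obtain ⟨ρ, P, h1, h2, rfl⟩ := h.exists
  refine ⟨ht.dom, ?_⟩
  rintro e (he | he)
  · rcases (h2.augmenting h1).mem_flip.1 he with ⟨h3, -⟩ | ⟨h3, -⟩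
    · exact ht.tight e (Or.inl h3)
    · rcases h2.edge_cases hg.struct h3 with h4 | h4
      · exact h4.2
      · exact ht.tight e (Or.inr h4)
  · exact ht.tight e (Or.inr he)

theorem Augment.eqs {s' : State W} (h : Augment c F s s') : s'.U = s.U ∧ s'.E = s.E ∧ s'.w = s.w ∧
    s'.y = s.y := by
  obtain ⟨ρ, P, h1, h2, rfl⟩ := h.exists
  exact ⟨rfl, rfl, rfl, rfl⟩

end Augmentation

/-! ### A maximal batch augmentation leaves no augmenting path -/

section Maximal
variable {W : Type u} [Fintype W] [DecidableEq W]
variable {s t : State W} {c : Criterion} {F : Finset W} {ρ : List (Finset W)} {P : List W}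

/-- The stretch of `P` in `R` has an odd number of vertices, so the positions of its two boundary
edges differ in parity. The one at an even position is unmatched, and it exists since `P` has an
even number of vertices. -/
theorem State.Augmenting.exists_crossing (hP : s.Augmenting P) {R : Finset W} (hR : s.Part R)
    {x : W} (hx : x ∈ P) (hxR : x ∈ R) :
    ∃ u v, u ∈ R ∧ v ∉ R ∧ s(u, v) ∈ pathEdges P ∧ s(u, v) ∉ s.M := by
  obtain ⟨g, hg⟩ := hP.exists_get
  obtain ⟨i, hi⟩ := List.mem_iff_getElem?.1 hx
  obtain ⟨hiL, -⟩ := List.getElem?_eq_some_iff.1 hi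
  obtain ⟨a, b, hbL, hab, hst⟩ : ∃ a b : ℕ, b ≤ P.length ∧ (a < b → Odd (b - a)) ∧
      ∀ (j : ℕ) (v : W), P[j]? = some v → (v ∈ R ↔ a ≤ j ∧ j < b) := by
    rcases hR with hR | ⟨v, -, rfl⟩
    · exact hP.stretch R hR
    · obtain rfl := mem_singleton.1 hxR
      refine ⟨i, i + 1, hiL, fun _ => by simp, fun j v hj => ?_⟩
      rw [mem_singleton]
      constructor
      · rintro rfl
        have := getElem?_index_eq hP.nodup hi hj
        omega
      · intro h
        have : j = i := by omega
        subst this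
        rw [hi] at hj
        exact (Option.some.inj hj).symm
  have hi' := (hst i x hi).1 hxR
  have hL := hP.even_length
  obtain ⟨k, hk⟩ := hab (by omega)
  obtain ⟨m, hm⟩ := hL
  rcases Nat.even_or_odd a with ⟨p, hp⟩ | ⟨p, hp⟩
  · have e1 := hg (b - 1) (by omega)
    have e2 := hg (b - 1 + 1) (by omega)
    refine ⟨g (b - 1), g (b - 1 + 1), (hst _ _ e1).2 (by omega), fun h => ?_,
      mem_pathEdges.2 ⟨_, _, _, e1, e2, rfl⟩, fun h => ?_⟩
    · have := (hst _ _ e2).1 h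
      omega
    · obtain ⟨q, hq⟩ := (hP.alternating _ _ _ e1 e2).2.1 h
      omega
  · have e1 := hg (a - 1) (by omega)
    have e2 := hg (a - 1 + 1) (by omega)
    refine ⟨g (a - 1 + 1), g (a - 1), (hst _ _ e2).2 (by omega), fun h => ?_,
      mem_pathEdges.2 ⟨_, _, _, e1, e2, Sym2.eq_swap⟩, fun h => ?_⟩
    · have := (hst _ _ e1).1 h
      omega
    · rw [Sym2.eq_swap] at h
      obtain ⟨q, hq⟩ := (hP.alternating _ _ _ e1 e2).2.1 h
      omega

theorem pairwise_disjoint_of_extends {Ψ : List (List (Finset W))} {Ps : List (List W)}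
    (h : List.Forall₂ (s.Extends c) Ψ Ps) (hd : Ψ.Pairwise List.Disjoint) :
    Ps.Pairwise List.Disjoint := by
  induction h with
  | nil => exact List.Pairwise.nil
  | @cons ρ P Ψ Ps h1 h2 ih =>
    rw [List.pairwise_cons] at hd ⊢
    refine ⟨fun Q hQ v hvP hvQ => ?_, ih hd.2⟩
    obtain ⟨i, hi⟩ := List.mem_iff_getElem?.1 hQ
    obtain ⟨hil, -⟩ := List.getElem?_eq_some_iff.1 hi
    have hlen := h2.length_eq
    have hex : s.Extends c Ψ[i] Q := by
      have := List.forall₂_iff_get.1 h2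
      have h3 := this.2 i (by omega) hil
      rw [List.getElem?_eq_getElem hil] at hi
      simp only [List.get_eq_getElem] at h3
      rwa [Option.some.inj hi] at h3
    exact hd.1 _ (List.getElem_mem (by omega)) (h1.mem_iff.2 ⟨v, hvP, rfl⟩)
      (hex.mem_iff.2 ⟨v, hvQ, rfl⟩)

theorem exists_of_forall₂_right {α β : Type*} {r : α → β → Prop} {l : List α} {m : List β}
    (h : List.Forall₂ r l m) {y : β} (hy : y ∈ m) : ∃ x ∈ l, r x y := by
  induction h with
  | nil => simp at hy
  | cons h1 _ ih =>
    rcases List.mem_cons.1 hy with rfl | hy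
    · exact ⟨_, by simp, h1⟩
    · obtain ⟨x, hx, hr⟩ := ih hy
      exact ⟨x, by simp [hx], hr⟩

theorem exists_of_forall₂_left {α β : Type*} {r : α → β → Prop} {l : List α} {m : List β}
    (h : List.Forall₂ r l m) {x : α} (hx : x ∈ l) : ∃ y ∈ m, r x y := by
  induction h with
  | nil => simp at hx
  | cons h1 _ ih =>
    rcases List.mem_cons.1 hx with rfl | hx
    · exact ⟨_, by simp, h1⟩
    · obtain ⟨y, hy, hr⟩ := ih hx
      exact ⟨y, by simp [hy], hr⟩

theorem AugmentMaximal.good (h : AugmentMaximal c F s t) (hg : s.Good) :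
    t.Good ∧ (∀ v, t.Free v → s.Free v) ∧
      (t.U = s.U ∧ t.E = s.E ∧ t.w = s.w ∧ t.y = s.y) := by
  obtain ⟨Ψ, Ps, h1, h2, h3, h4, rfl⟩ := h
  obtain ⟨h5, h6⟩ := hg.flip_all (Ps := Ps)
    (fun P hP => by
      obtain ⟨ρ, hρ, he⟩ := exists_of_forall₂_right h4 hP
      exact he.augmenting (h1 ρ hρ))
    (pairwise_disjoint_of_extends h4 h2)
    (fun P hP e he _ => by
      obtain ⟨ρ, hρ, hex⟩ := exists_of_forall₂_right h4 hP
      exact hg.eligible_le (hex.edge_cases hg.struct he))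
  exact ⟨h5, fun v hv => ((h6 v).1 hv).1, rfl, rfl, rfl, rfl⟩

/-- A path disjoint from all chosen ones would have been augmenting before, against maximality. A
root met by a chosen path now has a matched edge with `yz = w - 2`, which `batch` makes ineligible;
it is not free and its only matched edge is unusable, so no augmenting path contains it. -/
theorem AugmentMaximal.noAug (h : AugmentMaximal .batch F s t) (hg : s.Good) :
    ¬ ∃ ρ, t.IsAugPath .batch F ρ := by
  have ht := (h.good hg).1
  have hfree := (h.good hg).2.1
  have hs := hg.struct
  obtain ⟨Ψ, Ps, h1, h2, h3, h4, rfl⟩ := h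
  set t : State W := { s with M := symmDiff s.M (Ps.toFinset.biUnion pathEdges) } with htdef
  have hts := ht.struct
  have hmemM : ∀ e, e ∈ t.M ↔ e ∈ symmDiff s.M (Ps.toFinset.biUnion pathEdges) := fun e => Iff.rfl
  rintro ⟨ρ, hρ⟩
  have hpath := hρ.1
  obtain ⟨hnd, hnode, ⟨R₀, hR₀, f, hfF, hfR, hff⟩, hedge⟩ := hρ.1
  by_cases hmeet : ∃ ρ' ∈ Ψ, ¬ List.Disjoint ρ ρ'
  · obtain ⟨ρ', hρ', hnd'⟩ := hmeet
    obtain ⟨R, hR, hR'⟩ : ∃ R, R ∈ ρ ∧ R ∈ ρ' := by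
      by_contra hcon
      push Not at hcon
      exact hnd' fun R h h' => hcon R h h'
    obtain ⟨P, hP, hex⟩ := exists_of_forall₂_left h4 hρ'
    have haug := hex.augmenting (h1 ρ' hρ')
    obtain ⟨x, hxP, hx⟩ := hex.mem_iff.1 hR'
    have hRn : s.IsNode R := hnode R hR
    have hxR : x ∈ R := hx ▸ self_mem_rootOf x
    obtain ⟨u, v, hu, hv, he, heM⟩ := haug.exists_crossing (hs.node_part hRn) hxP hxR
    have hnotEB : ¬ ∃ B ∈ s.Ω, s(u, v) ∈ s.EB B := by
      rintro ⟨B, hB, heB⟩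
      have hin := hs.cyclic.inside B hB _ heB
      have := rootOf_eq_of_blossom hs.nested hB (hin u (by simp)) (hin v (by simp))
      apply hv
      rw [hs.node_eq hRn hu, this]
      exact self_mem_rootOf v
    have hyz : s.yz s(u, v) = s.w s(u, v) - 2 := by
      have h5 := (hex.edge_cases hs he).resolve_right hnotEB
      rcases h5.2 with h6 | h6 | h6
      · exact absurd h6 hnotEB
      · exact h6.2
      · exact absurd h6.1 heM
    have heT : s(u, v) ∈ t.M := by
      rw [hmemM, Finset.mem_symmDiff]
      exact Or.inr ⟨mem_biUnion.2 ⟨P, List.mem_toFinset.2 hP, he⟩, heM⟩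
    have hinel : ¬ t.Eligible .batch s(u, v) := by
      rintro ⟨-, h5 | h5 | h5⟩
      · exact hnotEB h5
      · exact h5.1 heT
      · have : s.yz s(u, v) = s.w s(u, v) := h5.2
        omega
    have hpart : t.Part R := hts.node_part (hnode R hR)
    have hnf : ∀ g ∈ R, ¬ t.Free g := fun g hg' =>
      hts.not_free_of_matched hpart heT (hts.not_mem_blossomEdges hv) (by simp) hu hg'
    have hcross : ∀ R' ∈ ρ, R' ≠ R → ∀ a ∈ R, ∀ b ∈ R', t.Eligible .batch s(a, b) →
        s(a, b) ∈ t.M → False := by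
      intro R' hR'm hne a ha b hb hel hab
      have hb' : b ∉ R := fun hbR => hne (hts.node_eq_of_mem (hnode R' hR'm) (hnode R hR) hb hbR)
      have := (hts.matched_unique hpart heT hab (hts.not_mem_blossomEdges hv)
        (hts.not_mem_blossomEdges hb') (Sym2.mem_mk_left _ _) hu (Sym2.mem_mk_left _ _) ha).1
      rw [this] at hinel
      exact hinel hel
    obtain ⟨j, hj⟩ := List.mem_iff_getElem?.1 hR
    obtain ⟨hjL, -⟩ := List.getElem?_eq_some_iff.1 hj
    obtain ⟨-, hev, R₁, hR₁, g, hgR, hgf⟩ := hρ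
    rw [List.head?_eq_getElem?] at hR₀
    rw [List.getLast?_eq_getElem?] at hR₁
    -- At an interior position one of the two path edges at `R` is matched; at either end `R` would
    -- contain a free vertex.
    rcases Nat.even_or_odd j with hje | hjo
    · rcases Nat.eq_zero_or_pos j with rfl | hpos
      · rw [hj] at hR₀
        cases hR₀
        exact hnf f hfR hff
      · obtain ⟨k, rfl⟩ : ∃ k, j = k + 1 := ⟨j - 1, by omega⟩
        have hk : ρ[k]? = some ρ[k] := List.getElem?_eq_getElem (by omega)
        obtain ⟨a, ha, b, hb, hel, hM⟩ := hedge k _ _ hk hj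
        have hne := nodup_getElem_ne hnd hk hj
        rw [Sym2.eq_swap] at hel hM
        refine hcross _ (List.mem_of_getElem? hk) hne b hb a ha hel (hM.2 ?_)
        rwa [Nat.even_add_one, Nat.not_even_iff_odd] at hje
    · rcases Nat.lt_or_ge (j + 1) ρ.length with hlt | hge
      · have hk : ρ[j + 1]? = some ρ[j + 1] := List.getElem?_eq_getElem hlt
        obtain ⟨a, ha, b, hb, hel, hM⟩ := hedge j _ _ hj hk
        have hne := nodup_getElem_ne hnd hj hk
        exact hcross _ (List.mem_of_getElem? hk) hne.symm a ha b hb hel (hM.2 hjo)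
      · have : j = ρ.length - 1 := by omega
        rw [← this, hj] at hR₁
        cases hR₁
        exact hnf g hgR hgf
  · push Not at hmeet
    have haug : s.IsAugPath .batch F ρ := by
      obtain ⟨-, hev, R₁, hR₁, g, hgR, hgf⟩ := hρ
      refine ⟨⟨hnd, hnode, ⟨R₀, hR₀, f, hfF, hfR, hfree f hff⟩, ?_⟩, hev, R₁, hR₁, g, hgR,
        hfree g hgf⟩
      intro j R R' hR hR'
      obtain ⟨u, hu, v, hv, hel, hM⟩ := hedge j R R' hR hR'
      have hRρ := List.mem_of_getElem? hR
      have hMiff : s(u, v) ∈ t.M ↔ s(u, v) ∈ s.M := by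
        have : s(u, v) ∉ Ps.toFinset.biUnion pathEdges := by
          intro h5
          obtain ⟨P, hP, he⟩ := mem_biUnion.1 h5
          obtain ⟨ρ', hρ', hex⟩ := exists_of_forall₂_right h4 (List.mem_toFinset.1 hP)
          refine hmeet ρ' hρ' hRρ (hex.mem_iff.2 ⟨u, mem_of_mem_pathEdges he (by simp), ?_⟩)
          exact (hs.node_eq (hnode R hRρ) hu).symm
        rw [hmemM, Finset.mem_symmDiff]
        tauto
      refine ⟨u, hu, v, hv, ⟨hel.1, ?_⟩, hMiff.symm.trans hM⟩
      rcases hel.2 with h5 | h5 | h5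
      · exact Or.inl h5
      · exact Or.inr (Or.inl ⟨fun h => h5.1 (hMiff.2 h), h5.2⟩)
      · exact Or.inr (Or.inr ⟨hMiff.1 h5.1, h5.2⟩)
    obtain ⟨ρ', hρ', hd⟩ := h3 ρ haug
    exact hd (hmeet ρ' hρ')

end Maximal

/-! ### Expanding contracted paths through nested blossoms -/

section Threads
variable {W : Type u} [Fintype W] [DecidableEq W]
variable {s : State W}

/-- A list of paths through the members of an alternating list of vertex sets can be concatenated
to an alternating path, where `β X` is the vertex of `X` at which matching edges leave `X`. -/
theorem exists_thread {Q : Bool → W → W → Prop} (hQ : ∀ b x y, Q b x y → Q b y x)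
    {Pc : Finset W → List W → Prop} (hrev : ∀ X p, Pc X p → Pc X p.reverse)
    {β : Finset W → W} : ∀ L : List (Finset W), Odd L.length →
    (∀ X ∈ L, ∀ x ∈ X, ∃ p, Pc X p ∧ AltChain Q true p ∧ Odd p.length ∧ p.head? = some x ∧
      p.getLast? = some (β X)) →
    (∀ X ∈ L, ∀ Y ∈ L, X ≠ Y → ∀ u ∈ X, ∀ v ∈ Y, Q true u v → u = β X) → L.Nodup →
    AltChain (fun b X Y => ∃ u ∈ X, ∃ v ∈ Y, Q b u v) true L →
    ∀ X x, L.head? = some X → x ∈ X → ∀ Z, L.getLast? = some Z →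
    ∃ Ps, List.Forall₂ Pc L Ps ∧ AltChain Q true Ps.flatten ∧ Odd Ps.flatten.length ∧
      Ps.flatten.head? = some x ∧ Ps.flatten.getLast? = some (β Z)
  | [], h, _, _, _, _ => by simp at h
  | [A], _, hp, _, _, _ => by
    intro X x hX hx Z hZ
    simp at hX hZ
    subst hX
    subst hZ
    obtain ⟨p, h1, h2, h3, h4, h5⟩ := hp A (by simp) x hx
    exact ⟨[p], by simpa using h1, by simpa using h2, by simpa using h3, by simpa using h4,
      by simpa using h5⟩
  | [_, _], h, _, _, _, _ => absurd h (by simp)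
  -- Sets are handled in pairs: run from `x` to the base of `A`, cross the matched edge to the base
  -- of `B`, run a reversed piece to the vertex `u'`, and leave by an unmatched edge.
  | A :: B :: C :: L, hodd, hp, hb, hnd, hch => by
    intro X x hX hx Z hZ
    simp only [List.head?_cons, Option.some.injEq] at hX
    subst hX
    obtain ⟨⟨u, hu, v, hv, huv⟩, ⟨u', hu', v', hv', huv'⟩, hch'⟩ := hch
    rw [List.nodup_cons, List.nodup_cons] at hnd
    have hAB : A ≠ B := fun h => hnd.1 (by simp [h])
    have hu1 := hb A (by simp) B (by simp) hAB u hu v hv huv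
    have hv1 := hb B (by simp) A (by simp) hAB.symm v hv u hu (hQ _ _ _ huv)
    obtain ⟨p, p1, p2, p3, p4, p5⟩ := hp A (by simp) x hx
    obtain ⟨q, q1, q2, q3, q4, q5⟩ := hp B (by simp) u' hu'
    obtain ⟨Ps, r1, r2, r3, r4, r5⟩ := exists_thread hQ hrev (C :: L)
      (by simpa [Nat.odd_add_one] using hodd)
      (fun X hX => hp X (by simp only [List.mem_cons] at hX ⊢; tauto))
      (fun X hX Y hY => hb X (by simp only [List.mem_cons] at hX ⊢; tauto) Y
        (by simp only [List.mem_cons] at hY ⊢; tauto)) hnd.2.2 (by simpa using hch')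
      C v' (by simp) hv' Z (by simpa using hZ)
    have q2' := altChain_reverse hQ true q q2
    have hq : q ≠ [] := by rintro rfl; simp at q3
    have hp0 : p ≠ [] := by rintro rfl; simp at p3
    have hr0 : Ps.flatten ≠ [] := by intro h; rw [h] at r3; simp at r3
    refine ⟨p :: q.reverse :: Ps, ?_, ?_, ?_, ?_, ?_⟩
    · exact List.Forall₂.cons p1 (List.Forall₂.cons (hrev _ _ q1) r1)
    · rw [List.flatten_cons, List.flatten_cons, altChain_append, altChain_append]
      rw [bodd_of_odd q3] at q2'
      refine ⟨p2, ⟨by simpa [bodd_of_odd p3] using q2', ?_, ?_⟩, ?_⟩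
      · simpa [bodd_of_odd p3, bodd_of_odd q3] using r2
      · intro y z hy hz
        rw [List.getLast?_reverse, q4] at hy
        rw [r4] at hz
        cases hy
        cases hz
        simpa [bodd_of_odd p3, bodd_of_odd q3] using huv'
      · intro y z hy hz
        rw [p5] at hy
        rw [List.head?_append_of_ne_nil _ (by simpa using hq), List.head?_reverse, q5] at hz
        cases hy
        cases hz
        rw [hu1, hv1] at huv
        simpa [bodd_of_odd p3] using huv
    · simp only [List.flatten_cons, List.length_append, List.length_reverse]
      exact p3.add_even (q3.add_odd r3)
    · rw [List.flatten_cons, List.head?_append_of_ne_nil _ hp0, p4]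
    · rw [List.flatten_cons, List.flatten_cons, List.getLast?_append_of_ne_nil _ (by simp [hr0]),
        List.getLast?_append_of_ne_nil _ hr0, r5]

/-- The list meets `D` in a stretch of odd length or not at all, and uses edges of `EB D` there. -/
def State.Stretch (s : State W) (D : Finset W) (p : List W) : Prop :=
  ∃ l m r, p = l ++ m ++ r ∧ (∀ x ∈ l, x ∉ D) ∧ (∀ x ∈ m, x ∈ D) ∧ (∀ x ∈ r, x ∉ D) ∧
    (m = [] ∨ Odd m.length) ∧ AltChain (fun _ u v => s(u, v) ∈ s.EB D) false m

/-- A path inside `R` that passes properly through all blossoms in `R`. -/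
structure State.Piece (s : State W) (R : Finset W) (p : List W) : Prop where
  nonempty : p ≠ []
  nodup : p.Nodup
  subset : ∀ x ∈ p, x ∈ R
  stretch : ∀ D ∈ s.Ω, D ⊆ R → s.Stretch D p

theorem State.Stretch.of_notMem {D : Finset W} {p : List W} (h : ∀ x ∈ p, x ∉ D) :
    s.Stretch D p := ⟨p, [], [], by simp, h, by simp, by simp, Or.inl rfl, by simp⟩

theorem State.Stretch.append {D : Finset W} {p q r : List W} (h : s.Stretch D q)
    (hp : ∀ x ∈ p, x ∉ D) (hr : ∀ x ∈ r, x ∉ D) : s.Stretch D (p ++ q ++ r) := by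
  obtain ⟨l, m, r', rfl, h1, h2, h3, h4, h5⟩ := h
  refine ⟨p ++ l, m, r' ++ r, by simp, ?_, h2, ?_, h4, h5⟩
  · intro x hx
    rcases List.mem_append.1 hx with hx | hx
    · exact hp x hx
    · exact h1 x hx
  · intro x hx
    rcases List.mem_append.1 hx with hx | hx
    · exact h3 x hx
    · exact hr x hx

theorem altChain_const {α : Type*} {r : α → α → Prop} {b b' : Bool} {l : List α}
    (h : AltChain (fun _ => r) b l) : AltChain (fun _ => r) b' l := by
  rw [altChain_iff_getElem] at h ⊢
  exact h

theorem State.Stretch.reverse {D : Finset W} {p : List W} (h : s.Stretch D p) :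
    s.Stretch D p.reverse := by
  obtain ⟨l, m, r, rfl, h1, h2, h3, h4, h5⟩ := h
  refine ⟨r.reverse, m.reverse, l.reverse, by simp, by simpa using h3, by simpa using h2,
    by simpa using h1, by simpa using h4, altChain_const (altChain_reverse ?_ _ _ h5)⟩
  intro _ x y h
  rwa [Sym2.eq_swap]

theorem State.Piece.reverse {R : Finset W} {p : List W} (h : s.Piece R p) :
    s.Piece R p.reverse :=
  ⟨by simpa using h.nonempty, List.nodup_reverse.2 h.nodup, by simpa using h.subset,
    fun D hD hDR => (h.stretch D hD hDR).reverse⟩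

theorem mem_flatten_of_forall₂ {Pc : Finset W → List W → Prop}
    (hPc : ∀ X p, Pc X p → ∀ x ∈ p, x ∈ X) {L : List (Finset W)} {Ps : List (List W)}
    (h : List.Forall₂ Pc L Ps) {x : W} (hx : x ∈ Ps.flatten) : ∃ X ∈ L, x ∈ X := by
  obtain ⟨p, hp, hxp⟩ := List.mem_flatten.1 hx
  obtain ⟨X, hX, hr⟩ := exists_of_forall₂_right h hp
  exact ⟨X, hX, hPc X p hr x hxp⟩

theorem State.Piece.flatten_nodup {L : List (Finset W)} {Ps : List (List W)}
    (h : List.Forall₂ s.Piece L Ps) (hL : L.Pairwise Disjoint) : Ps.flatten.Nodup := by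
  induction h with
  | nil => simp
  | @cons X p L Ps h1 h2 ih =>
    rw [List.pairwise_cons] at hL
    rw [List.flatten_cons, List.nodup_append]
    refine ⟨h1.nodup, ih hL.2, ?_⟩
    rintro x hx y hy rfl
    obtain ⟨Y, hY, hxY⟩ := mem_flatten_of_forall₂ (fun X p h => State.Piece.subset h) h2 hy
    exact Finset.disjoint_left.1 (hL.1 Y hY) (h1.subset x hx) hxY

theorem State.Piece.flatten_stretch {L : List (Finset W)} {Ps : List (List W)}
    (h : List.Forall₂ s.Piece L Ps) (hL : L.Pairwise Disjoint) {D : Finset W} (hD : D ∈ s.Ω)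
    (hDL : ∀ X ∈ L, D ⊆ X ∨ Disjoint D X) : s.Stretch D Ps.flatten := by
  induction h with
  | nil => exact State.Stretch.of_notMem (by simp)
  | @cons X p L Ps h1 h2 ih =>
    rw [List.pairwise_cons] at hL
    rw [List.flatten_cons]
    rcases hDL X (by simp) with hX | hX
    · have := (h1.stretch D hD hX).append (p := []) (r := Ps.flatten) (by simp) (by
        intro x hx hxD
        obtain ⟨Y, hY, hxY⟩ := mem_flatten_of_forall₂ (fun X p h => State.Piece.subset h) h2 hx
        exact Finset.disjoint_left.1 (hL.1 Y hY) (hX hxD) hxY)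
      simpa using this
    · have := (ih hL.2 fun Y hY => hDL Y (by simp [hY])).append (p := p) (r := []) (by
        intro x hx hxD
        exact Finset.disjoint_left.1 hX hxD (h1.subset x hx)) (by simp)
      simpa using this

namespace State.Struct
variable (hs : s.Struct)
include hs

theorem exists_bases [Nonempty W] : ∃ β : Finset W → W, ∀ R, s.Part R → s.IsBase R (β R) := by
  have : ∀ R, ∃ b, s.Part R → s.IsBase R b := by
    intro R
    by_cases h : s.Part R
    · obtain ⟨b, hb⟩ := hs.exists_base h
      exact ⟨b, fun _ => hb⟩
    · exact ⟨Classical.arbitrary W, fun h' => absurd h' h⟩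
  exact Classical.axiomOfChoice this

/-- The two cycle edges at `A 0` have the even indices `0` and `ℓ - 1`, so both are unmatched and
the base of `A 0` stays uncovered in `B`. -/
theorem base_of_cycle {B : Finset W} {ℓ : ℕ} {A : ℕ → Finset W} {a b : ℕ → W} {C : Sym2 W → Prop}
    (hB : B ∈ s.Ω) (hc : s.Cycle C B ℓ A a b) (hM : ∀ i < ℓ, (s(a i, b i) ∈ s.M ↔ Odd i))
    {x y : W} (hx : s.IsBase (A 0) x) (hy : s.IsBase B y) : x = y := by
  by_contra hne
  obtain ⟨e, he, hxe⟩ := hy.2.1 x (hc.subset hc.pos hx.1) hne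
  rw [State.blossomEdges_of_mem hB, mem_inter, hc.mem_edges] at he
  obtain ⟨heM, ⟨i, hi, he⟩ | ⟨i, hi, rfl⟩⟩ := he
  · have h0 := hc.index_eq hi hc.pos (hs.cyclic.blossomEdges_inside he hxe) hx.1
    subst h0
    exact hx.2.2 e (mem_inter.2 ⟨heM, he⟩) hxe
  · have hodd := (hM i hi).1 heM
    rcases Sym2.mem_iff.1 hxe with rfl | rfl
    · have h0 := hc.index_eq hi hc.pos (hc.edge i hi).1 hx.1
      subst h0
      simp at hodd
    · have h0 := hc.index_eq (hc.succ_mod_lt i) hc.pos (hc.b_mem hi) hx.1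
      have h1 : i + 1 = ℓ := by
        by_contra h
        rw [Nat.mod_eq_of_lt (by omega)] at h0
        omega
      have := hc.odd
      rw [← h1, Nat.odd_add_one] at this
      exact this hodd

/-- By induction on the size of the blossom. On the cycle of constituents there is an even
alternating path from `A 0` to the one containing `x`; reversed, it is threaded with pieces through
the constituents, each running to its own base. -/
theorem exists_piece {R : Finset W} (hR : s.Part R) {x y : W} (hx : x ∈ R) (hy : s.IsBase R y) :
    ∃ p, s.Piece R p ∧ AltChain (fun b u v => s(u, v) ∈ s.blossomEdges R ∧
      (s(u, v) ∈ s.M ↔ b = true)) true p ∧ Odd p.length ∧ p.head? = some x ∧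
      p.getLast? = some y := by
  have hsing : ∀ v x y : W, x ∈ ({v} : Finset W) → s.IsBase {v} y →
      ∃ p, s.Piece {v} p ∧ AltChain (fun b u v' => s(u, v') ∈ s.blossomEdges {v} ∧
      (s(u, v') ∈ s.M ↔ b = true)) true p ∧ Odd p.length ∧ p.head? = some x ∧
      p.getLast? = some y := by
    intro v x y hx hy
    obtain rfl := mem_singleton.1 hx
    obtain rfl := mem_singleton.1 hy.1
    refine ⟨[y], ⟨by simp, by simp, by simp, fun D hD hDR => ?_⟩, by simp, by simp, by simp,
      by simp⟩
    have h1 := card_le_card hDR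
    have h2 := hs.cyclic.three_le_card hD
    rw [card_singleton] at h1
    omega
  rcases hR with hR | ⟨v, -, rfl⟩
  swap
  · exact hsing v x y hx hy
  revert x y
  revert R
  suffices H : ∀ n, ∀ R ∈ s.Ω, R.card = n → ∀ {x y : W}, x ∈ R → s.IsBase R y → ∃ p, s.Piece R p ∧
      AltChain (fun b u v => s(u, v) ∈ s.blossomEdges R ∧
      (s(u, v) ∈ s.M ↔ b = true)) true p ∧ Odd p.length ∧ p.head? = some x ∧
      p.getLast? = some y from fun {R} hR {x y} hx hy => H _ R hR rfl hx hy
  intro n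
  induction n using Nat.strong_induction_on with
  | _ n ih =>
  intro B hB hn x y hx hy
  have : Nonempty W := ⟨x⟩
  obtain ⟨β, hβ⟩ := hs.exists_bases
  obtain ⟨ℓ, A, a, b, hc, hM⟩ := State.isBlossom_iff.1 (hs.isBlossom hB)
  have hpart : ∀ i < ℓ, s.Part (A i) := hc.child
  rw [State.blossomEdges_of_mem hB]
  set Q : Bool → W → W → Prop := fun b u v => s(u, v) ∈ s.EB B ∧ (s(u, v) ∈ s.M ↔ b = true)
    with hQdef
  have hQ : ∀ b x y, Q b x y → Q b y x := by
    intro b x y h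
    simp only [hQdef] at h ⊢
    rwa [Sym2.eq_swap (a := y)]
  set r : Bool → Finset W → Finset W → Prop := fun b X Y => ∃ u ∈ X, ∃ v ∈ Y, Q b u v with hrdef
  have hr : ∀ b X Y, r b X Y → r b Y X := by
    rintro b X Y ⟨u, hu, v, hv, h⟩
    exact ⟨v, hv, u, hu, hQ _ _ _ h⟩
  have hedge : ∀ i < ℓ, ∀ c : Bool, (Odd i ↔ c = true) → r c (A i) (A (i + 1)) := fun i hi c hc' =>
    ⟨a i, (hc.edge i hi).1, b i, (hc.edge i hi).2.1,
      hc.mem_edges.2 (Or.inr ⟨i, hi, rfl⟩), (hM i hi).trans hc'⟩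
  set C := (List.range (ℓ - 1)).map fun i => A (i + 1) with hC
  have hlist : A 0 :: C = (List.range ℓ).map A := by
    obtain ⟨k, rfl⟩ : ∃ k, ℓ = k + 1 := ⟨ℓ - 1, by have := hc.pos; omega⟩
    rw [List.range_succ_eq_map]
    simp [hC]
  have hget : ∀ (j : ℕ) (X : Finset W), (A 0 :: C)[j]? = some X → j < ℓ ∧ X = A j := by
    intro j X hX
    rw [hlist, List.getElem?_map] at hX
    rcases Nat.lt_or_ge j ℓ with h | h
    · rw [List.getElem?_range h] at hX
      exact ⟨h, (Option.some.inj hX).symm⟩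
    · rw [List.getElem?_eq_none (by simpa using h)] at hX
      simp at hX
  have hmem : ∀ X ∈ A 0 :: C, ∃ i < ℓ, X = A i := by
    intro X hX
    obtain ⟨j, hj⟩ := List.mem_iff_getElem?.1 hX
    exact ⟨j, hget j X hj⟩
  have hnd : (A 0 :: C).Nodup := by
    rw [hlist, List.nodup_map_iff_inj_on List.nodup_range]
    intro i hi j hj hij
    rw [List.mem_range] at hi hj
    exact hc.index_eq hi hj (hc.edge i hi).1 (hij ▸ (hc.edge i hi).1)
  have hlen : (A 0 :: C).length = ℓ := by rw [hlist]; simp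
  obtain ⟨i, hi, hxi⟩ := hc.mem_iff.1 hx
  obtain ⟨L, hLnd, hLsub, hLch, hLodd, hLh, hLl⟩ := exists_cycle_path hr hnd
    (by
      rw [altChain_iff_getElem]
      intro j X Y hX hY
      obtain ⟨hj, rfl⟩ := hget j X hX
      obtain ⟨hj', rfl⟩ := hget (j + 1) Y hY
      exact hedge j hj _ (by rw [odd_iff_bodd]; simp))
    (by rw [hlen]; exact hc.odd)
    (by
      intro Z hZ
      rw [List.getLast?_eq_getElem?, hlen] at hZ
      obtain ⟨hj, rfl⟩ := hget _ Z hZ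
      have := hedge (ℓ - 1) hj false (by
        obtain ⟨k, hk⟩ := hc.odd
        simp [hk])
      rwa [Nat.sub_add_cancel hc.pos, hc.wrap] at this)
    (x := A i) (by rw [hlist]; exact List.mem_map.2 ⟨i, by simpa using hi, rfl⟩)
  have hLA : ∀ X ∈ L, ∃ i < ℓ, X = A i := fun X hX => hmem X (hLsub X hX)
  have hbase : x ∈ A i := hxi
  obtain ⟨Ps, h1, h2, h3, h4, h5⟩ := exists_thread hQ (Pc := s.Piece)
    (fun X p h => h.reverse) (β := β) L.reverse (by simpa using hLodd)
    (by
      intro X hX x hx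
      obtain ⟨j, hj, rfl⟩ := hLA X (by simpa using hX)
      have hQj : ∀ p, AltChain (fun b u v => s(u, v) ∈ s.blossomEdges (A j) ∧
          (s(u, v) ∈ s.M ↔ b = true)) true p → AltChain Q true p := fun p hp =>
        altChain_mono _ _ (fun b u _ v _ h => ⟨hc.blossomEdges_subset hj h.1, h.2⟩) hp
      rcases hc.child j hj with h | ⟨v, -, hv⟩
      · obtain ⟨p, p1, p2, p3⟩ := ih _ (hn ▸ hc.card_lt hj) (A j) h rfl hx (hβ _ (hpart j hj))
        exact ⟨p, p1, hQj p p2, p3⟩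
      · rw [hv] at hx
        have hb := hβ _ (hpart j hj)
        rw [hv] at hb
        obtain ⟨p, p1, p2, p3⟩ := hsing v _ _ hx hb
        rw [← hv] at p1 p2 p3
        exact ⟨p, p1, hQj p p2, p3⟩)
    (by
      intro X hX Y hY hne u hu v hv huv
      obtain ⟨j, hj, rfl⟩ := hLA X (by simpa using hX)
      obtain ⟨k, hk, rfl⟩ := hLA Y (by simpa using hY)
      have hjk : j ≠ k := fun h => hne (by rw [h])
      refine hs.eq_base (hβ _ (hpart j hj)) (huv.2.2 rfl) (hs.not_mem_blossomEdges ?_)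
        (Sym2.mem_mk_left _ _) hu
      exact fun h => Finset.disjoint_left.1 (hc.disj j hj k hk hjk) h hv)
    (List.nodup_reverse.2 hLnd)
    (by simpa [bodd_of_odd hLodd] using altChain_reverse hr false L hLch)
    (A i) x (by rw [List.head?_reverse, hLl]) hxi (A 0) (by rw [List.getLast?_reverse, hLh])
  have hdisj : L.reverse.Pairwise Disjoint := by
    refine List.Pairwise.imp_of_mem ?_ (List.nodup_reverse.2 hLnd)
    intro X Y hX hY hne
    obtain ⟨j, hj, rfl⟩ := hLA X (by simpa using hX)
    obtain ⟨k, hk, rfl⟩ := hLA Y (by simpa using hY)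
    exact hc.disj j hj k hk fun h => hne (by rw [h])
  have hsub : ∀ v ∈ Ps.flatten, v ∈ B := by
    intro v hv
    obtain ⟨X, hX, hvX⟩ := mem_flatten_of_forall₂ (fun X p h => State.Piece.subset h) h1 hv
    obtain ⟨j, hj, rfl⟩ := hLA X (by simpa using hX)
    exact hc.subset hj hvX
  refine ⟨Ps.flatten, ⟨?_, State.Piece.flatten_nodup h1 hdisj, hsub, ?_⟩, h2, h3, h4, ?_⟩
  · intro h
    rw [h] at h3
    simp at h3
  · intro D hD hDB
    rcases hDB.eq_or_ssubset with rfl | hss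
    · refine ⟨[], Ps.flatten, [], by simp, by simp, hsub, by simp, Or.inr h3, ?_⟩
      rw [altChain_iff_getElem] at h2 ⊢
      exact fun j u v hu hv => (h2 j u v hu hv).1
    · refine State.Piece.flatten_stretch h1 hdisj hD fun X hX => ?_
      obtain ⟨j, hj, rfl⟩ := hLA X (by simpa using hX)
      obtain ⟨k, hk, hDk⟩ := hc.inside D hD hss
      by_cases hjk : j = k
      · subst hjk
        exact Or.inl hDk
      · exact Or.inr ((hc.disj k hk j hj (Ne.symm hjk)).mono_left hDk)
  · rw [h5, hs.base_of_cycle hB hc hM (hβ _ (hpart 0 hc.pos)) hy]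

omit hs in
theorem _root_.MWPM.destutter'_append_const {α : Type*} [DecidableEq α] (a : α) (q : List α) :
    ∀ p : List α, (∀ x ∈ p, x = a) → (p ++ q).destutter' (· ≠ ·) a = q.destutter' (· ≠ ·) a
  | [], _ => rfl
  | x :: p, h => by
    rw [List.cons_append, List.destutter'_cons, if_neg (by simp [h x (by simp)])]
    exact destutter'_append_const a q p fun y hy => h y (by simp [hy])

theorem destutter'_flatten {L : List (Finset W)} {Ps : List (List W)}
    (h : List.Forall₂ s.Piece L Ps) : (∀ X ∈ L, s.IsNode X) → ∀ X₀, (X₀ :: L).Nodup →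
    (Ps.flatten.map (rootOf s.Ω)).destutter' (· ≠ ·) X₀ = X₀ :: L := by
  induction h with
  | nil => simp
  | @cons X p L Ps h1 h2 ih =>
    intro hnode X₀ hnd
    have hp : ∀ x ∈ p, rootOf s.Ω x = X := fun x hx =>
      (hs.node_eq (hnode X (by simp)) (h1.subset x hx)).symm
    obtain _ | ⟨x, p⟩ := p
    · exact absurd rfl h1.nonempty
    rw [List.nodup_cons] at hnd
    rw [List.flatten_cons, List.cons_append, List.map_cons, hp x (by simp), List.destutter'_cons,
      if_pos (fun h => hnd.1 (by simp [h])), List.map_append, destutter'_append_const,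
      ih (fun Y hY => hnode Y (by simp [hY])) X hnd.2]
    simpa using fun y hy => hp y (by simp [hy])

theorem destutter_flatten {L : List (Finset W)} {Ps : List (List W)}
    (h : List.Forall₂ s.Piece L Ps) (hnode : ∀ X ∈ L, s.IsNode X) (hnd : L.Nodup) :
    (Ps.flatten.map (rootOf s.Ω)).destutter (· ≠ ·) = L := by
  cases h with
  | nil => simp
  | @cons X p L Ps h1 h2 =>
    have hp : ∀ x ∈ p, rootOf s.Ω x = X := fun x hx =>
      (hs.node_eq (hnode X (by simp)) (h1.subset x hx)).symm
    obtain _ | ⟨x, p⟩ := p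
    · exact absurd rfl h1.nonempty
    rw [List.flatten_cons, List.cons_append, List.map_cons, hp x (by simp), List.destutter_cons',
      List.map_append, destutter'_append_const,
      hs.destutter'_flatten h2 (fun Y hY => hnode Y (by simp [hY])) X hnd]
    simpa using fun y hy => hp y (by simp [hy])

omit hs in
theorem _root_.MWPM.mem_stretch_cases {α : Type*} {l m r : List α} {j : ℕ} {x : α}
    (h : (l ++ m ++ r)[j]? = some x) : (x ∈ l ∧ j < l.length) ∨
      (m[j - l.length]? = some x ∧ j < l.length + m.length ∧ l.length ≤ j) ∨
      (x ∈ r ∧ l.length + m.length ≤ j) := by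
  rcases Nat.lt_or_ge j l.length with h1 | h1
  · rw [List.append_assoc, List.getElem?_append_left h1] at h
    exact Or.inl ⟨List.mem_of_getElem? h, h1⟩
  rcases Nat.lt_or_ge j (l.length + m.length) with h2 | h2
  · rw [List.getElem?_append_left (by simpa using h2), List.getElem?_append_right h1] at h
    exact Or.inr (Or.inl ⟨h, h2, h1⟩)
  · rw [List.getElem?_append_right (by simpa using h2)] at h
    exact Or.inr (Or.inr ⟨List.mem_of_getElem? h, h2⟩)

/-- Every augmenting path of the shrunken graph extends to an augmenting path of the graph. -/
theorem exists_extends {c : Criterion} {F : Finset W} {ρ : List (Finset W)}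
    (hρ : s.IsAugPath c F ρ) : ∃ P, s.Extends c ρ P := by
  obtain ⟨⟨hnd, hnode, ⟨R, hR, f, -, hfR, hff⟩, hedge⟩, hev, Z, hZ, g, hgZ, hgf⟩ := hρ
  have : Nonempty W := ⟨f⟩
  obtain ⟨β, hβ⟩ := hs.exists_bases
  set Q : Bool → W → W → Prop := fun b u v => s(u, v) ∈ s.E ∧ (s(u, v) ∈ s.M ↔ b = true) ∧
    (rootOf s.Ω u ≠ rootOf s.Ω v → s.Eligible c s(u, v)) with hQdef
  have hQ : ∀ b x y, Q b x y → Q b y x := by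
    intro b x y h
    simp only [hQdef] at h ⊢
    rw [Sym2.eq_swap (a := y)]
    exact ⟨h.1, h.2.1, fun h' => h.2.2 h'.symm⟩
  have hpiece : ∀ X, s.IsNode X → ∀ x ∈ X, ∃ p, s.Piece X p ∧ AltChain Q true p ∧ Odd p.length ∧
      p.head? = some x ∧ p.getLast? = some (β X) := by
    intro X hX x hx
    have hpart := hs.node_part hX
    obtain ⟨p, p1, p2, p3⟩ := hs.exists_piece hpart hx (hβ X hpart)
    refine ⟨p, p1, altChain_mono _ _ (fun b u hu v hv h => ⟨?_, h.2, fun hne => ?_⟩) p2, p3⟩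
    · have h1 := h.1
      unfold State.blossomEdges at h1
      split_ifs at h1 with hXΩ
      · exact hs.cyclic.EB_subset X hXΩ h1
      · simp at h1
    · exact absurd ((hs.node_eq hX (p1.subset u hu)).symm.trans
        (hs.node_eq hX (p1.subset v hv))) hne
  have hdisj : ∀ X, s.IsNode X → ∀ Y, s.IsNode Y → X ≠ Y → Disjoint X Y := by
    intro X hX Y hY hne
    rw [Finset.disjoint_left]
    exact fun v hv hv' => hne (hs.node_eq_of_mem hX hY hv hv')
  have hch : AltChain (fun b X Y => ∃ u ∈ X, ∃ v ∈ Y, Q b u v) false ρ := by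
    rw [altChain_iff_getElem]
    intro j X Y hX hY
    obtain ⟨u, hu, v, hv, hel, hM⟩ := hedge j X Y hX hY
    exact ⟨u, hu, v, hv, hel.1, by rw [hM, odd_iff_bodd]; simp, fun _ => hel⟩
  -- A free vertex is the base of its node, so pieces ending at bases give a path with free ends.
  have hfβ : f = β R := (hβ R (hs.node_part (hnode R (List.mem_of_head? hR)))).eq_of_free hff hfR
  have hgβ : g = β Z :=
    (hβ Z (hs.node_part (hnode Z (List.mem_of_getLast? hZ)))).eq_of_free hgf hgZ
  obtain _ | ⟨R', _ | ⟨X, ρ⟩⟩ := ρ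
  · simp at hR
  · simp at hev
  obtain rfl : R' = R := by simpa using hR
  obtain ⟨⟨u, hu, v, hv, huv⟩, hch'⟩ := hch
  -- The first node is traversed from its base outwards, so its piece is used in reverse; the
  -- remaining nodes form a list that begins with a matched edge.
  obtain ⟨q, q1, q2, q3, q4, q5⟩ := hpiece R' (hnode R' (by simp)) u hu
  have q2' := altChain_reverse hQ true q q2
  rw [bodd_of_odd q3] at q2'
  have hq : q ≠ [] := by rintro rfl; simp at q3
  obtain ⟨Ps, h1, h2, h3, h4, h5⟩ := exists_thread hQ (Pc := s.Piece)
    (fun X p h => h.reverse) (β := β) (X :: ρ) (by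
      rw [List.length_cons] at hev
      exact Nat.not_even_iff_odd.1 (Nat.even_add_one.1 hev))
    (fun Y hY => hpiece Y (hnode Y (List.mem_cons_of_mem _ hY)))
    (by
      intro Y hY Y' hY' hne a ha b hb hab
      have hYn := hnode Y (List.mem_cons_of_mem _ hY)
      refine hs.eq_base (hβ _ (hs.node_part hYn)) (hab.2.1.2 rfl) (hs.not_mem_blossomEdges ?_)
        (Sym2.mem_mk_left _ _) ha
      exact fun h => hne (hs.node_eq_of_mem hYn (hnode Y' (List.mem_cons_of_mem _ hY')) h hb))
    (List.nodup_cons.1 hnd).2 (by simpa using hch') X v (by simp) hv Z (by simpa using hZ)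
  have hr0 : Ps.flatten ≠ [] := by intro h; rw [h] at h3; simp at h3
  have hF : List.Forall₂ s.Piece (R' :: X :: ρ) (q.reverse :: Ps) :=
    List.Forall₂.cons q1.reverse h1
  have hpd : (R' :: X :: ρ).Pairwise Disjoint :=
    List.Pairwise.imp_of_mem (fun hX hY hne => hdisj _ (hnode _ hX) _ (hnode _ hY) hne) hnd
  have hP : AltChain Q false (q.reverse :: Ps).flatten := by
    rw [List.flatten_cons, altChain_append]
    refine ⟨by simpa using q2', by simpa [bodd_of_odd q3] using h2, ?_⟩
    intro y z hy hz
    rw [List.getLast?_reverse, q4] at hy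
    rw [h4] at hz
    cases hy
    cases hz
    simpa [bodd_of_odd q3] using huv
  have hst : ∀ D ∈ s.Ω, s.Stretch D (q.reverse :: Ps).flatten := by
    intro D hD
    refine State.Piece.flatten_stretch hF hpd hD fun Y hY => ?_
    by_cases hmeet : ∃ x ∈ D, x ∈ Y
    · obtain ⟨x, hx, hxY⟩ := hmeet
      left
      rw [hs.node_eq (hnode Y hY) hxY]
      exact subset_rootOf hD hx
    · right
      rw [Finset.disjoint_left]
      exact fun x hx hxY => hmeet ⟨x, hx, hxY⟩
  refine ⟨(q.reverse :: Ps).flatten, State.Piece.flatten_nodup hF hpd, ?_, ?_, ?_, ?_, ?_⟩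
  · exact hs.destutter_flatten hF hnode hnd
  · rw [List.flatten_cons, List.head?_append_of_ne_nil _ (by simpa using hq), List.head?_reverse,
      q5, List.getLast?_append_of_ne_nil _ hr0, h5, ← hfβ, ← hgβ]
    rintro v (hv | hv)
    · exact Option.some.inj hv ▸ hff
    · exact Option.some.inj hv ▸ hgf
  · intro j x y hx hy
    have h := (altChain_iff_getElem _ _).1 hP j x y hx hy
    exact ⟨h.1, by rw [h.2.1, odd_iff_bodd]; simp, h.2.2⟩
  · intro D hD
    obtain ⟨l, m, r, hlmr, hl, hm, hr, hodd, -⟩ := hst D hD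
    rw [hlmr]
    refine ⟨l.length, l.length + m.length, by simp, ?_, ?_⟩
    · intro hlt
      rcases hodd with rfl | hodd
      · simp at hlt
      · simpa using hodd
    · intro j v hj
      rcases mem_stretch_cases hj with ⟨h, hlt⟩ | ⟨h, hlt, hge⟩ | ⟨h, hlt⟩
      · exact iff_of_false (hl v h) (by omega)
      · exact iff_of_true (hm v (List.mem_of_getElem? h)) (by omega)
      · exact iff_of_false (hr v h) (by omega)
  · intro D hD j x y hx hy hxD hyD
    obtain ⟨l, m, r, hlmr, hl, hm, hr, -, hch⟩ := hst D hD
    rw [hlmr] at hx hy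
    rcases mem_stretch_cases hx with ⟨h, hlt⟩ | ⟨h, hlt, hge⟩ | ⟨h, hlt⟩
    · exact absurd hxD (hl x h)
    · rcases mem_stretch_cases hy with ⟨h', hlt'⟩ | ⟨h', hlt', hge'⟩ | ⟨h', hlt'⟩
      · exact absurd hyD (hl y h')
      · refine (altChain_iff_getElem _ _).1 hch (j - l.length) x y h ?_
        rwa [show j - l.length + 1 = j + 1 - l.length by omega]
      · exact absurd hyD (hr y h')
    · exact absurd hxD (hr x h)

theorem exists_augment {c : Criterion} {F : Finset W} {ρ : List (Finset W)}
    (hρ : s.IsAugPath c F ρ) : ∃ s', Augment c F s s' := by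
  obtain ⟨P, hP⟩ := hs.exists_extends hρ
  exact ⟨_, ρ, P, hρ, hP, rfl⟩

/-- Otherwise arbitrarily long lists of disjoint paths would exist, but concatenated they are lists
without repetition in a finite type. -/
theorem exists_augmentMaximal (c : Criterion) (F : Finset W) : ∃ s', AugmentMaximal c F s s' := by
  obtain ⟨Ψ, h1, h2, h3⟩ : ∃ Ψ : List (List (Finset W)), (∀ ρ ∈ Ψ, s.IsAugPath c F ρ) ∧
      Ψ.Pairwise List.Disjoint ∧ ∀ ρ, s.IsAugPath c F ρ → ∃ ρ' ∈ Ψ, ¬ List.Disjoint ρ ρ' := by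
    by_contra hno
    have hall : ∀ n : ℕ, ∃ Ψ : List (List (Finset W)), (∀ ρ ∈ Ψ, s.IsAugPath c F ρ) ∧
        Ψ.Pairwise List.Disjoint ∧ Ψ.length = n := by
      intro n
      induction n with
      | zero => exact ⟨[], by simp⟩
      | succ n ih =>
        obtain ⟨Ψ, h1, h2, h3⟩ := ih
        by_contra hcon
        refine hno ⟨Ψ, h1, h2, fun ρ hρ => ?_⟩
        by_contra hd
        push Not at hd
        refine hcon ⟨ρ :: Ψ, ?_, List.pairwise_cons.2 ⟨hd, h2⟩, by simp [h3]⟩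
        intro ρ' hρ'
        rcases List.mem_cons.1 hρ' with rfl | h
        · exact hρ
        · exact h1 ρ' h
    obtain ⟨Ψ, h1, h2, h3⟩ := hall (Fintype.card (Finset W) + 1)
    have hnd : Ψ.flatten.Nodup := List.nodup_flatten.2 ⟨fun ρ hρ => (h1 ρ hρ).1.1, h2⟩
    have hle := hnd.length_le_card
    have hge : Ψ.length ≤ Ψ.flatten.length := by
      clear h2 h3 hnd hle
      induction Ψ with
      | nil => simp
      | cons ρ Ψ ih =>
        have := ih fun ρ' hρ' => h1 ρ' (by simp [hρ'])
        obtain ⟨⟨-, -, ⟨R, hR, -⟩, -⟩, -⟩ := h1 ρ (by simp)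
        have : 0 < ρ.length := List.length_pos_of_mem (List.mem_of_head? hR)
        simp only [List.length_cons, List.flatten_cons, List.length_append]
        omega
    omega
  have h4 : ∀ Ψ : List (List (Finset W)), (∀ ρ ∈ Ψ, s.IsAugPath c F ρ) →
      ∃ Ps, List.Forall₂ (s.Extends c) Ψ Ps := by
    intro Ψ
    induction Ψ with
    | nil => exact fun _ => ⟨[], List.Forall₂.nil⟩
    | cons ρ Ψ ih =>
      intro h
      obtain ⟨P, hP⟩ := hs.exists_extends (h ρ (by simp))
      obtain ⟨Ps, hPs⟩ := ih fun ρ' hρ' => h ρ' (by simp [hρ'])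
      exact ⟨P :: Ps, List.Forall₂.cons hP hPs⟩
  obtain ⟨Ps, hPs⟩ := h4 Ψ h1
  exact ⟨_, Ψ, Ps, h1, h2, h3, hPs, rfl⟩

end State.Struct

end Threads

/-! ### Near-optimality from relaxed complementary slackness -/

section Bound
variable {W : Type u} [Fintype W] [DecidableEq W]
variable {s : State W}

theorem sum_endSum {M : Finset (Sym2 W)} (hd : ∀ e ∈ M, ¬ e.IsDiag)
    (hM : ∀ e ∈ M, ∀ f ∈ M, ∀ v, v ∈ e → v ∈ f → e = f) (y : W → ℤ) :
    ∑ e ∈ M, endSum y e = ∑ v ∈ M.biUnion fun e => e.toFinset, y v := by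
  rw [sum_biUnion]
  · refine sum_congr rfl fun e he => ?_
    have := hd e he
    induction e with
    | _ u v =>
    rw [Sym2.toFinset_mk_eq, sum_pair (by simpa using this)]
    rfl
  · intro e he f hf hef
    rw [Function.onFun, Finset.disjoint_left]
    intro v hv hv'
    rw [Sym2.mem_toFinset] at hv hv'
    exact hef (hM e he f hf v hv hv')

theorem card_biUnion_toFinset {M : Finset (Sym2 W)} (hd : ∀ e ∈ M, ¬ e.IsDiag)
    (hM : ∀ e ∈ M, ∀ f ∈ M, ∀ v, v ∈ e → v ∈ f → e = f) :
    (M.biUnion fun e => e.toFinset).card = 2 * M.card := by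
  have := sum_endSum hd hM fun _ => 1
  rw [sum_const, sum_congr rfl (g := fun _ => (2 : ℤ)), sum_const] at this
  · simp only [mul_one, nsmul_eq_mul] at this
    omega
  · intro e _
    induction e with
    | _ u v => rfl

open Classical in
theorem sum_yz (M : Finset (Sym2 W)) : ∑ e ∈ M, s.yz e =
    ∑ e ∈ M, endSum s.y e + ∑ B, ((M.filter fun e => ∀ v ∈ e, v ∈ B).card : ℤ) * s.z B := by
  unfold State.yz
  rw [sum_add_distrib]
  congr 1
  simp_rw [sum_filter]
  rw [sum_comm]
  refine sum_congr rfl fun B _ => ?_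
  rw [← sum_filter, sum_const, nsmul_eq_mul]

/-- The matched and the free vertices. -/
theorem State.Struct.biUnion_matching (hs : s.Struct) :
    s.M.biUnion (fun e => e.toFinset) ∪ s.freeSet = s.U ∧
      Disjoint (s.M.biUnion fun e => e.toFinset) s.freeSet := by
  constructor
  · ext v
    simp only [mem_union, mem_biUnion, Sym2.mem_toFinset, State.freeSet, mem_filter, mem_univ,
      true_and]
    constructor
    · rintro (⟨e, he, hv⟩ | h)
      · exact hs.ends e (hs.matching.1 he) v hv
      · exact h.1
    · intro h
      by_cases hc : ∃ e ∈ s.M, v ∈ e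
      · exact Or.inl hc
      · exact Or.inr ⟨h, fun e he hv => hc ⟨e, he, hv⟩⟩
  · rw [Finset.disjoint_left]
    intro v hv hv'
    simp only [mem_biUnion, Sym2.mem_toFinset, State.freeSet, mem_filter, mem_univ,
      true_and] at hv hv'
    obtain ⟨e, he, hve⟩ := hv
    exact hv'.2 e he hve

theorem State.Struct.biUnion_perfect (hs : s.Struct) {M' : Finset (Sym2 W)}
    (hM' : IsPerfectMatching s.U s.E M') : M'.biUnion (fun e => e.toFinset) = s.U := by
  ext v
  simp only [mem_biUnion, Sym2.mem_toFinset]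
  constructor
  · rintro ⟨e, he, hv⟩
    exact hs.ends e (hM'.1.1 he) v hv
  · exact hM'.2 v

theorem State.Struct.card_perfect (hs : s.Struct) {M' : Finset (Sym2 W)}
    (hM' : IsPerfectMatching s.U s.E M') : 2 * M'.card = s.U.card := by
  rw [← hs.biUnion_perfect hM',
    card_biUnion_toFinset (fun e he => hs.noloop e (hM'.1.1 he)) hM'.1.2]

/-- Near-optimality from relaxed complementary slackness. -/
theorem State.Good.weight_le (hg : s.Good) {M' : Finset (Sym2 W)}
    (hM' : IsPerfectMatching s.U s.E M') :
    ∑ e ∈ M', s.w e ≤ ∑ e ∈ s.M, s.w e + ∑ v ∈ s.freeSet, s.y v + s.U.card := by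
  classical
  have hs := hg.struct
  have h1 : ∑ e ∈ M', s.w e ≤ ∑ e ∈ M', (s.yz e + 2) := sum_le_sum fun e he => by
    have := hg.rcs.near_domination e (hM'.1.1 he)
    omega
  have h2 : ∑ e ∈ s.M, s.yz e ≤ ∑ e ∈ s.M, s.w e := sum_le_sum fun e he =>
    hg.rcs.near_tightness e (Or.inl he)
  -- Every matching has at most `B.card / 2` edges inside `B`, and `M` attains this for active
  -- blossoms; inactive sets have dual zero.
  have h3 : ∑ B, ((M'.filter fun e => ∀ v ∈ e, v ∈ B).card : ℤ) * s.z B ≤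
      ∑ B, ((s.M.filter fun e => ∀ v ∈ e, v ∈ B).card : ℤ) * s.z B := by
    refine sum_le_sum fun B _ => ?_
    by_cases hB : B ∈ s.Ω
    · refine mul_le_mul_of_nonneg_right ?_ (hg.rcs.granularity B).1
      have h4 : (s.M ∩ s.EB B).card ≤ (s.M.filter fun e => ∀ v ∈ e, v ∈ B).card := by
        refine card_le_card fun e he => ?_
        rw [mem_inter] at he
        exact mem_filter.2 ⟨he.1, fun v hv => hs.cyclic.inside B hB e he.2 v hv⟩
      rw [hs.active B hB] at h4
      have h5 : 2 * (M'.filter fun e => ∀ v ∈ e, v ∈ B).card ≤ B.card := by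
        rw [← card_biUnion_toFinset
          (fun e he => hs.noloop e (hM'.1.1 (mem_filter.1 he).1))
          (fun e he f hf => hM'.1.2 e (mem_filter.1 he).1 f (mem_filter.1 hf).1)]
        refine card_le_card fun v hv => ?_
        simp only [mem_biUnion, Sym2.mem_toFinset] at hv
        obtain ⟨e, he, hve⟩ := hv
        exact (mem_filter.1 he).2 v hve
      exact_mod_cast (by omega : (M'.filter fun e => ∀ v ∈ e, v ∈ B).card ≤
        (s.M.filter fun e => ∀ v ∈ e, v ∈ B).card)
    · rw [hg.rcs.inactive B hB, mul_zero, mul_zero]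
  rw [sum_add_distrib, sum_yz, sum_endSum (fun e he => hs.noloop e (hM'.1.1 he)) hM'.1.2,
    hs.biUnion_perfect hM', ← hs.biUnion_matching.1, sum_union hs.biUnion_matching.2] at h1
  rw [sum_yz, sum_endSum (fun e he => hs.not_diag he) hs.matching.2] at h2
  have h6 : ∑ e ∈ M', (2 : ℤ) = s.U.card := by
    rw [sum_const, ← hs.card_perfect hM']
    simp [mul_comm]
  linarith

end Bound

section Transitions

/-! ### Beginning of a scale: doubling, liquidation and reweighting -/

section Scale
variable {W : Type u} [Fintype W] [DecidableEq W]
variable {s : State W}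

theorem State.yz_congr {t : State W} (hz : t.z = s.z) {e : Sym2 W} (hy : ∀ v ∈ e, t.y v = s.y v) :
    t.yz e = s.yz e := by
  unfold State.yz
  rw [hz]
  congr 1
  induction e with
  | _ u v =>
  rw [endSum_mk, endSum_mk, hy u (by simp), hy v (by simp)]

/-- The duals with which the old vertices enter the reweighting. -/
def scaledDual (τ : ℕ) (s : State W) (v : W) : ℤ :=
  2 * s.y v + 3 + ∑ B ∈ s.Ω with τ ≤ B.card ∧ v ∈ B, s.z B

theorem startScale_y (τ : ℕ) (bit : Sym2 W → ℤ) (v : W) :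
    (startScale τ bit s).y v = ∑ B ∈ s.Ω with B.card < τ ∧ v ∈ B, s.z B := by
  simp only [startScale, liquidate, reweight, zero_add, filter_filter]
  refine sum_congr rfl fun B hB => ?_
  rw [mem_filter] at hB
  rw [if_neg (by simp; omega)]
  omega

theorem startScale_w (τ : ℕ) (bit : Sym2 W → ℤ) (u v : W) : (startScale τ bit s).w s(u, v) =
    2 * (s.w s(u, v) + bit s(u, v)) - (scaledDual τ s u + scaledDual τ s v) := by
  have h : ∀ B, 2 * s.z B / 2 = s.z B := fun B => by omega
  simp only [startScale, liquidate, reweight, filter_filter, scaledDual, endSum_mk, h]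

theorem startScale_z (τ : ℕ) (bit : Sym2 W → ℤ) (hz : ∀ B, B ∉ s.Ω → s.z B = 0) (B : Finset W) :
    (startScale τ bit s).z B = 0 := by
  simp only [startScale, liquidate, reweight, mem_filter]
  by_cases hB : B ∈ s.Ω
  · rcases Nat.lt_or_ge B.card τ with h | h
    · simp [hB, h]
    · simp [hB, h]
  · simp [hB, hz B hB]

theorem startScale_yz (τ : ℕ) (bit : Sym2 W → ℤ) (hz : ∀ B, B ∉ s.Ω → s.z B = 0) (u v : W) :
    (startScale τ bit s).yz s(u, v) = ∑ B ∈ s.Ω with B.card < τ ∧ u ∈ B, s.z B +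
      ∑ B ∈ s.Ω with B.card < τ ∧ v ∈ B, s.z B := by
  have h : ∑ B ∈ univ.filter (fun B : Finset W => u ∈ B ∧ v ∈ B), (startScale τ bit s).z B = 0 :=
    sum_eq_zero fun B _ => startScale_z τ bit hz B
  rw [State.yz_mk, startScale_y, startScale_y, h, add_zero]

/-- Doubling `w - 2 ≤ yz` and adding a bit costs at most 6 per edge, which the two added constants 3
pay for. Liquidation gives half of the doubled dual to each vertex of the blossom, so `yz` is kept
inside it and can only grow elsewhere. -/
theorem startScale_domination (τ : ℕ) {bit : Sym2 W → ℤ} (hg : s.Good) {u v : W}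
    (he : s(u, v) ∈ s.E) (hbit : bit s(u, v) ≤ 1) :
    (startScale τ bit s).w s(u, v) ≤ (startScale τ bit s).yz s(u, v) := by
  rw [startScale_yz τ bit hg.rcs.inactive, startScale_w]
  have h1 := hg.rcs.near_domination _ he
  rw [State.yz_mk] at h1
  have hsplit : ∀ v, ∑ B ∈ s.Ω with τ ≤ B.card ∧ v ∈ B, s.z B +
      ∑ B ∈ s.Ω with B.card < τ ∧ v ∈ B, s.z B = ∑ B ∈ univ with v ∈ B, s.z B := by
    intro v
    have h2 : ∑ B ∈ univ with v ∈ B, s.z B = ∑ B ∈ s.Ω with v ∈ B, s.z B := by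
      symm
      refine sum_subset (fun B hB => by simpa using (mem_filter.1 hB).2) fun B hB hB' => ?_
      refine hg.rcs.inactive B fun h => hB' ?_
      exact mem_filter.2 ⟨h, (mem_filter.1 hB).2⟩
    rw [h2, ← sum_filter_add_sum_filter_not (s.Ω.filter fun B => v ∈ B) fun B => τ ≤ B.card,
      filter_filter, filter_filter]
    congr 1
    · exact sum_congr (by ext; simp; tauto) fun _ _ => rfl
    · exact sum_congr (by ext; simp; tauto) fun _ _ => rfl
  have hle : ∀ x, (∀ B : Finset W, u ∈ B ∧ v ∈ B → x ∈ B) →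
      ∑ B ∈ univ with u ∈ B ∧ v ∈ B, s.z B ≤ ∑ B ∈ univ with x ∈ B, s.z B := by
    intro x hx
    refine sum_le_sum_of_subset_of_nonneg (fun B hB => ?_) fun B _ _ => (hg.rcs.granularity B).1
    exact mem_filter.2 ⟨mem_univ _, hx B (mem_filter.1 hB).2⟩
  have hu := hle u fun B h => h.1
  have hv := hle v fun B h => h.2
  have := hsplit u
  have := hsplit v
  unfold scaledDual
  linarith

theorem startScale_even (τ : ℕ) (bit : Sym2 W → ℤ) (hg : s.Good) (u v : W) :
    Even ((startScale τ bit s).w s(u, v)) := by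
  rw [startScale_w]
  have h : ∀ v, Even (∑ B ∈ s.Ω with τ ≤ B.card ∧ v ∈ B, s.z B) := fun v =>
    even_sum _ fun B _ => (hg.rcs.granularity B).2
  obtain ⟨a, ha⟩ := h u
  obtain ⟨b, hb⟩ := h v
  unfold scaledDual
  rw [ha, hb]
  exact ⟨s.w s(u, v) + bit s(u, v) - s.y u - s.y v - 3 - a - b, by ring⟩

/-- The matching and the blossoms have been discarded, so all conditions except evenness and
domination are vacuous or trivial; domination even holds without the slack 2. -/
theorem State.Good.startScale (τ : ℕ) {bit : Sym2 W → ℤ} (hg : s.Good) (hbit : ∀ e, bit e ≤ 1) :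
    (startScale τ bit s).Good ∧ (startScale τ bit s).Tight := by
  have hdom : ∀ e ∈ s.E, (MWPM.startScale τ bit s).w e ≤ (MWPM.startScale τ bit s).yz e := by
    intro e he
    induction e with
    | _ u v => exact startScale_domination τ hg he (hbit _)
  have hM : (MWPM.startScale τ bit s).M = ∅ := rfl
  have hΩ : (MWPM.startScale τ bit s).Ω = ∅ := rfl
  refine ⟨⟨⟨?_, ?_, ?_, ?_, ?_, ?_, ?_, ?_, ?_, ?_⟩, hg.noloop, hg.ends, ?_⟩, hdom, ?_⟩
  · intro e he
    induction e with
    | _ u v => exact startScale_even τ bit hg u v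
  · rw [hM]
    exact ⟨empty_subset _, by simp⟩
  · rw [hΩ]
    intro A hA
    simp at hA
  · rw [hΩ]
    simp
  · intro B
    rw [startScale_z τ bit hg.rcs.inactive]
    simp
  · rw [hΩ]
    simp
  · intro B hB
    have := hB.1
    rw [hΩ] at this
    simp at this
  · exact fun B _ => startScale_z τ bit hg.rcs.inactive B
  · intro e he
    have := hdom e he
    omega
  · intro e he
    rw [hM, hΩ] at he
    simp at he
  · rw [hΩ]
    simp
  · intro e he
    rw [hM, hΩ] at he
    simp at he

theorem exists_maximalSmall {τ : ℕ} {Ω : Finset (Finset W)} {B : Finset W} (hB : B ∈ Ω)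
    (hτ : B.card < τ) : ∃ C ∈ maximalSmall τ Ω, B ⊆ C := by
  obtain ⟨C, hC, hmax⟩ := exists_max_image (Ω.filter fun C => C.card < τ ∧ B ⊆ C) Finset.card
    ⟨B, by simp [hB, hτ]⟩
  simp only [mem_filter] at hC hmax
  refine ⟨C, mem_filter.2 ⟨hC.1, hC.2.1, fun D hD hDτ hCD => ?_⟩, hC.2.2⟩
  exact (eq_of_subset_of_card_le hCD (hmax D ⟨hD, hDτ, hC.2.2.trans hCD⟩)).symm

theorem startScale_y_nonneg (τ : ℕ) (bit : Sym2 W → ℤ) (hg : s.Good) (v : W) :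
    0 ≤ (startScale τ bit s).y v := by
  rw [startScale_y]
  exact sum_nonneg fun B _ => (hg.rcs.granularity B).1

theorem exists_of_startScale_y_ne {τ : ℕ} {bit : Sym2 W → ℤ} {v : W}
    (h : (startScale τ bit s).y v ≠ 0) : ∃ B ∈ maximalSmall τ s.Ω, v ∈ B := by
  rw [startScale_y] at h
  obtain ⟨B, hB, -⟩ := exists_ne_zero_of_sum_ne_zero h
  simp only [mem_filter] at hB
  obtain ⟨C, hC, hBC⟩ := exists_maximalSmall hB.1 hB.2.1
  exact ⟨C, hC, hBC hB.2.2⟩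

end Scale

/-! ### The supplemented graph and its weights -/

section Dummies
variable {V : Type u} [Fintype V] [DecidableEq V]

/-- The current graph is the input graph with dummy vertices attached to some vertices, and after
`i` scales the edge weights are, up to vertex terms, twice the leading bits of the extended
weights. -/
structure GraphInv (G : SimpleGraph V) [DecidableRel G.Adj] (c : Sym2 V → ℕ) (N i : ℕ)
    (s : State (V ⊕ V)) : Prop where
  vertices : ∀ u, Sum.inl u ∈ s.U
  edges : ∀ e ∈ s.E, (∃ e' ∈ G.edgeFinset, e = e'.map Sum.inl) ∨ ∃ u, e = s(Sum.inl u, Sum.inr u)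
  mem : ∀ e ∈ G.edgeFinset, e.map Sum.inl ∈ s.E
  weight : ∃ π : V → ℤ, ∀ u v, G.Adj u v → s.w s(Sum.inl u, Sum.inl v) =
    2 * (extWeight c s(u, v) / 2 ^ (numScales V N - i) : ℕ) - π u - π v

variable {G : SimpleGraph V} [DecidableRel G.Adj] {c : Sym2 V → ℕ} {N τ i : ℕ}
  {s t : State (V ⊕ V)}

theorem GraphInv.congr (h : GraphInv G c N i s) (hU : t.U = s.U) (hE : t.E = s.E)
    (hw : t.w = s.w) : GraphInv G c N i t :=
  ⟨hU ▸ h.vertices, hE ▸ h.edges, hE ▸ h.mem, hw ▸ h.weight⟩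

theorem GraphInv.edge_inr (h : GraphInv G c N i s) {x : V ⊕ V} {u : V}
    (he : s(x, Sum.inr u) ∈ s.E) : x = Sum.inl u := by
  rcases h.edges _ he with ⟨e', -, he'⟩ | ⟨v, hv⟩
  · have : Sum.inr u ∈ e'.map Sum.inl := he' ▸ Sym2.mem_mk_right _ _
    rw [Sym2.mem_map] at this
    simp at this
  · rw [Sym2.eq_iff] at hv
    rcases hv with ⟨h1, h2⟩ | ⟨-, h2⟩
    · cases h2
      exact h1
    · simp at h2

theorem GraphInv.edge_of_inr_mem (h : GraphInv G c N i s) {e : Sym2 (V ⊕ V)} {u : V}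
    (he : e ∈ s.E) (hu : Sum.inr u ∈ e) : e = s(Sum.inl u, Sum.inr u) := by
  obtain ⟨x, rfl⟩ := Sym2.mem_iff_exists.1 hu
  rw [Sym2.eq_swap] at he ⊢
  rw [h.edge_inr he]

/-- A dummy has a single incident edge. As a constituent of a blossom it would lie on two distinct
consecutive cycle edges. Hence dummies can be added and deleted without touching blossoms. -/
theorem GraphInv.isLeft (h : GraphInv G c N i s) (hs : s.Struct) : ∀ B ∈ s.Ω, ∀ v ∈ B,
    v.isLeft = true := by
  refine hs.cyclic.blossom_induction ?_
  rintro B ℓ A a b hB hc ih (u | u) hv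
  · rfl
  exfalso
  obtain ⟨i, hi, hvi⟩ := hc.mem_iff.1 hv
  rcases hc.child i hi with hA | ⟨v, -, hA⟩
  · exact absurd (ih i hi hA _ hvi) (by simp)
  have hAu : A i = {Sum.inr u} := by
    rw [hA] at hvi ⊢
    rw [mem_singleton.1 hvi]
  have hai : a i = Sum.inr u := by simpa [hAu] using (hc.edge i hi).1
  have h1 := (hc.edge i hi).2.2
  rw [hai] at h1
  have hei := h.edge_of_inr_mem h1 (Sym2.mem_mk_left _ _)
  obtain ⟨j, hj, hji⟩ : ∃ j < ℓ, (j + 1) % ℓ = i := by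
    rcases Nat.eq_zero_or_pos i with rfl | hpos
    · exact ⟨ℓ - 1, by omega, by rw [Nat.sub_add_cancel hc.pos, Nat.mod_self]⟩
    · exact ⟨i - 1, by omega, by rw [Nat.sub_add_cancel hpos, Nat.mod_eq_of_lt hi]⟩
  have hbj : b j = Sum.inr u := by simpa [hji, hAu] using hc.b_mem hj
  have h2 := (hc.edge j hj).2.2
  rw [hbj] at h2
  have hej := h.edge_of_inr_mem h2 (Sym2.mem_mk_right _ _)
  have : j = i := hc.edge_inj hj hi (by rw [hai, hbj, hei, hej])
  exact hc.succ_mod_ne hi (this ▸ hji)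

/-- Changes of the graph that only affect dummy vertices. -/
theorem State.Good.of_agree (hg : s.Good) (hl : ∀ B ∈ s.Ω, ∀ v ∈ B, v.isLeft = true)
    (hΩ : t.Ω = s.Ω) (hEB : t.EB = s.EB) (hz : t.z = s.z)
    (hU : ∀ v ∈ s.U, v.isLeft = true → v ∈ t.U)
    (hE : ∀ e ∈ s.E, (∀ v ∈ e, v.isLeft = true) → e ∈ t.E)
    (hM : ∀ e, (∀ v ∈ e, v.isLeft = true) → (e ∈ t.M ↔ e ∈ s.M))
    (hy : ∀ v, v.isLeft = true → t.y v = s.y v)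
    (hw : ∀ e, (∀ v ∈ e, v.isLeft = true) → t.w e = s.w e)
    (noloop : ∀ e ∈ t.E, ¬ e.IsDiag) (ends : ∀ e ∈ t.E, ∀ v ∈ e, v ∈ t.U)
    (matching : IsMatching t.E t.M)
    (hlocal : ∀ e ∈ t.E, Even (t.w e) ∧ t.w e - 2 ≤ t.yz e ∧ (e ∈ t.M → t.yz e ≤ t.w e)) :
    t.Good := by
  have hs := hg.struct
  have hlE : ∀ B ∈ s.Ω, ∀ e ∈ s.EB B, ∀ v ∈ e, v.isLeft = true := fun B hB e he v hv =>
    hl B hB v (hs.cyclic.inside B hB e he v hv)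
  have hst : t.Struct := by
    refine ⟨noloop, ends, matching, hΩ ▸ hs.nested, ?_, ?_⟩
    · intro B hB
      rw [hΩ] at hB
      obtain ⟨ℓ, A, a, b, hc⟩ := hs.cycles B hB
      have hbe : t.blossomEdges = s.blossomEdges := by
        funext X
        unfold State.blossomEdges
        rw [hΩ, hEB]
      refine ⟨ℓ, A, a, b, hc.odd, hc.three, hc.wrap, hc.disj, ?_, ?_, hc.union, ?_, ?_⟩
      · intro i hi
        rw [hΩ]
        rcases hc.child i hi with h | ⟨v, hv, hA⟩
        · exact Or.inl h
        · exact Or.inr ⟨v, hU v hv (hl B hB v (hc.subset hi (by simp [hA]))), hA⟩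
      · intro i hi
        obtain ⟨h1, h2, h3⟩ := hc.edge i hi
        refine ⟨h1, h2, hE _ h3 fun v hv => ?_⟩
        exact hlE B hB _ (hc.mem_edges.2 (Or.inr ⟨i, hi, rfl⟩)) v hv
      · rw [hbe, hEB]
        exact hc.edges
      · rw [hΩ]
        exact hc.inside
    · intro B hB
      rw [hΩ] at hB
      rw [hEB, ← hs.active B hB]
      congr 1
      ext e
      rw [mem_inter, mem_inter]
      exact and_congr_left fun he => hM e (hlE B hB e he)
  refine ⟨⟨fun e he => (hlocal e he).1, matching, hst.nested, fun B hB => hst.isBlossom hB,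
    hz ▸ hg.rcs.granularity, hst.active, ?_, ?_, fun e he => (hlocal e he).2.1, ?_⟩, noloop, ends,
    ?_⟩
  · intro B hB
    rw [hz]
    refine hg.rcs.root_pos B ?_
    unfold State.IsRoot at hB ⊢
    rwa [hΩ] at hB
  · rw [hz, hΩ]
    exact hg.rcs.inactive
  · rintro e (he | ⟨B, hB, he⟩)
    · exact (hlocal e (matching.1 he)).2.2 he
    · rw [hΩ] at hB
      rw [hEB] at he
      have hv := hlE B hB e he
      rw [hw e hv, State.yz_congr hz fun v hve => hy v (hv v hve)]
      exact hg.rcs.near_tightness e (Or.inr ⟨B, hB, he⟩)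
  · intro B hB u hu v hv
    rw [hΩ] at hB
    rw [hy u (hl B hB u hu), hy v (hl B hB v hv)]
    exact hg.parity B hB u hu v hv

theorem initialState_good : (initialState G).Good := by
  have hyz : ∀ e, (initialState G).yz e = 0 := by
    intro e
    induction e with
    | _ u v =>
    rw [State.yz_mk]
    simp [initialState]
  have hE : ∀ e ∈ (initialState G).E, ∃ e' ∈ G.edgeFinset, e'.map Sum.inl = e := fun e he =>
    mem_image.1 he
  refine ⟨⟨?_, ?_, ?_, ?_, ?_, ?_, ?_, ?_, ?_, ?_⟩, ?_, ?_, ?_⟩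
  · exact fun e _ => ⟨0, rfl⟩
  · exact ⟨empty_subset _, by simp [initialState]⟩
  · intro A hA
    simp [initialState] at hA
  · simp [initialState]
  · simp [initialState]
  · simp [initialState]
  · intro B hB
    simpa [initialState] using hB.1
  · exact fun _ _ => rfl
  · intro e _
    rw [hyz]
    simp [initialState]
  · simp [initialState]
  · intro e he
    obtain ⟨e', he', rfl⟩ := hE e he
    induction e' with
    | _ u v => simpa using (G.mem_edgeFinset.1 he' : G.Adj u v).ne
  · intro e he v hv
    obtain ⟨e', he', rfl⟩ := hE e he
    obtain ⟨u, -, rfl⟩ := Sym2.mem_map.1 hv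
    exact mem_image_of_mem _ (mem_univ u)
  · simp [initialState]

theorem extWeight_lt (hN : ∀ e ∈ G.edgeSet, c e ≤ N) {e : Sym2 V} (he : e ∈ G.edgeSet) :
    extWeight c e < 2 ^ numScales V N := by
  have h := Nat.le_pow_clog (b := 2) (by norm_num) ((Fintype.card V / 2 + 1) * N + 1)
  have h2 : extWeight c e ≤ (Fintype.card V / 2 + 1) * N := Nat.mul_le_mul_left _ (hN e he)
  unfold numScales
  omega

/-- The extended weights fit into `numScales V N` bits, so the quotient is zero before any bit has
been read. -/
theorem initialState_graphInv (hN : ∀ e ∈ G.edgeSet, c e ≤ N) :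
    GraphInv G c N 0 (initialState G) := by
  refine ⟨fun u => mem_image_of_mem _ (mem_univ u), fun e he => Or.inl ?_,
    fun e he => mem_image_of_mem _ he, 0, fun u v huv => ?_⟩
  · obtain ⟨e', he', rfl⟩ := mem_image.1 he
    exact ⟨e', he', rfl⟩
  · rw [Nat.sub_zero, Nat.div_eq_of_lt (extWeight_lt hN huv)]
    simp [initialState]

theorem weightBit_le (e : Sym2 (V ⊕ V)) : weightBit c N i e ≤ 1 := by
  unfold weightBit
  split_ifs <;> norm_num

/-- Doubling and appending a bit turns the leading `i` bits into the leading `i + 1` bits; the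
reweighting only adds vertex terms, which are collected in the new `π`. -/
theorem GraphInv.startScale (h : GraphInv G c N i s) (hi : i < numScales V N) :
    GraphInv G c N (i + 1) (startScale τ (weightBit c N (i + 1)) s) := by
  refine ⟨h.vertices, h.edges, h.mem, ?_⟩
  obtain ⟨π, hπ⟩ := h.weight
  refine ⟨fun u => 2 * π u + scaledDual τ s (.inl u), fun u v huv => ?_⟩
  rw [startScale_w, hπ u v huv]
  have hlift : liftWeight (extWeight c) s(Sum.inl u, Sum.inl v) = extWeight c s(u, v) := rfl
  have hbit : weightBit c N (i + 1) s(Sum.inl u, Sum.inl v) =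
      ((extWeight c s(u, v) / 2 ^ (numScales V N - (i + 1)) % 2 : ℕ) : ℤ) := by
    unfold weightBit
    rw [hlift, Nat.testBit_eq_decide_div_mod_eq]
    rcases Nat.mod_two_eq_zero_or_one (extWeight c s(u, v) / 2 ^ (numScales V N - (i + 1)))
      with h | h <;> simp [h]
  have hdiv : extWeight c s(u, v) / 2 ^ (numScales V N - i) =
      extWeight c s(u, v) / 2 ^ (numScales V N - (i + 1)) / 2 := by
    rw [Nat.div_div_eq_div_mul, ← pow_succ]
    congr 2
    omega
  rw [hbit, hdiv]
  generalize extWeight c s(u, v) / 2 ^ (numScales V N - (i + 1)) = q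
  have := Nat.div_add_mod q 2
  push_cast
  have : (q : ℤ) = 2 * (q / 2 : ℤ) + (q : ℤ) % 2 := by omega
  linarith

/-! ### Adding and deleting dummy vertices -/

section Perfection

theorem mem_freeSet {W : Type u} [Fintype W] {s : State W} {v : W} :
    v ∈ s.freeSet ↔ s.Free v := by
  unfold State.freeSet
  simp

theorem perfection_U {v : V ⊕ V} : v ∈ (perfection τ s).U ↔
    (v ∈ s.U ∧ ¬ (s.Free v ∧ v.isRight = true)) ∨ ∃ u, s.Free (.inl u) ∧ v = .inr u := by
  simp only [perfection, mem_union, mem_sdiff, mem_filter, mem_image, mem_freeSet, mem_univ,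
    true_and, eq_comm]

theorem perfection_E {e : Sym2 (V ⊕ V)} : e ∈ (perfection τ s).E ↔
    (e ∈ s.E ∧ ∀ v ∈ e, ¬ (s.Free v ∧ v.isRight = true)) ∨
      ∃ u, s.Free (.inl u) ∧ e = s(.inl u, .inr u) := by
  simp only [perfection, mem_union, mem_filter, mem_image, mem_freeSet, mem_univ,
    true_and, eq_comm]

theorem perfection_M {e : Sym2 (V ⊕ V)} : e ∈ (perfection τ s).M ↔
    e ∈ s.M ∨ ∃ u, s.Free (.inl u) ∧ e = s(.inl u, .inr u) := by
  simp only [perfection, mem_union, mem_filter, mem_image, mem_univ, true_and, eq_comm]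

theorem perfection_w_new {u : V} (hu : s.Free (.inl u)) :
    (perfection τ s).w s(.inl u, .inr u) = 0 := by
  simp only [perfection]
  rw [if_pos]
  exact mem_image.2 ⟨u, by simpa using hu, rfl⟩

theorem perfection_w_old {e : Sym2 (V ⊕ V)}
    (he : ∀ u, s.Free (.inl u) → e ≠ s(.inl u, .inr u)) : (perfection τ s).w e = s.w e := by
  simp only [perfection]
  rw [if_neg]
  intro h
  obtain ⟨u, hu, rfl⟩ := mem_image.1 h
  exact he u (by simpa using hu) rfl

theorem perfection_y_inl {u : V} : (perfection τ s).y (.inl u) = s.y (.inl u) := by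
  simp [perfection]

theorem perfection_y_inr_new {u : V} (hu : s.Free (.inl u)) :
    (perfection τ s).y (.inr u) = τ := by
  simp [perfection, hu]

theorem perfection_y_inr_old {u : V} (hu : ¬ s.Free (.inl u)) :
    (perfection τ s).y (.inr u) = s.y (.inr u) := by
  simp [perfection, hu]

theorem GraphInv.perfection (h : GraphInv G c N i s) : GraphInv G c N i (perfection τ s) := by
  refine ⟨fun u => perfection_U.2 (Or.inl ⟨h.vertices u, by simp⟩), fun e he => ?_,
    fun e he => perfection_E.2 (Or.inl ⟨h.mem e he, ?_⟩), ?_⟩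
  · rcases perfection_E.1 he with ⟨he, -⟩ | ⟨u, -, rfl⟩
    · exact h.edges e he
    · exact Or.inr ⟨u, rfl⟩
  · intro v hv
    obtain ⟨u, -, rfl⟩ := Sym2.mem_map.1 hv
    simp
  · obtain ⟨π, hπ⟩ := h.weight
    refine ⟨π, fun u v huv => ?_⟩
    rw [perfection_w_old, hπ u v huv]
    intro x _ hx
    rw [Sym2.eq_iff] at hx
    simp at hx

/-- Free vertices have dual `-τ` at this point, so a dummy with dual `τ` makes the new matched edge
exactly tight for weight zero. -/
theorem State.Good.perfection (hg : s.Good) (h : GraphInv G c N i s)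
    (hy : ∀ v, s.Free v → s.y v = -τ) : (perfection τ s).Good ∧
      IsPerfectMatching (perfection τ s).U (perfection τ s).E (perfection τ s).M := by
  have hs := hg.struct
  have hl := h.isLeft hs
  -- The only edge at an existing dummy leads to its original. If the original is free, so is the
  -- dummy, which is then deleted and created afresh; no old edge sees the changed dual.
  have hfree : ∀ {u}, Sum.inr u ∈ s.U → s.Free (.inl u) → s.Free (.inr u) := by
    intro u hU hu
    refine ⟨hU, fun e he hue => ?_⟩
    have := h.edge_of_inr_mem (hs.matching.1 he) hue
    exact hu.2 e he (by simp [this])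
  have hMne : ∀ e ∈ s.M, ∀ u, s.Free (.inl u) → e ≠ s(.inl u, .inr u) := by
    rintro e he u hu rfl
    exact hu.2 _ he (by simp)
  have hends : ∀ e ∈ (MWPM.perfection τ s).E, ∀ v ∈ e, v ∈ (MWPM.perfection τ s).U := by
    intro e he v hv
    rcases perfection_E.1 he with ⟨he, he'⟩ | ⟨u, hu, rfl⟩
    · exact perfection_U.2 (Or.inl ⟨hs.ends e he v hv, he' v hv⟩)
    · rcases Sym2.mem_iff.1 hv with rfl | rfl
      · exact perfection_U.2 (Or.inl ⟨hu.1, by simp⟩)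
      · exact perfection_U.2 (Or.inr ⟨u, hu, rfl⟩)
  have hmatch : IsMatching (MWPM.perfection τ s).E (MWPM.perfection τ s).M := by
    refine ⟨fun e he => ?_, fun e he f hf v hve hvf => ?_⟩
    · rcases perfection_M.1 he with he | ⟨u, hu, rfl⟩
      · exact perfection_E.2 (Or.inl ⟨hs.matching.1 he, fun v hv hv' => hv'.1.2 e he hv⟩)
      · exact perfection_E.2 (Or.inr ⟨u, hu, rfl⟩)
    · have hcross : ∀ e ∈ s.M, ∀ u, s.Free (.inl u) → ∀ v ∈ e, v ∉ s(Sum.inl u, Sum.inr u) := by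
        intro e he u hu v hve hv
        rcases Sym2.mem_iff.1 hv with rfl | rfl
        · exact hu.2 e he hve
        · exact hMne e he u hu (h.edge_of_inr_mem (hs.matching.1 he) hve)
      rcases perfection_M.1 he with he | ⟨u, hu, rfl⟩ <;>
        rcases perfection_M.1 hf with hf | ⟨u', hu', rfl⟩
      · exact hs.matching.2 e he f hf v hve hvf
      · exact absurd hvf (hcross e he u' hu' v hve)
      · exact absurd hve (hcross f hf u hu v hvf)
      · rcases Sym2.mem_iff.1 hve with rfl | rfl <;> rcases Sym2.mem_iff.1 hvf with h' | h' <;>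
          cases h' <;> rfl
  refine ⟨hg.of_agree hl rfl rfl rfl ?_ ?_ ?_ ?_ ?_ ?_ hends hmatch ?_, hmatch, ?_⟩
  · exact fun v hv hv' => perfection_U.2 (Or.inl ⟨hv, by cases v <;> simp_all⟩)
  · exact fun e he hv => perfection_E.2 (Or.inl ⟨he, fun v hve h => by
      have := hv v hve
      cases v <;> simp_all⟩)
  · intro e he
    rw [perfection_M]
    refine or_iff_left ?_
    rintro ⟨u, -, rfl⟩
    simpa using he (.inr u) (by simp)
  · rintro (u | u) hu
    · exact perfection_y_inl
    · simp at hu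
  · intro e he
    refine perfection_w_old fun u _ heq => ?_
    subst heq
    simpa using he (.inr u) (by simp)
  · intro e he
    rcases perfection_E.1 he with ⟨he, he'⟩ | ⟨u, hu, rfl⟩
    · exact hs.noloop e he
    · simp
  · intro e he
    by_cases hnew : ∃ u, s.Free (.inl u) ∧ e = s(.inl u, .inr u)
    · obtain ⟨u, hu, rfl⟩ := hnew
      have hyz : (MWPM.perfection τ s).yz s(.inl u, .inr u) = 0 := by
        rw [State.yz_mk, perfection_y_inl, perfection_y_inr_new hu, hy _ hu, sum_eq_zero]
        · ring
        · intro B hB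
          refine hg.rcs.inactive B fun hBΩ => ?_
          simpa using hl B hBΩ (.inr u) (mem_filter.1 hB).2.2
      rw [hyz, perfection_w_new hu]
      simp
    · have hold : e ∈ s.E ∧ ∀ v ∈ e, ¬ (s.Free v ∧ v.isRight = true) :=
        (perfection_E.1 he).resolve_right hnew
      rw [perfection_w_old fun u hu heq => hnew ⟨u, hu, heq⟩,
        State.yz_congr (s := s) (t := MWPM.perfection τ s) rfl ?_]
      · refine ⟨hg.rcs.even_weight e hold.1, hg.rcs.near_domination e hold.1, fun heM => ?_⟩
        exact hg.rcs.near_tightness e (Or.inl ((perfection_M.1 heM).resolve_right hnew))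
      · rintro (u | u) hu
        · exact perfection_y_inl
        · refine perfection_y_inr_old fun hf => ?_
          exact hold.2 _ hu ⟨hfree (hs.ends e hold.1 _ hu) hf, rfl⟩
  · intro v hv
    rcases perfection_U.1 hv with ⟨hU, hv'⟩ | ⟨u, hu, rfl⟩
    · by_cases hf : s.Free v
      · obtain u | u := v
        · exact ⟨_, perfection_M.2 (Or.inr ⟨u, hf, rfl⟩), by simp⟩
        · exact absurd ⟨hf, rfl⟩ hv'
      · unfold State.Free at hf
        push Not at hf
        obtain ⟨e, he, hve⟩ := hf hU
        exact ⟨e, perfection_M.2 (Or.inl he), hve⟩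
    · exact ⟨_, perfection_M.2 (Or.inr ⟨u, hu, rfl⟩), by simp⟩

theorem mem_deleteDummies_E {e : Sym2 (V ⊕ V)} : e ∈ (deleteDummies s).E ↔
    e ∈ s.E ∧ ∀ v ∈ e, v.isLeft = true := by
  simp [deleteDummies]

theorem mem_deleteDummies_M {e : Sym2 (V ⊕ V)} : e ∈ (deleteDummies s).M ↔
    e ∈ s.M ∧ ∀ v ∈ e, v.isLeft = true := by
  simp [deleteDummies]

theorem State.Good.deleteDummies (hg : s.Good) (h : GraphInv G c N i s) :
    (deleteDummies s).Good := by
  have hs := hg.struct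
  refine hg.of_agree (h.isLeft hs) rfl rfl rfl ?_ ?_ ?_ (fun _ _ => rfl) (fun _ _ => rfl) ?_ ?_ ?_ ?_
  · exact fun v hv hv' => mem_filter.2 ⟨hv, hv'⟩
  · exact fun e he hv => mem_deleteDummies_E.2 ⟨he, hv⟩
  · exact fun e he => mem_deleteDummies_M.trans (and_iff_left he)
  · exact fun e he => hs.noloop e (mem_deleteDummies_E.1 he).1
  · exact fun e he v hv => mem_filter.2 ⟨hs.ends e (mem_deleteDummies_E.1 he).1 v hv,
      (mem_deleteDummies_E.1 he).2 v hv⟩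
  · refine ⟨fun e he => ?_, fun e he f hf => ?_⟩
    · rw [mem_deleteDummies_M] at he
      exact mem_deleteDummies_E.2 ⟨hs.matching.1 he.1, he.2⟩
    · exact hs.matching.2 e (mem_deleteDummies_M.1 he).1 f (mem_deleteDummies_M.1 hf).1
  · intro e he
    have heE := (mem_deleteDummies_E.1 he).1
    exact ⟨hg.rcs.even_weight e heE, hg.rcs.near_domination e heE, fun heM =>
      hg.rcs.near_tightness e (Or.inl (mem_deleteDummies_M.1 heM).1)⟩

theorem GraphInv.deleteDummies (h : GraphInv G c N i s) :
    GraphInv G c N i (deleteDummies s) ∧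
      (deleteDummies s).U = univ.image Sum.inl ∧
      (deleteDummies s).E = G.edgeFinset.image (Sym2.map Sum.inl) := by
  have hmap : ∀ e ∈ G.edgeFinset, e.map Sum.inl ∈ (MWPM.deleteDummies s).E := fun e he =>
    mem_deleteDummies_E.2 ⟨h.mem e he, fun v hv => by
      obtain ⟨u, -, rfl⟩ := Sym2.mem_map.1 hv
      rfl⟩
  refine ⟨⟨fun u => mem_filter.2 ⟨h.vertices u, rfl⟩,
    fun e he => h.edges e (mem_deleteDummies_E.1 he).1, hmap, h.weight⟩, ?_, ?_⟩
  · ext v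
    simp only [MWPM.deleteDummies, mem_filter, mem_image, mem_univ, true_and]
    constructor
    · rintro ⟨-, hv⟩
      obtain u | u := v
      · exact ⟨u, rfl⟩
      · simp at hv
    · rintro ⟨u, rfl⟩
      exact ⟨h.vertices u, rfl⟩
  · ext e
    rw [mem_image]
    constructor
    · intro he
      rw [mem_deleteDummies_E] at he
      rcases h.edges e he.1 with ⟨e', he', rfl⟩ | ⟨u, rfl⟩
      · exact ⟨e', he', rfl⟩
      · simpa using he.2 (.inr u) (by simp)
    · rintro ⟨e', he', rfl⟩
      exact hmap e' he'

end Perfection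

end Dummies

end Transitions

/-! ### The invariant along executions -/

section Invariant
variable {V : Type u} [Fintype V] [DecidableEq V]
variable {G : SimpleGraph V} [DecidableRel G.Adj] {c : Sym2 V → ℕ} {N τ : ℕ}

/-- All free vertices have nonnegative `y`-values, and positive ones only in the sets of `S`. -/
def State.FreeIn {W : Type u} [Fintype W] [DecidableEq W] (s : State W) (S : Finset (Finset W)) :
    Prop :=
  ∀ u, s.Free u → 0 ≤ s.y u ∧ (s.y u ≠ 0 → ∃ B ∈ S, u ∈ B)

/-- The invariant of Small Blossom Liquidation. -/
structure SmallInv (G : SimpleGraph V) [DecidableRel G.Adj] (c : Sym2 V → ℕ) (N i : ℕ)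
    (S : Finset (Finset (V ⊕ V))) (s : State (V ⊕ V)) : Prop where
  good : s.Good
  tight : s.Tight
  graph : GraphInv G c N i s
  pos : 1 ≤ i
  le : i ≤ numScales V N
  free : s.FreeIn S

/-- The invariant of Finalization. -/
structure FinalInv (G : SimpleGraph V) [DecidableRel G.Adj] (c : Sym2 V → ℕ) (N : ℕ)
    (s : State (V ⊕ V)) : Prop where
  good : s.Good
  graph : GraphInv G c N (numScales V N) s
  vertices : s.U = univ.image Sum.inl
  edges : s.E = G.edgeFinset.image (Sym2.map Sum.inl)

/-- The invariant of the algorithm at each control point. -/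
def Inv (G : SimpleGraph V) [DecidableRel G.Adj] (c : Sym2 V → ℕ) (N τ : ℕ) :
    Control (V ⊕ V) → State (V ⊕ V) → Prop
  | .scaleEnd i, s => s.Good ∧ GraphInv G c N i s ∧ i ≤ numScales V N ∧
      (1 ≤ i → IsPerfectMatching s.U s.E s.M)
  | .small i R, s => SmallInv G c N i R s
  | .smallLoop i R B, s => SmallInv G c N i (insert B R) s
  | .search .tight F k found (.smallLoop i R B), s => SmallInv G c N i (insert B R) s ∧
      (∃ Y : ℤ, ∃ m : ℕ, (∀ f ∈ F, s.Free f → s.y f = Y) ∧ k = m ∧ m ≤ Y) ∧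
      (found = false → ∃ f ∈ F, s.Free f)
  | .search .near F k found .finalization, s => FinalInv G c N s ∧
      (∃ p : ℤ, ∀ f ∈ F, s.Free f → Even (s.y f - p)) ∧ k = ⊤ ∧
      (found = false → ∃ f ∈ F, s.Free f)
  | .search _ _ _ _ _, _ => False
  | .reduction i k, s => s.Good ∧ GraphInv G c N i s ∧ 1 ≤ i ∧ i ≤ numScales V N ∧
      ∀ v, s.Free v → s.y v = k - τ
  | .finalization, s => FinalInv G c N s
  | .done, s => FinalInv G c N s ∧ ∀ v, ¬ s.Free v

/-- The searches that the algorithm performs. -/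
theorem Inv.search_cases {a : Criterion} {F : Finset (V ⊕ V)} {k : ℕ∞} {found : Bool}
    {r : Control (V ⊕ V)} {s : State (V ⊕ V)} (h : Inv G c N τ (.search a F k found r) s) :
    (a = .tight ∧ ∃ i R B, r = .smallLoop i R B) ∨ (a = .near ∧ r = .finalization) := by
  cases a <;> cases r <;> first | exact absurd h id | simp

theorem Inv.good {p : Control (V ⊕ V)} {s : State (V ⊕ V)} (h : Inv G c N τ p s) : s.Good := by
  cases p with
  | scaleEnd i => exact h.1
  | small i R => exact SmallInv.good h
  | smallLoop i R B => exact SmallInv.good h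
  | reduction i k => exact h.1
  | finalization => exact FinalInv.good h
  | done => exact h.1.good
  | search a F k found r =>
    rcases Inv.search_cases h with ⟨rfl, i, R, B, rfl⟩ | ⟨rfl, rfl⟩
    · exact h.1.good
    · exact h.1.good

section Preservation
variable {W : Type u} [Fintype W] [DecidableEq W] {s s' : State W} {a : Criterion} {F : Finset W}

/-- The effect of an adjustment. -/
structure Adjusted (F : Finset W) (s s' : State W) : Prop where
  U : s'.U = s.U
  E : s'.E = s.E
  w : s'.w = s.w
  M : s'.M = s.M
  free : ∀ v, s'.Free v ↔ s.Free v
  y : ∀ v, s.Free v → s'.y v = if v ∈ F then s.y v - 1 else s.y v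

theorem ShrinkAdjustDissolve.exists_shrinkData (h : ShrinkAdjustDissolve a F s s') (hg : s.Good)
    (hno : ¬ ∃ ρ, s.IsAugPath a F ρ) :
    ∃ t, ShrinkData a F s t ∧ s' = dissolve (adjust a F s t) := by
  obtain ⟨t, ht, rfl⟩ := h
  exact ⟨t, ht.shrinkData hg.struct hg.rcs.inactive ((noAug_iff hg.struct).1 hno), rfl⟩

theorem ShrinkAdjustDissolve.adjusted (h : ShrinkAdjustDissolve a F s s') (hg : s.Good)
    (hno : ¬ ∃ ρ, s.IsAugPath a F ρ) : Adjusted F s s' := by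
  obtain ⟨t, d, rfl⟩ := h.exists_shrinkData hg hno
  exact ⟨d.ext.U, d.ext.E, d.ext.w, d.ext.M, fun v => d.free_iff, fun v hv => d.free_y hv⟩

theorem ShrinkAdjustDissolve.good (h : ShrinkAdjustDissolve a F s s') (hg : s.Good)
    (hno : ¬ ∃ ρ, s.IsAugPath a F ρ) (ha : a ≠ .tight) {p : ℤ}
    (hF : ∀ f ∈ F, s.Free f → Even (s.y f - p)) : s'.Good := by
  obtain ⟨t, d, rfl⟩ := h.exists_shrinkData hg hno
  exact d.good_of_ne_tight hg hF ha

theorem ShrinkAdjustDissolve.good_tight (h : ShrinkAdjustDissolve .tight F s s') (hg : s.Good)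
    (ht : s.Tight) (hno : ¬ ∃ ρ, s.IsAugPath .tight F ρ) {p : ℤ}
    (hF : ∀ f ∈ F, s.Free f → Even (s.y f - p)) : s'.Good ∧ s'.Tight := by
  obtain ⟨t, d, rfl⟩ := h.exists_shrinkData hg hno
  exact d.good_of_tight hg ht hF

theorem exists_shrinkAdjustDissolve (hg : s.Good) (hno : ¬ ∃ ρ, s.IsAugPath a F ρ) :
    ∃ s', ShrinkAdjustDissolve a F s s' := by
  obtain ⟨t, ht⟩ := exists_shrink hg.struct hg.rcs.inactive hno
  exact ⟨_, t, ht, rfl⟩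

/-- All free vertices have the same dual and all are starting points, so the parity condition is
automatic and every remaining one drops by exactly 1. -/
theorem SearchOne.good (h : SearchOne s.freeSet s s') (hg : s.Good) {p : ℤ}
    (hy : ∀ v, s.Free v → s.y v = p) : s'.Good ∧ (∀ v, s'.Free v → s'.y v = p - 1) ∧
      s'.U = s.U ∧ s'.E = s.E ∧ s'.w = s.w := by
  obtain ⟨t, h1, h2⟩ := h
  obtain ⟨h3, h4, h5, h6, h7, h8⟩ := h1.good hg
  have hno := h1.noAug hg
  have hadj := h2.adjusted h3 hno
  refine ⟨h2.good h3 hno (by simp) (p := p) fun f _ hf => ?_, fun v hv => ?_,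
    hadj.U.trans h5, hadj.E.trans h6, hadj.w.trans h7⟩
  · rw [h8, hy f (h4 f hf), sub_self]
    exact Even.zero
  · have hv' := (hadj.free v).1 hv
    rw [hadj.y v hv', if_pos (mem_freeSet.2 (h4 v hv')), h8, hy v (h4 v hv')]

theorem exists_searchOne (hg : s.Good) (F : Finset W) : ∃ s', SearchOne F s s' := by
  obtain ⟨t, ht⟩ := hg.struct.exists_augmentMaximal .batch F
  obtain ⟨s', hs'⟩ := exists_shrinkAdjustDissolve (ht.good hg).1 (ht.noAug hg)
  exact ⟨s', t, ht, hs'⟩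

end Preservation

/-- In the first phase positive duals of free vertices are confined to the old small blossoms still
to be treated, and the remaining budget of a search never exceeds the common dual of its starting
vertices. So all free duals are zero when Free Vertex Reduction begins and `-τ` when it ends. -/
theorem Inv.step {p p' : Control (V ⊕ V)} {s s' : State (V ⊕ V)} (h : Inv G c N τ p s)
    (hstep : Step c N τ (p, s) (p', s')) : Inv G c N τ p' s' := by
  cases hstep with
  | start i s hi =>
    obtain ⟨hg, hG, -, -⟩ := h
    obtain ⟨h1, h2⟩ := hg.startScale τ (bit := weightBit c N (i + 1)) weightBit_le
    exact ⟨h1, h2, hG.startScale hi, by omega, by omega, fun u _ =>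
      ⟨startScale_y_nonneg _ _ hg u, exists_of_startScale_y_ne⟩⟩
  | smallPick i R B s hB =>
    change SmallInv G c N i (insert B (R.erase B)) s
    rwa [insert_erase hB]
  | smallDone i s =>
    have h : SmallInv G c N i ∅ s := h
    refine ⟨h.good, h.graph, h.pos, h.le, fun v hv => ?_⟩
    by_contra hne
    obtain ⟨B, hB, -⟩ := (h.free v hv).2 (by omega)
    simp at hB
  | smallEnter i R B F s Y Y' hY hpos hF hY' =>
    have h : SmallInv G c N i (insert B R) s := h
    refine ⟨h, ⟨Y, (Y - Y').toNat, ?_, rfl, ?_⟩, fun _ => ?_⟩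
    · intro f hf _
      simp only [hF, mem_filter] at hf
      exact hf.2.2
    · have : 0 ≤ Y' := hY'.2 (Or.inl rfl)
      omega
    · obtain ⟨u, hu, hfree, hy⟩ := hY.1
      exact ⟨u, by simp only [hF, mem_filter]; exact ⟨hu, hfree, hy⟩, hfree⟩
  | smallExit i R B s hB =>
    have h : SmallInv G c N i (insert B R) s := h
    refine ⟨h.good, h.tight, h.graph, h.pos, h.le, fun u hu => ⟨(h.free u hu).1, fun hne => ?_⟩⟩
    obtain ⟨C, hC, huC⟩ := (h.free u hu).2 hne
    rcases mem_insert.1 hC with rfl | hC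
    · have := hB u huC hu
      have := (h.free u hu).1
      omega
    · exact ⟨C, hC, huC⟩
  | searchAugment a F k found r s s' hk hA =>
    obtain ⟨hU, hE, hw, hy⟩ := hA.eqs
    rcases Inv.search_cases h with ⟨rfl, i, R, B, rfl⟩ | ⟨rfl, rfl⟩
    · obtain ⟨h1, ⟨Y, m, h2, h3⟩, -⟩ := h
      refine ⟨⟨hA.good h1.good, hA.tight h1.good h1.tight, h1.graph.congr hU hE hw, h1.pos, h1.le,
        fun u hu => ?_⟩, ⟨Y, m, fun f hf hfree => ?_, h3⟩, by simp⟩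
      · rw [hy]
        exact h1.free u (hA.free_subset hu)
      · rw [hy]
        exact h2 f hf (hA.free_subset hfree)
    · obtain ⟨h1, ⟨p, h2⟩, h3, -⟩ := h
      refine ⟨⟨hA.good h1.good, h1.graph.congr hU hE hw, hU.trans h1.vertices, hE.trans h1.edges⟩,
        ⟨p, fun f hf hfree => ?_⟩, h3, by simp⟩
      rw [hy]
      exact h2 f hf (hA.free_subset hfree)
  | searchAdjust a F k r s s' hk hno hA =>
    rcases Inv.search_cases h with ⟨rfl, i, R, B, rfl⟩ | ⟨rfl, rfl⟩
    · obtain ⟨h1, ⟨Y, m, h2, rfl, h4⟩, h5⟩ := h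
      have hm : m ≠ 0 := by simpa using hk
      obtain ⟨h6, h7⟩ := hA.good_tight h1.good h1.tight hno (p := Y) fun f hf hfree => by
        rw [h2 f hf hfree, sub_self]
        exact Even.zero
      have hadj := hA.adjusted h1.good hno
      refine ⟨⟨h6, h7, h1.graph.congr hadj.U hadj.E hadj.w, h1.pos, h1.le, fun u hu => ?_⟩,
        ⟨Y - 1, m - 1, fun f hf hfree => ?_, ?_, ?_⟩, fun _ => ?_⟩
      · have hu' := (hadj.free u).1 hu
        have h8 := h1.free u hu'
        rw [hadj.y u hu']
        -- Vertices of `F` have dual `Y ≥ m ≥ 1`, so they stay nonnegative after the decrease.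
        split_ifs with hF
        · have := h2 u hF hu'
          exact ⟨by omega, fun _ => h8.2 (by omega)⟩
        · exact h8
      · have hf' := (hadj.free f).1 hfree
        rw [hadj.y f hf', if_pos hf, h2 f hf hf']
      · push_cast
        rfl
      · omega
      · obtain ⟨f, hf, hfree⟩ := h5 rfl
        exact ⟨f, hf, (hadj.free f).2 hfree⟩
    · obtain ⟨h1, ⟨p, h2⟩, rfl, h5⟩ := h
      have h6 := hA.good h1.good hno (by simp) h2
      have hadj := hA.adjusted h1.good hno
      refine ⟨⟨h6, h1.graph.congr hadj.U hadj.E hadj.w, hadj.U.trans h1.vertices,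
        hadj.E.trans h1.edges⟩, ⟨p - 1, fun f hf hfree => ?_⟩, by simp, fun _ => ?_⟩
      · have hf' := (hadj.free f).1 hfree
        rw [hadj.y f hf', if_pos hf, sub_sub_sub_cancel_right]
        exact h2 f hf hf'
      · obtain ⟨f, hf, hfree⟩ := h5 rfl
        exact ⟨f, hf, (hadj.free f).2 hfree⟩
  | searchFound a F k r s hk hno =>
    rcases Inv.search_cases h with ⟨rfl, i, R, B, rfl⟩ | ⟨rfl, rfl⟩
    · exact h.1
    · exact h.1
  | searchBudget a F found r s =>
    rcases Inv.search_cases h with ⟨rfl, i, R, B, rfl⟩ | ⟨rfl, rfl⟩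
    · exact h.1
    · exact h.1
  | reduce i k s s' hS =>
    obtain ⟨h1, h2, h3, h4, h5⟩ := h
    obtain ⟨h6, h7, h8, h9, h10⟩ := hS.good h1 h5
    refine ⟨h6, h2.congr h8 h9 h10, h3, h4, fun v hv => ?_⟩
    rw [h7 v hv]
    push_cast
    ring
  | perfect i s =>
    obtain ⟨h1, h2, h3, h4, h5⟩ := h
    obtain ⟨h6, h7⟩ := h1.perfection (τ := τ) h2 fun v hv => by simpa using h5 v hv
    exact ⟨h6, h2.perfection, h4, fun _ => h7⟩
  | finalize s =>
    obtain ⟨h1, h2, h3, h4⟩ := h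
    obtain ⟨h5, h6, h7⟩ := h2.deleteDummies
    exact ⟨h1.deleteDummies h2, h5, h6, h7⟩
  | finalSearch s u hu =>
    refine ⟨h, ⟨s.y u, fun f hf _ => (mem_filter.1 hf).2⟩, rfl, fun _ => ⟨u, ?_, hu⟩⟩
    exact mem_filter.2 ⟨mem_freeSet.2 hu, by simp⟩
  | finalDone s hf => exact ⟨h, hf⟩

theorem Inv.initial (hN : ∀ e ∈ G.edgeSet, c e ≤ N) :
    Inv G c N τ (.scaleEnd 0) (initialState G) :=
  ⟨initialState_good, initialState_graphInv hN, Nat.zero_le _, fun h => absurd h (by simp)⟩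

theorem Reachable.inv (hN : ∀ e ∈ G.edgeSet, c e ≤ N) {p : Control (V ⊕ V)} {s : State (V ⊕ V)}
    (h : Reachable G c N τ (p, s)) : Inv G c N τ p s := by
  suffices H : ∀ x, Reachable G c N τ x → Inv G c N τ x.1 x.2 from H _ h
  intro x hx
  induction hx with
  | refl => exact Inv.initial hN
  | tail _ hstep ih => exact Inv.step ih hstep

end Invariant

/-! ### Progress, termination and the returned matching -/

section Termination
variable {V : Type u} [Fintype V] [DecidableEq V]
variable {G : SimpleGraph V} [DecidableRel G.Adj] {c : Sym2 V → ℕ} {N τ : ℕ}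

/-! ### Progress -/

theorem exists_isGreatest_of_finite {S : Set ℤ} (hS : S.Finite) (hne : S.Nonempty) :
    ∃ a, IsGreatest S a :=
  BddAbove.exists_isGreatest_of_nonempty hS.bddAbove hne

theorem finite_values {W : Type u} [Fintype W] (P : W → Prop) (y : W → ℤ) :
    {t | ∃ u, P u ∧ y u = t}.Finite :=
  (Set.toFinite {u | P u}).image y

theorem Inv.progress {p : Control (V ⊕ V)} {s : State (V ⊕ V)} (h : Inv G c N τ p s)
    (hp : p ≠ .done) : ∃ x, Step c N τ (p, s) x := by
  classical
  have hg := h.good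
  cases p with
  | scaleEnd i =>
    rcases h.2.2.1.eq_or_lt with rfl | hi
    · exact ⟨_, .finalize s⟩
    · exact ⟨_, .start i s hi⟩
  | small i R =>
    rcases R.eq_empty_or_nonempty with rfl | ⟨B, hB⟩
    · exact ⟨_, .smallDone i s⟩
    · exact ⟨_, .smallPick i R B s hB⟩
  | smallLoop i R B =>
    by_cases hex : ∃ u ∈ B, s.Free u ∧ 0 < s.y u
    · obtain ⟨u, hu, hfree, hpos⟩ := hex
      obtain ⟨Y, hY⟩ := exists_isGreatest_of_finite
        (S := {t | ∃ u ∈ B, s.Free u ∧ s.y u = t})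
        ((finite_values (fun u => u ∈ B ∧ s.Free u) s.y).subset
          fun t ⟨u, h1, h2, h3⟩ => ⟨u, ⟨h1, h2⟩, h3⟩) ⟨s.y u, u, hu, hfree, rfl⟩
      obtain ⟨Y', hY'⟩ := exists_isGreatest_of_finite
        (S := {0} ∪ {t | ∃ u ∈ B, u ∉ (B.filter fun u => s.Free u ∧ s.y u = Y) ∧
          s.Free u ∧ s.y u = t})
        ((Set.finite_singleton 0).union ((finite_values (fun u => u ∈ B ∧ s.Free u) s.y).subset
          fun t ⟨u, h1, h2, h3, h4⟩ => ⟨u, ⟨h1, h3⟩, h4⟩)) ⟨0, Or.inl rfl⟩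
      refine ⟨_, .smallEnter i R B _ s Y Y' hY ?_ ?_ hY'⟩
      · exact lt_of_lt_of_le hpos (hY.2 ⟨u, hu, hfree, rfl⟩)
      · ext v
        simp only [mem_filter]
    · refine ⟨_, .smallExit i R B s fun u hu hfree => ?_⟩
      by_contra hlt
      exact hex ⟨u, hu, hfree, by omega⟩
  | search a F k found r =>
    by_cases hk : k = 0
    · subst hk
      exact ⟨_, .searchBudget a F found r s⟩
    by_cases haug : ∃ ρ, s.IsAugPath a F ρ
    · obtain ⟨ρ, hρ⟩ := haug
      obtain ⟨s', hs'⟩ := hg.struct.exists_augment hρ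
      exact ⟨_, .searchAugment a F k found r s s' hk hs'⟩
    cases found with
    | true => exact ⟨_, .searchFound a F k r s hk haug⟩
    | false =>
      obtain ⟨s', hs'⟩ := exists_shrinkAdjustDissolve hg haug
      exact ⟨_, .searchAdjust a F k r s s' hk haug hs'⟩
  | reduction i k =>
    cases k with
    | zero => exact ⟨_, .perfect i s⟩
    | succ k =>
      obtain ⟨s', hs'⟩ := exists_searchOne hg s.freeSet
      exact ⟨_, .reduce i k s s' hs'⟩
  | finalization =>
    by_cases hf : ∃ u, s.Free u
    · obtain ⟨u, hu⟩ := hf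
      exact ⟨_, .finalSearch s u hu⟩
    · exact ⟨_, .finalDone s fun v hv => hf ⟨v, hv⟩⟩
  | done => exact absurd rfl hp

/-! ### Termination -/

/-- Counts the remaining phases. -/
def phaseRank (K : ℕ) : Control (V ⊕ V) → ℕ
  | .scaleEnd i => 2 * (K - i) + 2
  | .small i _ => 2 * (K - i) + 3
  | .smallLoop i _ _ => 2 * (K - i) + 3
  | .search _ _ _ _ r => phaseRank K r
  | .reduction i _ => 2 * (K - i) + 3
  | .finalization => 1
  | .done => 0

/-- Counts the remaining tasks in a phase. -/
def taskRank (τ : ℕ) : Control (V ⊕ V) → ℕ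
  | .small _ R => 2 * R.card + τ + 1
  | .smallLoop _ R _ => 2 * R.card + τ + 2
  | .search _ _ _ _ r => taskRank τ r
  | .reduction _ k => k
  | _ => 0

/-- Bounds the number of adjustments in a search; `M₀` is a fixed perfect matching. -/
def potential (M₀ : Finset (Sym2 (V ⊕ V))) : Control (V ⊕ V) → State (V ⊕ V) → ℤ
  | .smallLoop _ _ _, s => ∑ v ∈ s.freeSet, s.y v
  | .search _ _ _ _ r, s => potential M₀ r s
  | .finalization, s =>
      ∑ e ∈ s.M, s.w e + ∑ v ∈ s.freeSet, s.y v + s.U.card - ∑ e ∈ M₀, s.w e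
  | _, _ => 0

open Classical in
/-- Orders the entrance to a search, its beginning, and its end. -/
def searchRank : Control (V ⊕ V) → ℕ
  | .search _ _ k found _ => if found = true ∨ k = 0 then 3 else 1
  | _ => 2

/-- The termination measure. -/
def rank (K τ : ℕ) (M₀ : Finset (Sym2 (V ⊕ V))) (x : Control (V ⊕ V) × State (V ⊕ V)) :
    ℕ ×ₗ ℕ ×ₗ ℕ ×ₗ ℕ ×ₗ ℕ :=
  toLex (phaseRank K x.1, toLex (taskRank τ x.1, toLex (x.2.freeSet.card,
    toLex ((potential M₀ x.1 x.2).toNat, searchRank x.1))))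

section
variable {K : ℕ} {M₀ : Finset (Sym2 (V ⊕ V))} {x y : Control (V ⊕ V) × State (V ⊕ V)}

theorem rank_lt_of_phase (h : phaseRank K x.1 < phaseRank K y.1) :
    rank K τ M₀ x < rank K τ M₀ y :=
  Prod.Lex.toLex_lt_toLex.2 (Or.inl h)

theorem rank_lt_of_task (h : phaseRank K x.1 = phaseRank K y.1)
    (h' : taskRank τ x.1 < taskRank τ y.1) : rank K τ M₀ x < rank K τ M₀ y :=
  Prod.Lex.toLex_lt_toLex.2 (Or.inr ⟨h, Prod.Lex.toLex_lt_toLex.2 (Or.inl h')⟩)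

theorem rank_lt_of_free (h : phaseRank K x.1 = phaseRank K y.1)
    (h' : taskRank τ x.1 = taskRank τ y.1) (h'' : x.2.freeSet.card < y.2.freeSet.card) :
    rank K τ M₀ x < rank K τ M₀ y :=
  Prod.Lex.toLex_lt_toLex.2 (Or.inr ⟨h, Prod.Lex.toLex_lt_toLex.2 (Or.inr ⟨h',
    Prod.Lex.toLex_lt_toLex.2 (Or.inl h'')⟩)⟩)

theorem rank_lt_of_potential (h : phaseRank K x.1 = phaseRank K y.1)
    (h' : taskRank τ x.1 = taskRank τ y.1) (h'' : x.2.freeSet.card = y.2.freeSet.card)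
    (hx : 0 ≤ potential M₀ x.1 x.2) (hlt : potential M₀ x.1 x.2 < potential M₀ y.1 y.2) :
    rank K τ M₀ x < rank K τ M₀ y :=
  Prod.Lex.toLex_lt_toLex.2 (Or.inr ⟨h, Prod.Lex.toLex_lt_toLex.2 (Or.inr ⟨h',
    Prod.Lex.toLex_lt_toLex.2 (Or.inr ⟨h'', Prod.Lex.toLex_lt_toLex.2 (Or.inl
      ((Int.toNat_lt_toNat (lt_of_le_of_lt hx hlt)).2 hlt))⟩)⟩)⟩)

theorem rank_lt_of_search (h : phaseRank K x.1 = phaseRank K y.1)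
    (h' : taskRank τ x.1 = taskRank τ y.1) (hs : x.2 = y.2)
    (hpot : potential M₀ x.1 x.2 = potential M₀ y.1 y.2)
    (hlt : searchRank x.1 < searchRank y.1) : rank K τ M₀ x < rank K τ M₀ y :=
  Prod.Lex.toLex_lt_toLex.2 (Or.inr ⟨h, Prod.Lex.toLex_lt_toLex.2 (Or.inr ⟨h',
    Prod.Lex.toLex_lt_toLex.2 (Or.inr ⟨congrArg (fun s => s.freeSet.card) hs,
      Prod.Lex.toLex_lt_toLex.2 (Or.inr ⟨congrArg Int.toNat hpot, hlt⟩)⟩)⟩)⟩)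

end

theorem Augment.freeSet_card_lt {W : Type u} [Fintype W] [DecidableEq W] {a : Criterion}
    {F : Finset W} {s s' : State W} (h : Augment a F s s') :
    s'.freeSet.card < s.freeSet.card := by
  obtain ⟨v, hv, hv'⟩ := h.exists_covered
  refine card_lt_card ⟨fun u hu => mem_freeSet.2 (h.free_subset (mem_freeSet.1 hu)), fun hsub => ?_⟩
  exact hv' (mem_freeSet.1 (hsub (mem_freeSet.2 hv)))

theorem Adjusted.freeSet {W : Type u} [Fintype W] [DecidableEq W] {F : Finset W} {s s' : State W}
    (h : Adjusted F s s') : s'.freeSet = s.freeSet := by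
  ext v
  rw [mem_freeSet, mem_freeSet, h.free]

theorem Adjusted.sum_lt {W : Type u} [Fintype W] [DecidableEq W] {F : Finset W} {s s' : State W}
    (h : Adjusted F s s') (hF : ∃ f ∈ F, s.Free f) :
    ∑ v ∈ s'.freeSet, s'.y v < ∑ v ∈ s.freeSet, s.y v := by
  rw [h.freeSet]
  obtain ⟨f, hf, hfree⟩ := hF
  refine sum_lt_sum (fun v hv => ?_) ⟨f, mem_freeSet.2 hfree, ?_⟩
  · rw [h.y v (mem_freeSet.1 hv)]
    split_ifs <;> omega
  · rw [h.y f hfree, if_pos hf]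
    omega

theorem image_perfect {M : Finset (Sym2 V)} (hM : IsPerfectMatching univ G.edgeFinset M) :
    IsPerfectMatching (univ.image Sum.inl) (G.edgeFinset.image (Sym2.map Sum.inl))
      (M.image (Sym2.map (Sum.inl : V → V ⊕ V))) := by
  refine ⟨⟨image_subset_image hM.1.1, fun e he f hf v hve hvf => ?_⟩, fun v hv => ?_⟩
  · obtain ⟨e', he', rfl⟩ := mem_image.1 he
    obtain ⟨f', hf', rfl⟩ := mem_image.1 hf
    obtain ⟨u, hu, rfl⟩ := Sym2.mem_map.1 hve
    obtain ⟨u', hu', huu⟩ := Sym2.mem_map.1 hvf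
    cases huu
    rw [hM.1.2 e' he' f' hf' u hu hu']
  · obtain ⟨u, -, rfl⟩ := mem_image.1 hv
    obtain ⟨e, he, hue⟩ := hM.2 u (mem_univ u)
    exact ⟨_, mem_image_of_mem _ he, Sym2.mem_map.2 ⟨u, hue, rfl⟩⟩

/-- Comparing `M` with a fixed perfect matching of `G` bounds the free duals from below. This limits
the adjustments in Finalization, where the duals may be negative. -/
theorem FinalInv.potential_nonneg {s : State (V ⊕ V)} (h : FinalInv G c N s)
    {M : Finset (Sym2 V)} (hM : IsPerfectMatching univ G.edgeFinset M) :
    0 ≤ potential (M.image (Sym2.map Sum.inl)) .finalization s := by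
  have h1 := image_perfect hM
  rw [← h.vertices, ← h.edges] at h1
  have := h.good.weight_le h1
  simp only [potential]
  linarith

/-- Augmentations lower the number of free vertices. Adjustments keep it but lower the sum of the
free duals, since `F` contains a free vertex until a path is found. The last component only has to
order the entrance to a search before it and the exit after it. -/
theorem Inv.rank_lt {M : Finset (Sym2 V)} (hM : IsPerfectMatching univ G.edgeFinset M)
    {x x' : Control (V ⊕ V) × State (V ⊕ V)} (h : Inv G c N τ x.1 x.2) (hstep : Step c N τ x x') :
    rank (numScales V N) τ (M.image (Sym2.map Sum.inl)) x' <
      rank (numScales V N) τ (M.image (Sym2.map Sum.inl)) x := by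
  have h' : Inv G c N τ x'.1 x'.2 := Inv.step h hstep
  cases hstep with
  | start i s hi => exact rank_lt_of_phase (by simp only [phaseRank]; omega)
  | smallPick i R B s hB =>
    refine rank_lt_of_task rfl ?_
    have := card_erase_of_mem hB
    have := card_pos.2 ⟨B, hB⟩
    simp only [taskRank]
    omega
  | smallDone i s => exact rank_lt_of_task rfl (by simp [taskRank])
  | smallEnter i R B F s Y Y' hY hpos hF hY' =>
    refine rank_lt_of_search rfl rfl rfl rfl ?_
    -- Every free vertex of `B` outside `F` lies strictly below `Y`, so a search starts with a
    -- positive budget and cannot be left at once.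
    have hlt : Y' < Y := by
      rcases hY'.1 with h0 | ⟨u, hu, huF, hfree, hy⟩
      · rw [Set.mem_singleton_iff.1 h0]
        exact hpos
      · refine lt_of_le_of_ne (hY.2 ⟨u, hu, hfree, hy⟩) fun heq => huF ?_
        simp only [hF, mem_filter]
        exact ⟨hu, hfree, hy.trans heq⟩
    have hne : ¬ ((Y - Y').toNat : ℕ∞) = 0 := by
      simp only [Nat.cast_eq_zero]
      omega
    simp [searchRank, hne]
  | smallExit i R B s hB => exact rank_lt_of_task rfl (by simp [taskRank])
  | searchAugment a F k found r s s' hk hA => exact rank_lt_of_free rfl rfl hA.freeSet_card_lt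
  | searchAdjust a F k r s s' hk hno hA =>
    have hadj := hA.adjusted (Inv.good h) hno
    rcases Inv.search_cases h with ⟨rfl, i, R, B, rfl⟩ | ⟨rfl, rfl⟩
    · refine rank_lt_of_potential rfl rfl (congrArg card hadj.freeSet) ?_ (hadj.sum_lt (h.2.2 rfl))
      exact sum_nonneg fun v hv => (h'.1.free v (mem_freeSet.1 hv)).1
    · refine rank_lt_of_potential rfl rfl (congrArg card hadj.freeSet) ?_ ?_
      · exact FinalInv.potential_nonneg h'.1 hM
      · have := hadj.sum_lt (h.2.2.2 rfl)
        simp only [potential, hadj.M, hadj.w, hadj.U]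
        linarith
  | searchFound a F k r s hk hno =>
    refine rank_lt_of_search rfl rfl rfl rfl ?_
    rcases Inv.search_cases h with ⟨rfl, i, R, B, rfl⟩ | ⟨rfl, rfl⟩ <;> simp [searchRank]
  | searchBudget a F found r s =>
    refine rank_lt_of_search rfl rfl rfl rfl ?_
    rcases Inv.search_cases h with ⟨rfl, i, R, B, rfl⟩ | ⟨rfl, rfl⟩ <;> simp [searchRank]
  | reduce i k s s' hS => exact rank_lt_of_task rfl (by simp [taskRank])
  | perfect i s => exact rank_lt_of_phase (by simp [phaseRank])
  | finalize s => exact rank_lt_of_phase (by simp [phaseRank])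
  | finalSearch s u hu => exact rank_lt_of_search rfl rfl rfl rfl (by simp [searchRank])
  | finalDone s hf => exact rank_lt_of_phase (by simp [phaseRank])

theorem Inv.acc {M : Finset (Sym2 V)} (hM : IsPerfectMatching univ G.edgeFinset M)
    (x : Control (V ⊕ V) × State (V ⊕ V)) (h : Inv G c N τ x.1 x.2) :
    Acc (fun x' x => Step c N τ x x') x := by
  induction hr : rank (numScales V N) τ (M.image (Sym2.map Sum.inl)) x using
    WellFoundedLT.induction generalizing x with
  | _ r ih =>
  subst hr
  exact Acc.intro x fun x' hstep => ih _ (Inv.rank_lt hM h hstep) x' (Inv.step h hstep) rfl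

/-! ### Correctness of the output -/

theorem FinalInv.matching_eq {s : State (V ⊕ V)} (h : FinalInv G c N s) :
    s.M = s.output.image (Sym2.map Sum.inl) := by
  ext e
  simp only [State.output, mem_image, mem_filter, mem_univ, true_and]
  constructor
  · intro he
    have := h.good.rcs.matching.1 he
    rw [h.edges, mem_image] at this
    obtain ⟨e', -, rfl⟩ := this
    exact ⟨e', he, rfl⟩
  · rintro ⟨e', he, rfl⟩
    exact he

theorem FinalInv.output_perfect {s : State (V ⊕ V)} (h : FinalInv G c N s)
    (hf : ∀ v, ¬ s.Free v) : IsPerfectMatching univ G.edgeFinset s.output := by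
  have hmem : ∀ {e : Sym2 V}, e ∈ s.output ↔ e.map Sum.inl ∈ s.M := by
    intro e
    simp [State.output]
  refine ⟨⟨fun e he => ?_, fun e he f hf v hve hvf => ?_⟩, fun v _ => ?_⟩
  · have := h.good.rcs.matching.1 (hmem.1 he)
    rw [h.edges, mem_image] at this
    obtain ⟨e', he', heq⟩ := this
    rwa [Sym2.map.injective Sum.inl_injective heq] at he'
  · refine Sym2.map.injective Sum.inl_injective (h.good.rcs.matching.2 _ (hmem.1 he) _
      (hmem.1 hf) (Sum.inl v) ?_ ?_)
    · exact Sym2.mem_map.2 ⟨v, hve, rfl⟩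
    · exact Sym2.mem_map.2 ⟨v, hvf, rfl⟩
  · have h1 := hf (Sum.inl v)
    unfold State.Free at h1
    push Not at h1
    obtain ⟨e, he, hve⟩ := h1 (h.graph.vertices v)
    rw [h.matching_eq, mem_image] at he
    obtain ⟨e', he', rfl⟩ := he
    obtain ⟨u, hu, huv⟩ := Sym2.mem_map.1 hve
    cases huv
    exact ⟨e', he', hu⟩

/-- A perfect matching covers every vertex once, so the vertex terms always sum to the same constant
`p`. After all scales the quotient in `GraphInv` is the full extended weight. -/
theorem FinalInv.exists_weight {s : State (V ⊕ V)} (h : FinalInv G c N s) :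
    ∃ p : ℤ, ∀ M, IsPerfectMatching univ G.edgeFinset M →
      ∑ e ∈ M.image (Sym2.map Sum.inl), s.w e = 2 * (∑ e ∈ M, extWeight c e : ℕ) - p := by
  obtain ⟨π, hπ⟩ := h.graph.weight
  refine ⟨∑ v, π v, fun M hM => ?_⟩
  have hcover : M.biUnion (fun e => e.toFinset) = univ := by
    ext v
    simpa using hM.2 v (mem_univ v)
  rw [sum_image (Sym2.map.injective Sum.inl_injective).injOn, ← hcover, ← sum_endSum
    (fun e he => G.not_isDiag_of_mem_edgeFinset (hM.1.1 he)) hM.1.2, Nat.cast_sum, mul_sum,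
    ← sum_sub_distrib]
  refine sum_congr rfl fun e he => ?_
  have he' := G.mem_edgeFinset.1 (hM.1.1 he)
  induction e with
  | _ u v =>
  rw [Sym2.map_mk, hπ u v he', Nat.sub_self, pow_zero, Nat.div_one, endSum_mk]
  ring

theorem FinalInv.weight_le {s : State (V ⊕ V)} (h : FinalInv G c N s) (hf : ∀ v, ¬ s.Free v)
    {M' : Finset (Sym2 (V ⊕ V))} (hM' : IsPerfectMatching s.U s.E M') :
    ∑ e ∈ M', s.w e ≤ (∑ e ∈ s.M, s.w e) + Fintype.card V := by
  have h1 := h.good.weight_le hM'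
  have h2 : s.freeSet = ∅ := by
    ext v
    simpa [mem_freeSet] using hf v
  have h3 : s.U.card = Fintype.card V := by
    rw [h.vertices, card_image_of_injective _ Sum.inl_injective, card_univ]
  rwa [h2, sum_empty, add_zero, h3] at h1

/-- The constant `p` cancels, and dividing the error `n` by the factor 2 gives `n / 2`. -/
theorem FinalInv.extWeight_le {s : State (V ⊕ V)} (h : FinalInv G c N s) (hf : ∀ v, ¬ s.Free v)
    {M' : Finset (Sym2 V)} (hM' : IsPerfectMatching univ G.edgeFinset M') :
    ∑ e ∈ M', extWeight c e ≤ (∑ e ∈ s.output, extWeight c e) + Fintype.card V / 2 := by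
  have h1 := image_perfect hM'
  rw [← h.vertices, ← h.edges] at h1
  have h2 := h.weight_le hf h1
  obtain ⟨p, hp⟩ := h.exists_weight
  rw [hp M' hM', h.matching_eq, hp _ (h.output_perfect hf)] at h2
  omega

/-- Differences of extended weights are multiples of `n / 2 + 1`, so an excess of at most `n / 2` is
no excess. -/
theorem isMaxWeightPerfectMatching_of_extWeight_le {M : Finset (Sym2 V)}
    (hM : IsPerfectMatching univ G.edgeFinset M)
    (h : ∀ M', IsPerfectMatching univ G.edgeFinset M' →
      ∑ e ∈ M', extWeight c e ≤ (∑ e ∈ M, extWeight c e) + Fintype.card V / 2) :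
    IsMaxWeightPerfectMatching univ G.edgeFinset c M := by
  refine ⟨hM, fun M' hM' => ?_⟩
  have h1 := h M' hM'
  unfold extWeight at h1
  rw [← mul_sum, ← mul_sum] at h1
  by_contra hlt
  have h2 := Nat.mul_le_mul_left (Fintype.card V / 2 + 1) (Nat.succ_le_of_lt (not_le.1 hlt))
  rw [Nat.mul_succ] at h2
  omega

end Termination

end MWPM

end

theorem mainTheorem3 {V : Type*} [Fintype V] [DecidableEq V] (G : SimpleGraph V)
    [DecidableRel G.Adj] (c : Sym2 V → ℕ) (N τ : ℕ) (hN : ∀ e ∈ G.edgeSet, c e ≤ N)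
    (hG : ∃ M, MWPM.IsPerfectMatching Finset.univ G.edgeFinset M) :
    -- every execution terminates
    Acc (fun x' x => MWPM.Step c N τ x x') (.scaleEnd 0, MWPM.initialState G) ∧
    -- relaxed complementary slackness is maintained
    (∀ p s, MWPM.Reachable G c N τ (p, s) → s.RCS) ∧
    -- after every scale, the matching is perfect in the current (supplemented) graph
    (∀ i s, 1 ≤ i → MWPM.Reachable G c N τ (.scaleEnd i, s) →
      MWPM.IsPerfectMatching s.U s.E s.M) ∧
    -- an execution can stop only at the end of the algorithm, and there
    (∀ p s, MWPM.Reachable G c N τ (p, s) → (¬ ∃ x, MWPM.Step c N τ (p, s) x) →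
      p = .done ∧
      -- the final matching is within `n` of optimal for the current weights,
      (∀ M', MWPM.IsPerfectMatching s.U s.E M' →
        ∑ e ∈ M', s.w e ≤ (∑ e ∈ s.M, s.w e) + Fintype.card V) ∧
      -- it is within `n / 2` of optimal for the extended weights,
      (∀ M', MWPM.IsPerfectMatching Finset.univ G.edgeFinset M' →
        ∑ e ∈ M', MWPM.extWeight c e ≤
          (∑ e ∈ s.output, MWPM.extWeight c e) + Fintype.card V / 2) ∧
      -- and it is a maximum weight perfect matching
      MWPM.IsMaxWeightPerfectMatching Finset.univ G.edgeFinset c s.output) ∧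
    -- an error of at most `n / 2` for the extended weights forces exact optimality
    (∀ M, MWPM.IsPerfectMatching Finset.univ G.edgeFinset M →
      (∀ M', MWPM.IsPerfectMatching Finset.univ G.edgeFinset M' →
        ∑ e ∈ M', MWPM.extWeight c e ≤
          (∑ e ∈ M, MWPM.extWeight c e) + Fintype.card V / 2) →
      MWPM.IsMaxWeightPerfectMatching Finset.univ G.edgeFinset c M) := by
  obtain ⟨M₀, hM₀⟩ := id hG
  refine ⟨MWPM.Inv.acc hM₀ _ (MWPM.Inv.initial hN), fun p s h => (h.inv hN).good.rcs,
    fun i s hi h => (h.inv hN).2.2.2 hi, fun p s h hstuck => ?_, fun M hM h =>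
      MWPM.isMaxWeightPerfectMatching_of_extWeight_le hM h⟩
  have hinv := h.inv hN
  obtain rfl : p = .done := by
    by_contra hp
    exact hstuck (hinv.progress hp)
  obtain ⟨hfin, hfree⟩ := hinv
  exact ⟨rfl, fun M' hM' => hfin.weight_le hfree hM', fun M' hM' => hfin.extWeight_le hfree hM',
    MWPM.isMaxWeightPerfectMatching_of_extWeight_le (hfin.output_perfect hfree)
      fun M' hM' => hfin.extWeight_le hfree hM'⟩
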